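/- Let $0<\varrho<1$, $A=\{z\in\mathbb C:\varrho<|z|<1\}$, and let $p,q\in\mathbb Z$. Let $\mathcal I_{p,q}$ be the set of $u\in H^1(A,\mathbb C)$ whose trace satisfies $|u|=1$ a.e. on $\partial A$ and has degree $p$ on the circle $\{|z|=1\}$ and degree $q$ on the circle $\{|z|=\varrho\}$, both circles being oriented counter-clockwise. Here the degree of $g\in\mathcal C^\infty(\Gamma,\mathbb S^1)$ is $\frac1{2\pi}\int_\Gamma g\wedge\partial_\tau g\,d\tau$, where $a\wedge b=\det(a,b)$, and it is extended to $g\in H^{1/2}(\Gamma,\mathbb S^1)$ by density and continuity. Let $u\in\mathcal I_{p,q}$ solve the semi-stiff problem $$\Delta u=0\ \text{ in }A,\qquad |u|=1\ \text{ on }\partial A,\qquad u\wedge\partial_\nu u=0\ \text{ on }\partial A,$$ where the last condition is understood in the weak sense: $\int_A (u\wedge\nabla u)\cdot\nabla\psi\,dx=0$ for all $\psi\in\mathcal C^\infty(\overline A,\mathbb R)$. Let $\mathcal H_u=(\partial_z u)\,\overline{(\partial_{\bar z}u)}$ be the coefficient of the Hopf quadratic differential of $u$. Then there is a constant $c\in\mathbb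 R$ such that $\mathcal H_u(z)=c/z^2$ for all $z\in A$, and if $c\neq0$, then $p=q$. -/

import Mathlib

open Complex MeasureTheory Filter Set
open scoped Topology ContDiff ComplexConjugate

noncomputable section

namespace SemiStiff

/-- The annulus `A = {z : ϱ < |z| < 1}`. Its boundary consists of the unit circle (`∂Ω`) and the
circle `C_ϱ` of radius `ϱ` (`∂ω`). -/
def annulus (ϱ : ℝ) : Set ℂ := {z | ϱ < ‖z‖ ∧ ‖z‖ < 1}

/-- The vector product `a ∧ b = a₁ b₂ - a₂ b₁ = det (a, b)` of two complex numbers. -/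
def wedge (a b : ℂ) : ℝ := a.re * b.im - a.im * b.re

/-- The partial derivative `∂ₓ u`. -/
def dx (u : ℂ → ℂ) (z : ℂ) : ℂ := fderiv ℝ u z 1

/-- The partial derivative `∂_y u`. -/
def dy (u : ℂ → ℂ) (z : ℂ) : ℂ := fderiv ℝ u z Complex.I

/-- The Wirtinger derivative `∂_z u = (∂ₓ u - i ∂_y u) / 2`. -/
def dz (u : ℂ → ℂ) (z : ℂ) : ℂ := (dx u z - Complex.I * dy u z) / 2

/-- The Wirtinger derivative `∂_z̄ u = (∂ₓ u + i ∂_y u) / 2`. -/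
def dzbar (u : ℂ → ℂ) (z : ℂ) : ℂ := (dx u z + Complex.I * dy u z) / 2

/-- The coefficient `H_u(z) = ∂_z u · conj (∂_z̄ u)` of the Hopf quadratic differential
`H_u(z) (dz)²`. -/
def hopf (u : ℂ → ℂ) (z : ℂ) : ℂ := dz u z * conj (dzbar u z)

/-- Membership in `H¹(A, ℂ)` for functions that are `C¹` in the open annulus `A` (the weak gradient
of such a function is its classical one): `u` and `∇u` are square integrable on `A`. All functions
considered below are harmonic in `A`, hence `C¹` there; nothing is assumed up to the boundary. -/
structure MemH1 (ϱ : ℝ) (u : ℂ → ℂ) : Prop where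
  contDiffOn : ContDiffOn ℝ 1 u (annulus ϱ)
  memLp : MemLp u 2 (volume.restrict (annulus ϱ))
  memLp_fderiv : MemLp (fderiv ℝ u) 2 (volume.restrict (annulus ϱ))

/-- Lebesgue measure on the interval `(0, 2π]` of angles. Functions on a circle centred at `0` are
written as functions of the angle `θ`, so that increasing `θ` is the counter-clockwise
orientation. -/
def angleMeasure : Measure ℝ := volume.restrict (Ioc 0 (2 * Real.pi))

/-- `g` is the `L²` limit of the functions `θ ↦ u (r e^{iθ})` as `r` runs along the filter `l`.
For `u ∈ H¹(A)` as above, `l = 𝓝[<] 1` gives the Sobolev trace of `u` on the unit circle and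
`l = 𝓝[>] ϱ` the one on `C_ϱ`. -/
def IsTrace (l : Filter ℝ) (u : ℂ → ℂ) (g : ℝ → ℂ) : Prop :=
  MemLp g 2 angleMeasure ∧
    Tendsto (fun r : ℝ => eLpNorm (fun θ : ℝ => u (circleMap 0 r θ) - g θ) 2 angleMeasure) l (𝓝 0)

/-- The square of the `H^{1/2}` norm of a function on the circle, `∑ₙ (1 + |n|) |ĝ(n)|²`. -/
def halfNormSq (g : ℝ → ℂ) : ENNReal :=
  ∑' n : ℤ, ENNReal.ofReal ((1 + |(n : ℝ)|) * ‖fourierCoeffOn Real.two_pi_pos g n‖ ^ 2)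

/-- Smooth maps from the circle to the unit circle `𝕊¹`. -/
structure IsSmoothCircleMap (h : ℝ → ℂ) : Prop where
  contDiff : ContDiff ℝ ∞ h
  periodic : Function.Periodic h (2 * Real.pi)
  norm_eq_one : ∀ θ, ‖h θ‖ = 1

/-- The degree `(1 / 2π) ∫ h ∧ ∂_τ h dτ` of a smooth circle-valued map. The integral does not
depend on the radius of the circle: it is `∫₀^{2π} h ∧ h' dθ`. -/
def smoothDegree (h : ℝ → ℂ) : ℝ :=
  (2 * Real.pi)⁻¹ * ∫ θ in (0 : ℝ)..(2 * Real.pi), wedge (h θ) (deriv h θ)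

/-- The map `g ∈ H^{1/2}(𝕊¹, 𝕊¹)` has degree `d`: the degree is extended from smooth maps by
density and continuity with respect to strong `H^{1/2}` convergence. -/
def HasDegree (g : ℝ → ℂ) (d : ℤ) : Prop :=
  ∃ h : ℕ → ℝ → ℂ, (∀ k, IsSmoothCircleMap (h k)) ∧
    Tendsto (fun k => halfNormSq (fun θ => h k θ - g θ)) atTop (𝓝 0) ∧
    Tendsto (fun k => smoothDegree (h k)) atTop (𝓝 (d : ℝ))

/-- The class `𝓘_{p,q}`: `u ∈ H¹(A, ℂ)`, the trace of `u` has modulus one a.e. on `∂A`, and it has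
degree `p` on the unit circle and degree `q` on `C_ϱ` (both oriented counter-clockwise). -/
def MemClass (ϱ : ℝ) (p q : ℤ) (u : ℂ → ℂ) : Prop :=
  MemH1 ϱ u ∧ ∃ gout gin : ℝ → ℂ,
    IsTrace (𝓝[<] 1) u gout ∧ IsTrace (𝓝[>] ϱ) u gin ∧
    (∀ᵐ θ ∂angleMeasure, ‖gout θ‖ = 1) ∧ (∀ᵐ θ ∂angleMeasure, ‖gin θ‖ = 1) ∧
    HasDegree gout p ∧ HasDegree gin q

/-- The weak form of `u ∧ ∂_ν u = 0` on `∂A` for `u ∈ H¹(A, ℂ)` harmonic in `A`: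
`∫_A (u ∧ ∇u) · ∇ψ = 0` for all `ψ ∈ C^∞(closure A, ℝ)`. This is also the criticality of `u` for
the Dirichlet energy with respect to the variations `u e^{itψ}`. -/
def WeakSemiStiffNeumann (ϱ : ℝ) (u : ℂ → ℂ) : Prop :=
  ∀ ψ : ℂ → ℝ, ContDiff ℝ ∞ ψ →
    ∫ z in annulus ϱ, (wedge (u z) (dx u z) * fderiv ℝ ψ z 1 +
      wedge (u z) (dy u z) * fderiv ℝ ψ z Complex.I) = 0

/-- `u` is a solution in `𝓘_{p,q}` of the semi-stiff problem: `Δu = 0` in `A`, `|u| = 1` a.e. on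
`∂A` (part of the membership in `𝓘_{p,q}`), `u ∧ ∂_ν u = 0` on `∂A`. -/
structure IsSolution (ϱ : ℝ) (p q : ℤ) (u : ℂ → ℂ) : Prop where
  memClass : MemClass ϱ p q u
  harmonic : InnerProductSpace.HarmonicOnNhd u (annulus ϱ)
  neumann : WeakSemiStiffNeumann ϱ u

end SemiStiff

end

/-!
The proof works in the logarithmic coordinate `z = e^ζ`, `ζ = x + iθ`, which turns the annulus into
the strip `log ϱ < x < 0` with period `2πi`. For `v (ζ) = u (e^ζ)` the functions `f = ∂_ζ v` and
`g = conj (∂_ζ̄ v)` are holomorphic, and `f g = z² H_u(z)`. If `Im (f g)` tends to zero uniformly at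
both boundary lines, then the relations between the Laurent coefficients of `f g` obtained on the
two lines force `f g` to be a real constant (`exists_hopf_const`). Since
`|v|² f g = (conj v · f) (v g)`, where `v g` is the analogue of `conj v · f` for the map `conj v`,
everything comes down to boundary regularity: `f` and `g` are bounded, `|v| → 1` and
`Im (conj v · f) → 0` uniformly at a boundary line. Only the line `x = 0` has to be treated; the
reflection `ζ ↦ log ϱ - conj ζ` exchanges the two lines.

Boundary regularity. Finite energy and the trace condition give `|v| → 1` uniformly
(`EndData.eventually_norm_v`). The form `-2 Re (conj v · f) dx + 2 Im (conj v · f) dθ` is closed,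
and the weak Neumann condition makes it exact, with a potential `k` that vanishes at the boundary.
It satisfies `|∇k| = 2 |v| |f|` and `Δk = -4 |f|²`, an equation with quadratic right-hand side
`-|∇k|² / |v|²`, so that smallness of `k` leads to the hole-filling inequality `3/4 T ≤ |x| |T'|`
for the energy `T(x)` of `k` in `(x, 0)`; hence `T = O(|x|^{3/4})` (`EndData.exists_energy_decay`).
The moments `∫ v² conj (f e^{nζ}) dθ` have an `x`-derivative quadratic in `f`, so they are
`O(n^{-3/4})`; as `f` and `v² conj f` agree at the boundary in the sense of Fourier coefficients, so
are the Laurent coefficients of `f`. Those of `v` are then `O(n^{-7/4})`, and comparing `f` with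
`v² conj f` once more improves the rate for `f` to the summable `O(n^{-5/4})`
(`EndData.exists_fc_f_le_five_quarters`). This gives the bounds and, by dominated convergence for
Fourier series, the uniform boundary condition (`EndData.eventually_im_le`).

The degrees. In terms of Fourier coefficients the `H^{1/2}` degree is `∑ n |gₙ|²`, and the decay of
the coefficients of `v` makes it the limit of the degree integrals of `v` over circles. If the
constant `c = f g` is not zero, then `conj v · f` is bounded below and nearly real at the boundary,
so it does not wind, and the degree of `v` is the winding number of `f`
(`EndData.tendsto_integral_wedge`). The latter does not depend on the circle, since `f` has no
zeros; at the inner line the role of `f` is played by `-conj g`, which winds like `f` because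
`g = c / f`. Hence `p = q` (`degree_eq_of_hopf_ne_zero`).
-/

namespace SemiStiff

/-! ### Fourier coefficients of functions of the angle -/

/-- The exponential `e^{inθ}`. -/
noncomputable def ex (n : ℤ) (θ : ℝ) : ℂ := Complex.exp (n * θ * I)

/-- The `n`-th Fourier coefficient `(2π)⁻¹ ∫₀^{2π} φ(θ) e^{-inθ} dθ`. -/
noncomputable def fc (φ : ℝ → ℂ) (n : ℤ) : ℂ := fourierCoeffOn Real.two_pi_pos φ n

lemma norm_ex (n : ℤ) (θ : ℝ) : ‖ex n θ‖ = 1 := by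
  have : (n : ℂ) * θ * I = ((n * θ : ℝ) : ℂ) * I := by push_cast; ring
  rw [ex, this, Complex.norm_exp_ofReal_mul_I]

lemma ex_zero (θ : ℝ) : ex 0 θ = 1 := by simp [ex]

lemma ex_add (m n : ℤ) (θ : ℝ) : ex (m + n) θ = ex m θ * ex n θ := by
  simp only [ex, ← Complex.exp_add]; push_cast; ring_nf

lemma conj_ex (n : ℤ) (θ : ℝ) : conj (ex n θ) = ex (-n) θ := by
  simp only [ex, ← Complex.exp_conj]; simp

lemma continuous_ex (n : ℤ) : Continuous (ex n) := by unfold ex; fun_prop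

lemma ex_periodic (n : ℤ) : Function.Periodic (ex n) (2 * Real.pi) := fun θ => by
  have : (n : ℂ) * ((θ + 2 * Real.pi : ℝ) : ℂ) * I = n * θ * I + n * (2 * Real.pi * I) := by
    push_cast; ring
  rw [ex, this, Complex.exp_add, Complex.exp_int_mul_two_pi_mul_I, mul_one, ex]

lemma hasDerivAt_ex (n : ℤ) (θ : ℝ) : HasDerivAt (ex n) (n * I * ex n θ) θ := by
  have h : HasDerivAt (fun t : ℝ => (n : ℂ) * t * I) (n * 1 * I) θ :=
    ((hasDerivAt_id θ).ofReal_comp.const_mul (n : ℂ)).mul_const I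
  have := h.cexp
  unfold ex
  convert this using 1
  ring

lemma fourier_eq_ex (n : ℤ) (θ : ℝ) :
    fourier n (θ : AddCircle (2 * Real.pi - 0)) = ex n θ := by
  rw [fourier_coe_apply, ex]
  congr 1
  have : (Real.pi : ℂ) ≠ 0 := by exact_mod_cast Real.pi_ne_zero
  push_cast
  field_simp
  ring

lemma fc_eq (φ : ℝ → ℂ) (n : ℤ) :
    fc φ n = (2 * Real.pi : ℂ)⁻¹ * ∫ θ in (0 : ℝ)..(2 * Real.pi), ex (-n) θ * φ θ := by
  rw [fc, fourierCoeffOn_eq_integral]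
  simp only [fourier_eq_ex, smul_eq_mul]
  rw [Complex.real_smul]
  push_cast
  simp

lemma integral_ex_mul (φ : ℝ → ℂ) (n : ℤ) :
    ∫ θ in (0 : ℝ)..(2 * Real.pi), ex (-n) θ * φ θ = 2 * Real.pi * fc φ n := by
  have : (Real.pi : ℂ) ≠ 0 := by exact_mod_cast Real.pi_ne_zero
  rw [fc_eq]; field_simp

lemma norm_fc_le_integral {φ : ℝ → ℂ} (n : ℤ) :
    ‖fc φ n‖ ≤ (2 * Real.pi)⁻¹ * ∫ θ in (0 : ℝ)..(2 * Real.pi), ‖φ θ‖ := by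
  rw [fc_eq, norm_mul]
  have h1 : ‖(2 * Real.pi : ℂ)⁻¹‖ = (2 * Real.pi)⁻¹ := by
    rw [norm_inv, norm_mul, Complex.norm_real, Real.norm_of_nonneg Real.pi_pos.le]; simp
  rw [h1]
  gcongr
  refine (intervalIntegral.norm_integral_le_integral_norm Real.two_pi_pos.le).trans_eq ?_
  simp [norm_ex]

lemma norm_fc_le {φ : ℝ → ℂ} {M : ℝ} (h : ∀ θ, ‖φ θ‖ ≤ M) (n : ℤ) : ‖fc φ n‖ ≤ M := by
  rw [fc_eq, norm_mul]
  have h1 : ‖(2 * Real.pi : ℂ)⁻¹‖ = (2 * Real.pi)⁻¹ := by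
    rw [norm_inv, norm_mul, Complex.norm_real, Real.norm_of_nonneg Real.pi_pos.le]; simp
  rw [h1]
  have h2 : ‖∫ θ in (0 : ℝ)..(2 * Real.pi), ex (-n) θ * φ θ‖ ≤ M * |2 * Real.pi - 0| :=
    intervalIntegral.norm_integral_le_of_norm_le_const fun θ _ => by
      rw [norm_mul, norm_ex, one_mul]; exact h θ
  rw [sub_zero, abs_of_pos Real.two_pi_pos] at h2
  rw [inv_mul_le_iff₀ Real.two_pi_pos]
  linarith

lemma fc_add {φ ψ : ℝ → ℂ} (hφ : Continuous φ) (hψ : Continuous ψ) (n : ℤ) :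
    fc (fun θ => φ θ + ψ θ) n = fc φ n + fc ψ n := by
  simp only [fc_eq, mul_add]
  rw [intervalIntegral.integral_add, mul_add]
  · exact ((continuous_ex _).mul hφ).intervalIntegrable _ _
  · exact ((continuous_ex _).mul hψ).intervalIntegrable _ _

lemma fc_const_mul (φ : ℝ → ℂ) (c : ℂ) (n : ℤ) :
    fc (fun θ => c * φ θ) n = c * fc φ n := fourierCoeffOn.const_mul φ c n _

lemma fc_sub {φ ψ : ℝ → ℂ} (hφ : Continuous φ) (hψ : Continuous ψ) (n : ℤ) :
    fc (fun θ => φ θ - ψ θ) n = fc φ n - fc ψ n := by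
  have h := fc_add (ψ := fun θ => -1 * ψ θ) hφ (by fun_prop) n
  rw [fc_const_mul] at h
  simpa [sub_eq_add_neg] using h

lemma fc_conj (φ : ℝ → ℂ) (n : ℤ) : fc (fun θ => conj (φ θ)) n = conj (fc φ (-n)) := by
  rw [fc_eq, fc_eq, map_mul, intervalIntegral.integral_of_le Real.two_pi_pos.le,
    intervalIntegral.integral_of_le Real.two_pi_pos.le, ← integral_conj]
  simp [conj_ex, Complex.conj_ofNat]

/-- Integration by parts over a period. -/
lemma integral_mul_deriv_periodic {φ ψ φ' ψ' : ℝ → ℂ} (hφ : ∀ θ, HasDerivAt φ (φ' θ) θ)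
    (hψ : ∀ θ, HasDerivAt ψ (ψ' θ) θ) (hφ' : Continuous φ') (hψ' : Continuous ψ')
    (pφ : φ (2 * Real.pi) = φ 0) (pψ : ψ (2 * Real.pi) = ψ 0) :
    ∫ θ in (0 : ℝ)..(2 * Real.pi), φ θ * ψ' θ = -∫ θ in (0 : ℝ)..(2 * Real.pi), φ' θ * ψ θ := by
  rw [intervalIntegral.integral_mul_deriv_eq_deriv_mul (fun θ _ => hφ θ) (fun θ _ => hψ θ)
    (hφ'.intervalIntegrable _ _) (hψ'.intervalIntegrable _ _), pφ, pψ]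
  ring

lemma fc_deriv {φ φ' : ℝ → ℂ} (hφ : ∀ θ, HasDerivAt φ (φ' θ) θ) (hφ' : Continuous φ')
    (pφ : φ (2 * Real.pi) = φ 0) (n : ℤ) : fc φ' n = n * I * fc φ n := by
  rw [fc_eq, fc_eq, integral_mul_deriv_periodic (fun θ => hasDerivAt_ex (-n) θ) hφ
    (by have := continuous_ex (-n); fun_prop) hφ' (by simpa using ex_periodic (-n) 0) pφ]
  simp only [mul_assoc]
  rw [intervalIntegral.integral_const_mul, intervalIntegral.integral_const_mul]
  push_cast
  ring

lemma memLp_two_of_continuous {φ : ℝ → ℂ} (hφ : Continuous φ) :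
    MemLp φ 2 (volume.restrict (Ioc 0 (2 * Real.pi))) := by
  obtain ⟨C, hC⟩ := (isCompact_Icc (a := (0 : ℝ)) (b := 2 * Real.pi)).exists_bound_of_continuousOn
    hφ.continuousOn
  refine MemLp.of_bound hφ.aestronglyMeasurable C ?_
  refine (ae_restrict_iff' measurableSet_Ioc).2 (ae_of_all _ fun θ hθ => hC θ ⟨hθ.1.le, hθ.2⟩)

lemma hasSum_sq_fc {φ : ℝ → ℂ} (hφ : Continuous φ) :
    HasSum (fun n => ‖fc φ n‖ ^ 2)
      ((2 * Real.pi)⁻¹ * ∫ θ in (0 : ℝ)..(2 * Real.pi), ‖φ θ‖ ^ 2) := by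
  have := hasSum_sq_fourierCoeffOn Real.two_pi_pos (memLp_two_of_continuous hφ)
  simpa [fc] using this

lemma hasSum_fc {φ : ℝ → ℂ} (hφ : Continuous φ) (pφ : Function.Periodic φ (2 * Real.pi))
    (hs : Summable fun n => ‖fc φ n‖) (θ : ℝ) : HasSum (fun n => fc φ n * ex n θ) (φ θ) := by
  have : Fact (0 < 2 * Real.pi - 0) := ⟨by simpa using Real.two_pi_pos⟩
  have pφ' : Function.Periodic φ (2 * Real.pi - 0) := by simpa using pφ
  let Φ : C(AddCircle (2 * Real.pi - 0), ℂ) :=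
    ⟨pφ'.lift, continuous_coinduced_dom.mpr (by exact hφ)⟩
  have hΦ : ∀ t : ℝ, Φ (t : AddCircle (2 * Real.pi - 0)) = φ t := fun t => rfl
  have hc : ∀ n, fourierCoeff Φ n = fc φ n := fun n => by
    rw [fourierCoeff_eq_intervalIntegral _ _ 0, fc, fourierCoeffOn_eq_integral]
    simp only [hΦ, zero_add, sub_zero]
  have h := has_pointwise_sum_fourier_series_of_summable (f := Φ)
    (by refine Summable.of_norm ?_; simpa only [hc] using hs) (θ : AddCircle (2 * Real.pi - 0))
  simpa only [hc, hΦ, fourier_eq_ex, smul_eq_mul] using h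

lemma norm_le_tsum_fc {φ : ℝ → ℂ} (hφ : Continuous φ) (pφ : Function.Periodic φ (2 * Real.pi))
    (hs : Summable fun n => ‖fc φ n‖) (θ : ℝ) : ‖φ θ‖ ≤ ∑' n, ‖fc φ n‖ := by
  rw [← (hasSum_fc hφ pφ hs θ).tsum_eq]
  refine (norm_tsum_le_tsum_norm ?_).trans_eq ?_
  · simpa [norm_ex] using hs
  · simp [norm_ex]

/-- The Fourier coefficients of a product are the convolution of the Fourier coefficients, when
those of one factor are absolutely summable. -/
lemma hasSum_fc_mul {φ ψ : ℝ → ℂ} (hφ : Continuous φ) (pφ : Function.Periodic φ (2 * Real.pi))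
    (hs : Summable fun n => ‖fc φ n‖) (hψ : Continuous ψ) (n : ℤ) :
    HasSum (fun m => fc φ m * fc ψ (n - m)) (fc (fun θ => φ θ * ψ θ) n) := by
  obtain ⟨C, hC⟩ := (isCompact_Icc (a := (0 : ℝ)) (b := 2 * Real.pi)).exists_bound_of_continuousOn
    hψ.continuousOn
  have key : HasSum (fun m => ∫ θ in (0 : ℝ)..(2 * Real.pi), ex (-n) θ * (fc φ m * ex m θ * ψ θ))
      (∫ θ in (0 : ℝ)..(2 * Real.pi), ex (-n) θ * (φ θ * ψ θ)) := by
    refine intervalIntegral.hasSum_integral_of_dominated_convergence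
      (fun m _ => ‖fc φ m‖ * C) (fun m => ?_) (fun m => ?_) ?_ ?_ ?_
    · have := continuous_ex (-n); have := continuous_ex m
      exact Continuous.aestronglyMeasurable (by fun_prop)
    · refine ae_of_all _ fun θ hθ => ?_
      rw [uIoc_of_le Real.two_pi_pos.le] at hθ
      rw [norm_mul, norm_ex, one_mul, norm_mul, norm_mul, norm_ex, mul_one]
      gcongr
      exact hC θ ⟨hθ.1.le, hθ.2⟩
    · exact ae_of_all _ fun θ _ => hs.mul_right C
    · simp
    · refine ae_of_all _ fun θ _ => ?_
      exact ((hasSum_fc hφ pφ hs θ).mul_right (ψ θ)).mul_left _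
  have h2 := key.mul_left (2 * Real.pi : ℂ)⁻¹
  rw [← fc_eq] at h2
  have e : (fun m => fc φ m * fc ψ (n - m)) = fun m => (2 * Real.pi : ℂ)⁻¹ *
      ∫ θ in (0 : ℝ)..(2 * Real.pi), ex (-n) θ * (fc φ m * ex m θ * ψ θ) := by
    funext m
    have : ∀ θ, ex (-n) θ * (fc φ m * ex m θ * ψ θ) = fc φ m * (ex (-(n - m)) θ * ψ θ) :=
      fun θ => by rw [show -(n - m) = -n + m by ring, ex_add]; ring
    simp only [this]
    rw [intervalIntegral.integral_const_mul, fc_eq ψ]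
    ring
  rw [e]
  exact h2

/-! ### Polynomially decaying sequences and their convolution -/

/-- The weight `(1 + |n|)^{-s}`. -/
noncomputable def pw (s : ℝ) (n : ℤ) : ℝ := (1 + |(n : ℝ)|) ^ (-s)

lemma pw_pos (s : ℝ) (n : ℤ) : 0 < pw s n := Real.rpow_pos_of_pos (by positivity) _

lemma pw_neg (s : ℝ) (n : ℤ) : pw s (-n) = pw s n := by simp [pw]

lemma pw_add (s t : ℝ) (n : ℤ) : pw (s + t) n = pw s n * pw t n := by
  rw [pw, neg_add, Real.rpow_add (by positivity)]; rfl

lemma pw_le_pw {s t : ℝ} (h : t ≤ s) (n : ℤ) : pw s n ≤ pw t n :=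
  Real.rpow_le_rpow_of_exponent_le (by have := abs_nonneg (n : ℝ); linarith) (by linarith)

lemma pw_anti {s : ℝ} (hs : 0 ≤ s) {m n : ℤ} (h : |(m : ℝ)| ≤ |(n : ℝ)|) : pw s n ≤ pw s m :=
  Real.rpow_le_rpow_of_nonpos (by positivity) (by linarith) (by linarith)

lemma summable_pw {s : ℝ} (hs : 1 < s) : Summable (pw s) := by
  have h : Summable fun n : ℕ => pw s n := by
    have := (summable_nat_add_iff 1).2 (Real.summable_nat_rpow.2 (by linarith : -s < -1))
    refine this.congr fun n => ?_
    simp [pw, add_comm]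
  refine Summable.of_nat_of_neg h ?_
  simpa only [pw_neg] using h

lemma pw_mul_pw_le {s : ℝ} (hs : 0 ≤ s) (k j : ℤ) :
    pw s j * pw s (k - j) ≤ 2 ^ s * pw s k * (pw s j + pw s (k - j)) := by
  have key : ∀ i : ℤ, 1 + |(k : ℝ)| ≤ 2 * (1 + |(i : ℝ)|) → pw s i ≤ 2 ^ s * pw s k := fun i hi => by
    have h1 : (2 : ℝ) ^ s * pw s k = ((1 + |(k : ℝ)|) / 2) ^ (-s) := by
      rw [Real.div_rpow (by positivity) (by norm_num), Real.rpow_neg (by norm_num : (0:ℝ) ≤ 2), pw]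
      field_simp
    rw [h1]
    exact Real.rpow_le_rpow_of_nonpos (by positivity) (by linarith) (by linarith)
  have h2 : |(k : ℝ)| ≤ |(j : ℝ)| + |((k - j : ℤ) : ℝ)| := by
    have := abs_add_le (j : ℝ) ((k - j : ℤ) : ℝ)
    rwa [← Int.cast_add, add_sub_cancel] at this
  have p1 := pw_pos s j
  have p2 := pw_pos s (k - j)
  have p3 : 0 < 2 ^ s * pw s k := mul_pos (Real.rpow_pos_of_pos (by norm_num) _) (pw_pos s k)
  rcases le_total |((k - j : ℤ) : ℝ)| |(j : ℝ)| with h | h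
  · have := key j (by have := abs_nonneg (j : ℝ); linarith)
    nlinarith
  · have := key (k - j) (by have := abs_nonneg (j : ℝ); linarith)
    nlinarith

lemma summable_pw_sub {s : ℝ} (hs : 1 < s) (k : ℤ) : Summable fun j => pw s (k - j) :=
  (Equiv.subLeft k).summable_iff.2 (summable_pw hs)

lemma tsum_pw_sub (s : ℝ) (k : ℤ) : ∑' j, pw s (k - j) = ∑' j, pw s j :=
  (Equiv.subLeft k).tsum_eq (pw s)

/-- The constant in the convolution estimate `norm_le_of_hasSum_conv`. -/
noncomputable def convC (s : ℝ) : ℝ := 2 ^ s * (2 * ∑' j, pw s j)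

lemma convC_nonneg (s : ℝ) : 0 ≤ convC s := by
  have : 0 ≤ ∑' j, pw s j := tsum_nonneg fun j => (pw_pos s j).le
  have : (0 : ℝ) ≤ 2 ^ s := by positivity
  unfold convC; positivity

/-- For `s > 1` the decay `(1 + |n|)^{-s}` is stable under convolution. -/
lemma norm_le_of_hasSum_conv {s : ℝ} (hs : 1 < s) {α β : ℤ → ℂ} {A B : ℝ}
    (hα : ∀ n, ‖α n‖ ≤ A * pw s n) (hβ : ∀ n, ‖β n‖ ≤ B * pw s n) {k : ℤ} {c : ℂ}
    (h : HasSum (fun m => α m * β (k - m)) c) : ‖c‖ ≤ A * B * convC s * pw s k := by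
  have hA : 0 ≤ A := nonneg_of_mul_nonneg_left ((norm_nonneg _).trans (hα 0)) (pw_pos s 0)
  have hB : 0 ≤ B := nonneg_of_mul_nonneg_left ((norm_nonneg _).trans (hβ 0)) (pw_pos s 0)
  have h1 : HasSum (fun m => A * B * (2 ^ s * pw s k * (pw s m + pw s (k - m))))
      (A * B * convC s * pw s k) := by
    have := (((summable_pw hs).hasSum.add (summable_pw_sub hs k).hasSum).mul_left
      (2 ^ s * pw s k)).mul_left (A * B)
    rw [show A * B * convC s * pw s k = A * B * (2 ^ s * pw s k *
      (∑' j, pw s j + ∑' j, pw s (k - j))) by rw [tsum_pw_sub, convC]; ring]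
    exact this
  have hb : ∀ m, ‖α m * β (k - m)‖ ≤ A * B * (2 ^ s * pw s k * (pw s m + pw s (k - m))) :=
      fun m => by
    rw [norm_mul]
    calc ‖α m‖ * ‖β (k - m)‖ ≤ (A * pw s m) * (B * pw s (k - m)) :=
          mul_le_mul (hα m) (hβ _) (norm_nonneg _) (mul_nonneg hA (pw_pos s m).le)
      _ = A * B * (pw s m * pw s (k - m)) := by ring
      _ ≤ _ := mul_le_mul_of_nonneg_left (pw_mul_pw_le (by linarith) k m) (by positivity)
  rw [← h.tsum_eq]
  exact tsum_of_norm_bounded h1 hb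

/-- The constant in the estimate `norm_le_of_hasSum_hankel`. -/
noncomputable def hankC : ℝ := (∑' j, pw (5 / 4) j) + 4 * (2 * ∑' j, pw (7 / 4) j)

/-- The gain of decay for Hankel sums `∑ₘ α_{n+m} β_m`, `n ≥ 0`, where `β` decays slowly only
towards `+∞`. -/
lemma norm_le_of_hasSum_hankel {α β : ℤ → ℂ} {A B : ℝ}
    (hα : ∀ n, ‖α n‖ ≤ A * pw (7 / 4) n) (hβ : ∀ n, 0 ≤ n → ‖β n‖ ≤ B * pw (3 / 4) n)
    (hβ' : ∀ n, n < 0 → ‖β n‖ ≤ B * pw (7 / 4) n) {n : ℤ} (hn : 0 ≤ n) {c : ℂ}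
    (h : HasSum (fun m => α (n + m) * β m) c) : ‖c‖ ≤ A * B * hankC * pw (5 / 4) n := by
  have hA : 0 ≤ A := nonneg_of_mul_nonneg_left ((norm_nonneg _).trans (hα 0)) (pw_pos _ 0)
  have hB : 0 ≤ B := nonneg_of_mul_nonneg_left ((norm_nonneg _).trans (hβ 0 le_rfl)) (pw_pos _ 0)
  have s1 : Summable (pw (5 / 4)) := summable_pw (by norm_num)
  have s2 : Summable (pw (7 / 4)) := summable_pw (by norm_num)
  have s3 : HasSum (fun m => pw (7 / 4) (n + m)) (∑' j, pw (7 / 4) j) := by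
    have e : (fun m => pw (7 / 4) (n + m)) = pw (7 / 4) ∘ (Equiv.addLeft n) := rfl
    rw [e, Equiv.hasSum_iff]
    exact s2.hasSum
  have h1 : HasSum (fun m => A * B * (pw (5 / 4) n *
      (pw (5 / 4) m + 4 * (pw (7 / 4) (n + m) + pw (7 / 4) m))))
      (A * B * hankC * pw (5 / 4) n) := by
    have := ((s1.hasSum.add ((s3.add s2.hasSum).mul_left 4)).mul_left (pw (5 / 4) n)).mul_left (A * B)
    rw [show A * B * hankC * pw (5 / 4) n = A * B * (pw (5 / 4) n * (∑' j, pw (5 / 4) j +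
      4 * (∑' j, pw (7 / 4) j + ∑' j, pw (7 / 4) j))) by rw [hankC]; ring]
    exact this
  have hb : ∀ m, ‖α (n + m) * β m‖ ≤ A * B * (pw (5 / 4) n *
      (pw (5 / 4) m + 4 * (pw (7 / 4) (n + m) + pw (7 / 4) m))) := fun m => by
    have q1 := pw_pos (5 / 4) n
    have q2 := pw_pos (5 / 4) m
    have q3 := pw_pos (7 / 4) (n + m)
    have q4 := pw_pos (7 / 4) m
    rw [norm_mul]
    rcases le_or_gt 0 m with hm | hm
    · have hn' : (0 : ℝ) ≤ n := by exact_mod_cast hn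
      have hm' : (0 : ℝ) ≤ m := by exact_mod_cast hm
      have e1 : pw (7 / 4) (n + m) ≤ pw (5 / 4) n * pw (1 / 2) m := by
        rw [show (7 / 4 : ℝ) = 5 / 4 + 1 / 2 by norm_num, pw_add]
        refine mul_le_mul (pw_anti (by norm_num) ?_) (pw_anti (by norm_num) ?_) (pw_pos _ _).le
          q1.le <;> push_cast <;> rw [abs_of_nonneg (by assumption), abs_of_nonneg (by linarith)] <;>
          linarith
      have e2 : pw (1 / 2) m * pw (3 / 4) m = pw (5 / 4) m := by rw [← pw_add]; norm_num
      calc ‖α (n + m)‖ * ‖β m‖ ≤ (A * pw (7 / 4) (n + m)) * (B * pw (3 / 4) m) :=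
            mul_le_mul (hα _) (hβ m hm) (norm_nonneg _) (mul_nonneg hA q3.le)
        _ = A * B * (pw (7 / 4) (n + m) * pw (3 / 4) m) := by ring
        _ ≤ A * B * ((pw (5 / 4) n * pw (1 / 2) m) * pw (3 / 4) m) := by
            gcongr; exact (pw_pos _ _).le
        _ = A * B * (pw (5 / 4) n * pw (5 / 4) m) := by rw [mul_assoc (pw _ _), e2]
        _ ≤ _ := by gcongr; linarith
    · have e := pw_mul_pw_le (s := 7 / 4) (by norm_num) n (-m)
      rw [sub_neg_eq_add, pw_neg] at e
      have e3 : (2 : ℝ) ^ (7 / 4 : ℝ) ≤ 4 := by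
        calc (2 : ℝ) ^ (7 / 4 : ℝ) ≤ 2 ^ (2 : ℝ) :=
              Real.rpow_le_rpow_of_exponent_le (by norm_num) (by norm_num)
          _ = 4 := by norm_num
      have e4 := pw_le_pw (by norm_num : (5 / 4 : ℝ) ≤ 7 / 4) n
      calc ‖α (n + m)‖ * ‖β m‖ ≤ (A * pw (7 / 4) (n + m)) * (B * pw (7 / 4) m) :=
            mul_le_mul (hα _) (hβ' m hm) (norm_nonneg _) (mul_nonneg hA q3.le)
        _ = A * B * (pw (7 / 4) m * pw (7 / 4) (n + m)) := by ring
        _ ≤ A * B * (2 ^ (7 / 4 : ℝ) * pw (7 / 4) n * (pw (7 / 4) m + pw (7 / 4) (n + m))) := by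
            gcongr
        _ ≤ A * B * (4 * pw (5 / 4) n * (pw (7 / 4) m + pw (7 / 4) (n + m))) := by
            have := (pw_pos (7 / 4) n).le
            gcongr
        _ ≤ _ := by
            refine mul_le_mul_of_nonneg_left ?_ (by positivity)
            nlinarith
  rw [← h.tsum_eq]
  exact tsum_of_norm_bounded h1 hb

/-! ### Integrals over circles as functions of the radial variable -/

lemma continuous_slice {X : Type*} [TopologicalSpace X] {φ : ℝ → ℝ → X} {a b x : ℝ}
    (hφ : ContinuousOn (Function.uncurry φ) (Ioo a b ×ˢ univ)) (hx : x ∈ Ioo a b) :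
    Continuous (φ x) := by
  have : φ x = Function.uncurry φ ∘ fun θ => (x, θ) := rfl
  rw [this]
  exact hφ.comp_continuous (by fun_prop) fun θ => ⟨hx, trivial⟩

lemma continuousOn_comp₁ {X Y : Type*} [TopologicalSpace X] [TopologicalSpace Y] {G : X → Y}
    (hG : Continuous G) {φ : ℝ → ℝ → X} {S : Set (ℝ × ℝ)}
    (hφ : ContinuousOn (Function.uncurry φ) S) :
    ContinuousOn (Function.uncurry fun x θ => G (φ x θ)) S := hG.comp_continuousOn hφ

/-- A function continuous on `(a, b) × ℝ` is bounded near each `{x} × [c, d]`. -/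
lemma exists_bound_nhds {E : Type*} [NormedAddCommGroup E] {φ : ℝ → ℝ → E} {a b x : ℝ}
    (hφ : ContinuousOn (Function.uncurry φ) (Ioo a b ×ˢ univ)) (hx : x ∈ Ioo a b) (c d : ℝ) :
    ∃ C, ∃ s ∈ 𝓝 x, s ⊆ Ioo a b ∧ Convex ℝ s ∧ ∀ y ∈ s, ∀ θ ∈ uIcc c d, ‖φ y θ‖ ≤ C := by
  obtain ⟨p, hp1, hp2⟩ := exists_between hx.1
  obtain ⟨q, hq1, hq2⟩ := exists_between hx.2
  obtain ⟨C, hC⟩ := ((isCompact_Icc (a := p) (b := q)).prod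
    (isCompact_uIcc (a := c) (b := d))).exists_bound_of_continuousOn
    (hφ.mono fun r hr => ⟨⟨hp1.trans_le hr.1.1, hr.1.2.trans_lt hq2⟩, trivial⟩)
  exact ⟨C, Icc p q, Icc_mem_nhds hp2 hq1, fun y hy => ⟨hp1.trans_le hy.1, hy.2.trans_lt hq2⟩,
    convex_Icc _ _, fun y hy θ hθ => hC (y, θ) ⟨hy, hθ⟩⟩

lemma continuousOn_circ {E : Type*} [NormedAddCommGroup E] [NormedSpace ℝ E] {φ : ℝ → ℝ → E}
    {a b : ℝ} (hφ : ContinuousOn (Function.uncurry φ) (Ioo a b ×ˢ univ)) :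
    ContinuousOn (fun x => ∫ θ in (0 : ℝ)..(2 * Real.pi), φ x θ) (Ioo a b) := by
  intro x hx
  refine ContinuousAt.continuousWithinAt ?_
  obtain ⟨C, s, hs, hsub, -, hC⟩ := exists_bound_nhds hφ hx 0 (2 * Real.pi)
  refine intervalIntegral.continuousAt_of_dominated_interval (bound := fun _ => C) ?_ ?_ ?_ ?_
  · filter_upwards [hs] with y hy
    exact (continuous_slice hφ (hsub hy)).aestronglyMeasurable
  · filter_upwards [hs] with y hy
    exact ae_of_all _ fun θ hθ => hC y hy θ (uIoc_subset_uIcc hθ)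
  · simp
  · refine ae_of_all _ fun θ _ => ?_
    have : ContinuousAt (Function.uncurry φ) (x, θ) :=
      hφ.continuousAt (prod_mem_nhds (Ioo_mem_nhds hx.1 hx.2) univ_mem)
    exact this.comp (f := fun y => (y, θ)) (by fun_prop)

lemma hasDerivAt_integral {E : Type*} [NormedAddCommGroup E] [NormedSpace ℝ E] {φ φ' : ℝ → ℝ → E}
    {a b x : ℝ} (c d : ℝ) (hφ : ∀ y ∈ Ioo a b, Continuous (φ y))
    (hφ' : ContinuousOn (Function.uncurry φ') (Ioo a b ×ˢ univ))
    (h : ∀ y ∈ Ioo a b, ∀ θ, HasDerivAt (fun t => φ t θ) (φ' y θ) y) (hx : x ∈ Ioo a b) :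
    HasDerivAt (fun y => ∫ θ in c..d, φ y θ) (∫ θ in c..d, φ' x θ) x := by
  obtain ⟨C, s, hs, hsub, -, hC⟩ := exists_bound_nhds hφ' hx c d
  refine (intervalIntegral.hasDerivAt_integral_of_dominated_loc_of_deriv_le
    (bound := fun _ => C) hs ?_ ?_ ?_ ?_ ?_ ?_).2
  · filter_upwards [hs] with y hy
    exact (hφ y (hsub hy)).aestronglyMeasurable
  · exact (hφ x hx).intervalIntegrable _ _
  · exact (continuous_slice hφ' hx).aestronglyMeasurable
  · exact ae_of_all _ fun θ hθ y hy => hC y hy θ (uIoc_subset_uIcc hθ)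
  · simp
  · exact ae_of_all _ fun θ _ y hy => h y (hsub hy) θ

/-- A function which is continuous in `θ` and has a jointly continuous `x`-derivative is jointly
continuous. -/
lemma continuousOn_uncurry_of_hasDerivAt {k Q : ℝ → ℝ → ℝ} {a b : ℝ}
    (hk : ∀ x ∈ Ioo a b, Continuous (k x))
    (hQ : ContinuousOn (Function.uncurry Q) (Ioo a b ×ˢ univ))
    (h : ∀ x ∈ Ioo a b, ∀ θ, HasDerivAt (fun t => k t θ) (Q x θ) x) :
    ContinuousOn (Function.uncurry k) (Ioo a b ×ˢ univ) := by
  rintro ⟨x, θ⟩ ⟨hx, -⟩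
  refine ContinuousAt.continuousWithinAt ?_
  obtain ⟨C, s, hs, hsub, hconv, hC⟩ := exists_bound_nhds hQ hx (θ - 1) (θ + 1)
  have hbound : ∀ᶠ p : ℝ × ℝ in 𝓝 (x, θ),
      ‖Function.uncurry k p - Function.uncurry k (x, θ)‖ ≤ C * ‖p.1 - x‖ + ‖k x p.2 - k x θ‖ := by
    filter_upwards [prod_mem_nhds hs (Icc_mem_nhds (by linarith : θ - 1 < θ)
      (by linarith : θ < θ + 1))] with p hp
    have h1 : ‖k p.1 p.2 - k x p.2‖ ≤ C * ‖p.1 - x‖ :=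
      hconv.norm_image_sub_le_of_norm_hasDerivWithin_le (f := fun t => k t p.2)
        (fun y hy => (h y (hsub hy) p.2).hasDerivWithinAt)
        (fun y hy => hC y hy p.2 (by rw [uIcc_of_le (by linarith)]; exact hp.2))
        (mem_of_mem_nhds hs) hp.1
    calc ‖k p.1 p.2 - k x θ‖ = ‖(k p.1 p.2 - k x p.2) + (k x p.2 - k x θ)‖ := by ring_nf
      _ ≤ _ := (norm_add_le _ _).trans (by linarith)
  rw [ContinuousAt, tendsto_iff_norm_sub_tendsto_zero]
  refine squeeze_zero' (Eventually.of_forall fun p => norm_nonneg _) hbound ?_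
  have hcont : Continuous fun p : ℝ × ℝ => C * ‖p.1 - x‖ + ‖k x p.2 - k x θ‖ := by
    have := hk x hx
    fun_prop
  simpa using hcont.tendsto (x, θ)

/-- The Cauchy–Schwarz inequality for continuous functions on an interval. -/
lemma sq_integral_mul_le {φ ψ : ℝ → ℝ} {a b : ℝ} (hab : a ≤ b) (hφ : ContinuousOn φ (Icc a b))
    (hψ : ContinuousOn ψ (Icc a b)) :
    (∫ t in a..b, φ t * ψ t) ^ 2 ≤ (∫ t in a..b, φ t ^ 2) * ∫ t in a..b, ψ t ^ 2 := by
  have i1 : IntervalIntegrable (fun t => φ t ^ 2) volume a b :=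
    (hφ.pow 2).intervalIntegrable_of_Icc hab
  have i2 : IntervalIntegrable (fun t => φ t * ψ t) volume a b :=
    (hφ.mul hψ).intervalIntegrable_of_Icc hab
  have i3 : IntervalIntegrable (fun t => ψ t ^ 2) volume a b :=
    (hψ.pow 2).intervalIntegrable_of_Icc hab
  have h : ∀ s : ℝ, 0 ≤ (∫ t in a..b, φ t ^ 2) * (s * s) + (2 * ∫ t in a..b, φ t * ψ t) * s +
      ∫ t in a..b, ψ t ^ 2 := fun s => by
    have e : (∫ t in a..b, φ t ^ 2) * (s * s) + (2 * ∫ t in a..b, φ t * ψ t) * s +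
        ∫ t in a..b, ψ t ^ 2 = ∫ t in a..b, (s * φ t + ψ t) ^ 2 := by
      have : ∀ t, (s * φ t + ψ t) ^ 2 = (s * s) * φ t ^ 2 + (2 * s) * (φ t * ψ t) + ψ t ^ 2 :=
        fun t => by ring
      simp only [this]
      rw [intervalIntegral.integral_add ((i1.const_mul _).add (i2.const_mul _)) i3,
        intervalIntegral.integral_add (i1.const_mul _) (i2.const_mul _),
        intervalIntegral.integral_const_mul, intervalIntegral.integral_const_mul]
      ring
    rw [e]
    exact intervalIntegral.integral_nonneg hab fun t _ => sq_nonneg _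
  have := discrim_le_zero h
  rw [discrim] at this
  nlinarith

lemma sq_integral_le {φ : ℝ → ℝ} {a b : ℝ} (hab : a ≤ b) (hφ : ContinuousOn φ (Icc a b)) :
    (∫ t in a..b, φ t) ^ 2 ≤ (b - a) * ∫ t in a..b, φ t ^ 2 := by
  have := sq_integral_mul_le hab (continuousOn_const (c := (1 : ℝ))) hφ
  simpa using this

/-- The `L²` increment of a function of `(x, θ)` between two circles is controlled by the
`L²` norm of its `x`-derivative on the annulus between them. -/
lemma integral_sq_sub_le {φ φ' : ℝ → ℝ → ℂ} {a b x y : ℝ}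
    (hφ : ∀ y ∈ Ioo a b, Continuous (φ y))
    (hφ' : ContinuousOn (Function.uncurry φ') (Ioo a b ×ˢ univ))
    (h : ∀ y ∈ Ioo a b, ∀ θ, HasDerivAt (fun t => φ t θ) (φ' y θ) y) (hx : x ∈ Ioo a b)
    (hy : y ∈ Ioo a b) (hxy : x ≤ y) :
    ∫ θ in (0 : ℝ)..(2 * Real.pi), ‖φ y θ - φ x θ‖ ^ 2 ≤
      (y - x) * ∫ t in x..y, ∫ θ in (0 : ℝ)..(2 * Real.pi), ‖φ' t θ‖ ^ 2 := by
  have hsub : Icc x y ⊆ Ioo a b := fun t ht => ⟨hx.1.trans_le ht.1, ht.2.trans_lt hy.2⟩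
  have hc : ∀ θ, ContinuousOn (fun t => φ' t θ) (Icc x y) := fun θ =>
    hφ'.comp (f := fun t => (t, θ)) (by fun_prop) fun t ht => ⟨hsub ht, trivial⟩
  have hpt : ∀ θ, ‖φ y θ - φ x θ‖ ^ 2 ≤ (y - x) * ∫ t in x..y, ‖φ' t θ‖ ^ 2 := fun θ => by
    have e : ∫ t in x..y, φ' t θ = φ y θ - φ x θ := by
      refine intervalIntegral.integral_eq_sub_of_hasDerivAt (f := fun t => φ t θ) (fun t ht => ?_)
        ((hc θ).intervalIntegrable_of_Icc hxy)
      rw [uIcc_of_le hxy] at ht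
      exact h t (hsub ht) θ
    rw [← e]
    calc ‖∫ t in x..y, φ' t θ‖ ^ 2 ≤ (∫ t in x..y, ‖φ' t θ‖) ^ 2 := by
          gcongr; exact intervalIntegral.norm_integral_le_integral_norm hxy
      _ ≤ _ := sq_integral_le hxy (hc θ).norm
  have hint : Integrable (Function.uncurry fun t θ => ‖φ' t θ‖ ^ 2)
      ((volume.restrict (Ioc x y)).prod (volume.restrict (Ioc 0 (2 * Real.pi)))) := by
    rw [Measure.prod_restrict]
    refine IntegrableOn.mono_set (t := Icc x y ×ˢ Icc 0 (2 * Real.pi)) ?_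
      (prod_mono Ioc_subset_Icc_self Ioc_subset_Icc_self)
    refine ContinuousOn.integrableOn_compact (isCompact_Icc.prod isCompact_Icc) ?_
    exact ((hφ'.mono (fun p hp => ⟨hsub hp.1, trivial⟩)).norm.pow 2)
  have hswap : ∫ θ in (0 : ℝ)..(2 * Real.pi), ∫ t in x..y, ‖φ' t θ‖ ^ 2 =
      ∫ t in x..y, ∫ θ in (0 : ℝ)..(2 * Real.pi), ‖φ' t θ‖ ^ 2 := by
    simp only [intervalIntegral.integral_of_le Real.two_pi_pos.le,
      intervalIntegral.integral_of_le hxy]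
    exact (integral_integral_swap hint).symm
  rw [← hswap, ← intervalIntegral.integral_const_mul]
  refine intervalIntegral.integral_mono_on Real.two_pi_pos.le ?_ ?_ fun θ _ => hpt θ
  · have := hφ x hx; have := hφ y hy
    exact Continuous.intervalIntegrable (by fun_prop) _ _
  · refine IntervalIntegrable.const_mul ?_ _
    rw [intervalIntegrable_iff_integrableOn_Ioc_of_le Real.two_pi_pos.le]
    simp only [intervalIntegral.integral_of_le hxy]
    exact hint.integral_prod_right

/-- A periodic Lipschitz function is small if its `L²` norm is small compared with the scale
given by the Lipschitz constant. -/
lemma abs_le_of_lipschitz_of_integral_sq {φ : ℝ → ℝ} (hφ : Continuous φ)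
    (pφ : Function.Periodic φ (2 * Real.pi)) {M d ε : ℝ} (hd : 0 < d) (hd' : d ≤ 2 * Real.pi)
    (hM : 0 ≤ M) (hε : 0 ≤ ε)
    (hL : ∀ s t, |φ s - φ t| ≤ M * |s - t|) (hMd : M * d ≤ ε)
    (hI : ∫ θ in (0 : ℝ)..(2 * Real.pi), φ θ ^ 2 ≤ d * ε ^ 2) (θ₀ : ℝ) : |φ θ₀| ≤ 2 * ε := by
  by_contra! hcon
  have h1 : ∫ θ in θ₀..θ₀ + 2 * Real.pi, φ θ ^ 2 = ∫ θ in (0 : ℝ)..(2 * Real.pi), φ θ ^ 2 := by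
    have p2 : Function.Periodic (fun θ => φ θ ^ 2) (2 * Real.pi) := fun θ => by
      simp only [pφ θ]
    have := p2.intervalIntegral_add_eq θ₀ 0
    rwa [zero_add] at this
  have i : ∀ a b, IntervalIntegrable (fun θ => φ θ ^ 2) volume a b := fun a b =>
    (hφ.pow 2).intervalIntegrable _ _
  have h2 : ∫ θ in θ₀..θ₀ + d, φ θ ^ 2 ≤ ∫ θ in θ₀..θ₀ + 2 * Real.pi, φ θ ^ 2 := by
    rw [← intervalIntegral.integral_add_adjacent_intervals (i θ₀ (θ₀ + d))
      (i (θ₀ + d) (θ₀ + 2 * Real.pi))]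
    have := intervalIntegral.integral_nonneg (μ := volume) (a := θ₀ + d) (b := θ₀ + 2 * Real.pi)
      (f := fun θ => φ θ ^ 2) (by linarith) fun t _ => sq_nonneg _
    linarith
  have h3 : d * (|φ θ₀| - ε) ^ 2 ≤ ∫ θ in θ₀..θ₀ + d, φ θ ^ 2 := by
    have : ∫ θ in θ₀..θ₀ + d, (|φ θ₀| - ε) ^ 2 ≤ ∫ θ in θ₀..θ₀ + d, φ θ ^ 2 := by
      refine intervalIntegral.integral_mono_on (by linarith) (by simp) (i _ _) fun t ht => ?_
      have e1 := hL θ₀ t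
      have e2 : |θ₀ - t| ≤ d := by rw [abs_le]; constructor <;> linarith [ht.1, ht.2]
      have e3 : M * |θ₀ - t| ≤ M * d := by gcongr
      have e4 := abs_sub_abs_le_abs_sub (φ θ₀) (φ t)
      rw [← sq_abs (φ t)]
      gcongr
      · linarith
      · linarith
    simpa using this
  have h4 : ε ^ 2 < (|φ θ₀| - ε) ^ 2 := by gcongr; linarith
  nlinarith

/-! ### Periodic holomorphic functions on a strip -/

/-- The point `x + iθ`; in this logarithmic coordinate the point `e^{x+iθ}` runs through the
annulus. -/
noncomputable def pt (x θ : ℝ) : ℂ := x + θ * I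

/-- The strip `{L < Re ζ < 0}`, which `exp` maps onto the annulus `{e^L < |z| < 1}`. -/
def strip (L : ℝ) : Set ℂ := {ζ | L < ζ.re ∧ ζ.re < 0}

lemma pt_re (x θ : ℝ) : (pt x θ).re = x := by simp [pt]

lemma pt_mem {L x : ℝ} (hx : x ∈ Ioo L 0) (θ : ℝ) : pt x θ ∈ strip L := by
  simpa [strip, pt_re] using hx

lemma isOpen_strip (L : ℝ) : IsOpen (strip L) :=
  (isOpen_lt continuous_const continuous_re).inter (isOpen_lt continuous_re continuous_const)

lemma continuous_pt : Continuous (Function.uncurry pt) := by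
  unfold pt Function.uncurry; fun_prop

lemma hasDerivAt_pt_left (x θ : ℝ) : HasDerivAt (fun t => pt t θ) 1 x := by
  have := ((hasDerivAt_id x).ofReal_comp).add_const ((θ : ℂ) * I)
  simpa [pt] using this

lemma hasDerivAt_pt_right (x θ : ℝ) : HasDerivAt (fun s => pt x s) I θ := by
  have := (((hasDerivAt_id θ).ofReal_comp).mul_const I).const_add (x : ℂ)
  simpa [pt] using this

lemma pt_add_two_pi (x θ : ℝ) : pt x (θ + 2 * Real.pi) = pt x θ + 2 * Real.pi * I := by
  simp [pt]; ring

lemma continuousOn_slice {X : Type*} [TopologicalSpace X] {L : ℝ} {F : ℂ → X}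
    (hF : ContinuousOn F (strip L)) :
    ContinuousOn (Function.uncurry fun x θ => F (pt x θ)) (Ioo L 0 ×ˢ univ) :=
  hF.comp continuous_pt.continuousOn fun p hp => pt_mem hp.1 p.2

lemma periodic_slice {X : Type*} {F : ℂ → X} (pF : Function.Periodic F (2 * Real.pi * I)) (x : ℝ) :
    Function.Periodic (fun θ => F (pt x θ)) (2 * Real.pi) := fun θ => by
  simp only [pt_add_two_pi]; exact pF _

lemma hasDerivAt_slice_left {L x : ℝ} {F : ℂ → ℂ} (hF : DifferentiableOn ℂ F (strip L))
    (hx : x ∈ Ioo L 0) (θ : ℝ) : HasDerivAt (fun t => F (pt t θ)) (deriv F (pt x θ)) x := by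
  have h := (hF.differentiableAt ((isOpen_strip L).mem_nhds (pt_mem hx θ))).hasDerivAt
  have h2 := h.comp x (hasDerivAt_pt_left x θ)
  rw [mul_one] at h2
  exact h2

lemma hasDerivAt_slice_right {L x : ℝ} {F : ℂ → ℂ} (hF : DifferentiableOn ℂ F (strip L))
    (hx : x ∈ Ioo L 0) (θ : ℝ) :
    HasDerivAt (fun s => F (pt x s)) (I * deriv F (pt x θ)) θ := by
  have h := (hF.differentiableAt ((isOpen_strip L).mem_nhds (pt_mem hx θ))).hasDerivAt
  have h2 := h.comp θ (hasDerivAt_pt_right x θ)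
  rw [mul_comm] at h2
  exact h2

lemma differentiableOn_deriv {L : ℝ} {F : ℂ → ℂ} (hF : DifferentiableOn ℂ F (strip L)) :
    DifferentiableOn ℂ (deriv F) (strip L) := hF.deriv (isOpen_strip L)

/-- The Laurent coefficients: a periodic holomorphic function on the strip is
`∑ₙ laurent L F n e^{nζ}`. -/
noncomputable def laurent (L : ℝ) (F : ℂ → ℂ) (n : ℤ) : ℂ :=
  Complex.exp (-(n * (L / 2 : ℝ))) * fc (fun θ => F (pt (L / 2) θ)) n

lemma fc_slice {L : ℝ} {F : ℂ → ℂ} (hF : DifferentiableOn ℂ F (strip L))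
    (pF : Function.Periodic F (2 * Real.pi * I)) {x : ℝ} (hx : x ∈ Ioo L 0) (n : ℤ) :
    fc (fun θ => F (pt x θ)) n = laurent L F n * Complex.exp (n * x) := by
  have hL : L < 0 := hx.1.trans hx.2
  have hd := differentiableOn_deriv hF
  have cF := continuousOn_slice hF.continuousOn
  have cd := continuousOn_slice hd.continuousOn
  have hder : ∀ y ∈ Ioo L 0, HasDerivAt (fun t => fc (fun θ => F (pt t θ)) n)
      (n * fc (fun θ => F (pt y θ)) n) y := fun y hy => by
    have h1 : HasDerivAt (fun t => ∫ θ in (0 : ℝ)..(2 * Real.pi), ex (-n) θ * F (pt t θ))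
        (∫ θ in (0 : ℝ)..(2 * Real.pi), ex (-n) θ * deriv F (pt y θ)) y := by
      refine hasDerivAt_integral 0 (2 * Real.pi) (φ := fun t θ => ex (-n) θ * F (pt t θ))
        (φ' := fun t θ => ex (-n) θ * deriv F (pt t θ)) (a := L) (b := 0) ?_ ?_ ?_ hy
      · intro t ht
        exact (continuous_ex _).mul (continuous_slice cF ht)
      · exact ((continuous_ex (-n)).comp continuous_snd).continuousOn.mul cd
      · intro t ht θ
        exact (hasDerivAt_slice_left hF ht θ).const_mul _
    have h2 := fc_deriv (fun θ => hasDerivAt_slice_right hF hy θ)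
      (continuous_const.mul (continuous_slice cd hy)) (by simpa using periodic_slice pF y 0) n
    rw [fc_const_mul] at h2
    have h3 : fc (fun θ => deriv F (pt y θ)) n = n * fc (fun θ => F (pt y θ)) n := by
      apply mul_left_cancel₀ I_ne_zero
      rw [h2]; ring
    have h4 := h1.const_mul (2 * Real.pi : ℂ)⁻¹
    rw [← h3, fc_eq]
    simpa only [fc_eq] using h4
  have hconst : ∀ y ∈ Ioo L 0, HasDerivAt
      (fun t : ℝ => Complex.exp (-(n * t)) * fc (fun θ => F (pt t θ)) n) 0 y := fun y hy => by
    have he : HasDerivAt (fun t : ℝ => Complex.exp (-(n * t))) (Complex.exp (-(n * y)) * -(n * 1)) y :=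
      (((hasDerivAt_id y).ofReal_comp.const_mul (n : ℂ)).neg).cexp
    have := he.mul (hder y hy)
    rw [show (0 : ℂ) = Complex.exp (-(n * y)) * -(n * 1) * fc (fun θ => F (pt y θ)) n +
      Complex.exp (-(n * y)) * (n * fc (fun θ => F (pt y θ)) n) by ring]
    exact this
  have hm : L / 2 ∈ Ioo L 0 := ⟨by linarith, by linarith⟩
  have key : Complex.exp (-(n * x)) * fc (fun θ => F (pt x θ)) n = laurent L F n := by
    refine isOpen_Ioo.is_const_of_deriv_eq_zero (𝕜 := ℝ)
      (f := fun t : ℝ => Complex.exp (-(n * t)) * fc (fun θ => F (pt t θ)) n)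
      (convex_Ioo L 0).isPreconnected
      (fun y hy => (hconst y hy).differentiableAt.differentiableWithinAt)
      (fun y hy => (hconst y hy).deriv) hx hm
  rw [← key, mul_right_comm, ← Complex.exp_add]
  simp

lemma norm_fc_slice {L : ℝ} {F : ℂ → ℂ} (hF : DifferentiableOn ℂ F (strip L))
    (pF : Function.Periodic F (2 * Real.pi * I)) {x : ℝ} (hx : x ∈ Ioo L 0) (n : ℤ) :
    ‖fc (fun θ => F (pt x θ)) n‖ = ‖laurent L F n‖ * Real.exp (n * x) := by
  rw [fc_slice hF pF hx, norm_mul, Complex.norm_exp]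
  simp

lemma laurent_bound {L : ℝ} {F : ℂ → ℂ} (hF : DifferentiableOn ℂ F (strip L))
    (pF : Function.Periodic F (2 * Real.pi * I)) {y : ℝ} (hy : y ∈ Ioo L 0) :
    ∃ M, 0 ≤ M ∧ ∀ n, ‖laurent L F n‖ * Real.exp (n * y) ≤ M := by
  refine ⟨(2 * Real.pi)⁻¹ * ∫ θ in (0 : ℝ)..(2 * Real.pi), ‖F (pt y θ)‖, ?_, fun n => ?_⟩
  · have := Real.two_pi_pos
    exact mul_nonneg (by positivity)
      (intervalIntegral.integral_nonneg this.le fun _ _ => norm_nonneg _)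
  · rw [← norm_fc_slice hF pF hy]
    exact norm_fc_le_integral n

lemma summable_laurent_nonneg {L : ℝ} {F : ℂ → ℂ} (hF : DifferentiableOn ℂ F (strip L))
    (pF : Function.Periodic F (2 * Real.pi * I)) {x : ℝ} (hL : L < 0) (hx : x < 0) :
    Summable fun n : ℕ => ‖laurent L F n‖ * Real.exp (n * x) := by
  have hm : max (x / 2) (L / 2) < 0 := by rw [max_lt_iff]; constructor <;> linarith
  set y := max (x / 2) (L / 2) with hy
  have hxy : x < y := lt_of_lt_of_le (by linarith) (le_max_left _ _)
  obtain ⟨M, hM0, hM⟩ := laurent_bound hF pF (y := y)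
    ⟨lt_of_lt_of_le (by linarith) (le_max_right _ _), hm⟩
  refine Summable.of_nonneg_of_le (fun n => by positivity) (fun n => ?_)
    ((Real.summable_exp_nat_mul_iff.2 (sub_neg.2 hxy)).mul_left M)
  have := hM n
  rw [Int.cast_natCast] at this
  calc ‖laurent L F n‖ * Real.exp (n * x)
      = ‖laurent L F n‖ * Real.exp (n * y) * Real.exp (n * (x - y)) := by
        rw [mul_assoc, ← Real.exp_add]; ring_nf
    _ ≤ _ := by gcongr

/-- The Laurent coefficients with negative index decay exponentially. -/
lemma laurent_neg_bound {L : ℝ} {F : ℂ → ℂ} (hF : DifferentiableOn ℂ F (strip L))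
    (pF : Function.Periodic F (2 * Real.pi * I)) (hL : L < 0) :
    ∃ M, 0 ≤ M ∧ ∀ n : ℕ, ‖laurent L F (-n)‖ * Real.exp (-n * (L / 2)) ≤
      M * Real.exp (n * (L / 4)) := by
  obtain ⟨M, hM0, hM⟩ := laurent_bound hF pF (y := 3 * L / 4) ⟨by linarith, by linarith⟩
  refine ⟨M, hM0, fun n => ?_⟩
  have := hM (-n)
  push_cast at this
  calc ‖laurent L F (-n)‖ * Real.exp (-n * (L / 2))
      = ‖laurent L F (-n)‖ * Real.exp (-n * (3 * L / 4)) * Real.exp (n * (L / 4)) := by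
        rw [mul_assoc, ← Real.exp_add]; ring_nf
    _ ≤ _ := by gcongr

lemma summable_laurent_neg {L : ℝ} {F : ℂ → ℂ} (hF : DifferentiableOn ℂ F (strip L))
    (pF : Function.Periodic F (2 * Real.pi * I)) (hL : L < 0) :
    Summable fun n : ℕ => ‖laurent L F (-n)‖ * Real.exp (-n * (L / 2)) := by
  obtain ⟨M, hM0, hM⟩ := laurent_neg_bound hF pF hL
  exact Summable.of_nonneg_of_le (fun n => by positivity) hM
    ((Real.summable_exp_nat_mul_iff.2 (by linarith : L / 4 < 0)).mul_left M)

lemma summable_fc_slice {L : ℝ} {F : ℂ → ℂ} (hF : DifferentiableOn ℂ F (strip L))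
    (pF : Function.Periodic F (2 * Real.pi * I)) {x : ℝ} (hx : x ∈ Ioo L 0) :
    Summable fun n => ‖fc (fun θ => F (pt x θ)) n‖ := by
  have hL : L < 0 := hx.1.trans hx.2
  simp only [norm_fc_slice hF pF hx]
  refine Summable.of_nat_of_neg ?_ ?_
  · exact_mod_cast summable_laurent_nonneg hF pF hL hx.2
  · have hm : L < (L + x) / 2 := by linarith [hx.1]
    obtain ⟨M, hM0, hM⟩ := laurent_bound hF pF (y := (L + x) / 2) ⟨hm, by linarith [hx.2]⟩
    refine Summable.of_nonneg_of_le (fun n => by positivity) (fun n => ?_)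
      ((Real.summable_exp_nat_mul_iff.2 (by linarith [hx.1] : (L + x) / 2 - x < 0)).mul_left M)
    have := hM (-n)
    push_cast at this ⊢
    calc ‖laurent L F (-n)‖ * Real.exp (-n * x)
        = ‖laurent L F (-n)‖ * Real.exp (-n * ((L + x) / 2)) * Real.exp (n * ((L + x) / 2 - x)) := by
          rw [mul_assoc, ← Real.exp_add]; ring_nf
      _ ≤ _ := by gcongr

/-- The tail of an integrable function tends to zero. -/
lemma tendsto_tail {e : ℝ → ℝ} {L : ℝ} (hL : L < 0) (he : IntegrableOn e (Ioo L 0)) :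
    Tendsto (fun x => ∫ t in x..0, e t) (𝓝[<] 0) (𝓝 0) := by
  have h := intervalIntegral.continuousOn_primitive_interval_left (a := L) (b := 0) (f := e)
    (μ := volume) (by rw [uIcc_of_le hL.le, integrableOn_Icc_iff_integrableOn_Ioo]; exact he)
  have h0 := h 0 (by simp)
  rw [uIcc_of_le hL.le] at h0
  have h1 := h0.tendsto
  rw [intervalIntegral.integral_same] at h1
  refine h1.mono_left ?_
  rw [← nhdsWithin_Ioo_eq_nhdsLT hL]
  exact nhdsWithin_mono _ Ioo_subset_Icc_self

lemma intervalIntegrable_tail {e : ℝ → ℝ} {L x y : ℝ} (he : IntegrableOn e (Ioo L 0))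
    (hx : L < x) (hy : y ≤ 0) (hxy : x ≤ y) : IntervalIntegrable e volume x y := by
  rw [intervalIntegrable_iff_integrableOn_Ioo_of_le hxy]
  exact he.mono_set (Ioo_subset_Ioo hx.le hy)

/-- A periodic holomorphic function which is square integrable near the line `Re ζ = 0` is
`o(1/|x|)` there. -/
lemma eventually_abs_mul_norm_le {L : ℝ} {F : ℂ → ℂ} (hF : DifferentiableOn ℂ F (strip L))
    (pF : Function.Periodic F (2 * Real.pi * I)) (hL : L < 0)
    (he : IntegrableOn (fun x => ∫ θ in (0 : ℝ)..(2 * Real.pi), ‖F (pt x θ)‖ ^ 2) (Ioo L 0))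
    {ε : ℝ} (hε : 0 < ε) : ∀ᶠ x in 𝓝[<] (0 : ℝ), ∀ θ, |x| * ‖F (pt x θ)‖ ≤ ε := by
  have cF := continuousOn_slice hF.continuousOn
  set e : ℝ → ℝ := fun x => ∫ θ in (0 : ℝ)..(2 * Real.pi), ‖F (pt x θ)‖ ^ 2 with he_def
  set M := ∑' n : ℕ, ‖laurent L F (-(n + 1 : ℕ))‖ * Real.exp (-(n + 1 : ℕ) * (L / 2)) with hM
  have sM : Summable fun n : ℕ => ‖laurent L F (-(n + 1 : ℕ))‖ *
      Real.exp (-(n + 1 : ℕ) * (L / 2)) :=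
    (summable_nat_add_iff 1).2 (summable_laurent_neg hF pF hL)
  have hM0 : 0 ≤ M := tsum_nonneg fun n => by positivity
  have hpi := Real.pi_pos
  -- the parameter of the weighted inequality `2ab ≤ η⁻¹ a² + η b²`
  set η := ε / 2 with hη
  have hη0 : 0 < η := by positivity
  have htail : ∀ᶠ x in 𝓝[<] (0 : ℝ), ∫ t in (x / 2)..0, e t ≤ Real.pi * η ^ 2 := by
    have h := tendsto_tail hL he
    have h2 : Tendsto (fun x : ℝ => x / 2) (𝓝[<] 0) (𝓝[<] 0) := by
      refine tendsto_nhdsWithin_of_tendsto_nhds_of_eventually_within _ ?_ ?_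
      · have : Tendsto (fun x : ℝ => x / 2) (𝓝 0) (𝓝 (0 / 2)) := tendsto_id.div_const 2
        rw [zero_div] at this
        exact this.mono_left nhdsWithin_le_nhds
      · filter_upwards [self_mem_nhdsWithin] with x hx
        simp only [mem_Iio] at hx ⊢; linarith
    filter_upwards [(h.comp h2).eventually (ge_mem_nhds (by positivity : 0 < Real.pi * η ^ 2))]
      with x hx using hx
  have hsmall : ∀ᶠ x in 𝓝[<] (0 : ℝ), |x| * M ≤ ε / 4 := by
    have : Tendsto (fun x : ℝ => |x| * M) (𝓝 0) (𝓝 (|0| * M)) :=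
      (continuous_abs.mul continuous_const).tendsto 0
    rw [abs_zero, zero_mul] at this
    exact (this.mono_left nhdsWithin_le_nhds).eventually (ge_mem_nhds (by positivity))
  have hmem : ∀ᶠ x in 𝓝[<] (0 : ℝ), x ∈ Ioo (max (L / 2) (-1)) 0 :=
    Ioo_mem_nhdsLT (max_lt (by linarith) (by norm_num))
  filter_upwards [htail, hsmall, hmem] with x h1 h2 h3 θ
  have hxL2 : L / 2 < x := lt_of_le_of_lt (le_max_left _ _) h3.1
  have hx1 : -1 < x := lt_of_le_of_lt (le_max_right _ _) h3.1
  have hx0 : x < 0 := h3.2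
  have hx : x ∈ Ioo L 0 := ⟨by linarith, hx0⟩
  have hs := summable_fc_slice hF pF hx
  have hle := norm_le_tsum_fc (continuous_slice cF hx) (periodic_slice pF x) hs θ
  have s1 : Summable fun n : ℕ => ‖laurent L F n‖ * Real.exp (n * x) :=
    summable_laurent_nonneg hF pF hL hx0
  have hneg : ∀ n : ℕ, ‖laurent L F (-(n + 1 : ℕ))‖ * Real.exp (-(n + 1 : ℕ) * x) ≤
      ‖laurent L F (-(n + 1 : ℕ))‖ * Real.exp (-(n + 1 : ℕ) * (L / 2)) := fun n => by
    gcongr ‖laurent L F (-(n + 1 : ℕ))‖ * Real.exp ?_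
    have : (0 : ℝ) ≤ (n + 1 : ℕ) := by positivity
    nlinarith
  have s2 : Summable fun n : ℕ => ‖laurent L F (-(n + 1 : ℕ))‖ * Real.exp (-(n + 1 : ℕ) * x) :=
    Summable.of_nonneg_of_le (fun n => by positivity) hneg sM
  have hsplit : ∑' n, ‖fc (fun θ => F (pt x θ)) n‖ =
      ∑' n : ℕ, ‖laurent L F n‖ * Real.exp (n * x) +
      ∑' n : ℕ, ‖laurent L F (-(n + 1 : ℕ))‖ * Real.exp (-(n + 1 : ℕ) * x) := by
    simp only [norm_fc_slice hF pF hx]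
    rw [tsum_of_nat_of_neg_add_one]
    · push_cast; rfl
    · exact_mod_cast s1
    · exact_mod_cast s2
  -- the square sum of the coefficients with nonnegative index
  have sQ : Summable fun n : ℕ => ‖laurent L F n‖ ^ 2 * Real.exp (n * x) := by
    have := (hasSum_sq_fc (continuous_slice cF (x := x / 2) ⟨by linarith, by linarith⟩)).summable
    simp only [norm_fc_slice hF pF (x := x / 2) ⟨by linarith, by linarith⟩] at this
    have h := this.comp_injective (i := fun n : ℕ => (n : ℤ)) Nat.cast_injective
    refine h.congr fun n => ?_
    simp only [Function.comp, Int.cast_natCast, mul_pow, ← Real.exp_nat_mul]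
    congr 2; push_cast; ring
  set Q := ∑' n : ℕ, ‖laurent L F n‖ ^ 2 * Real.exp (n * x) with hQ
  have hQt : ∀ t ∈ Ioo (x / 2) 0, Q ≤ (2 * Real.pi)⁻¹ * e t := fun t ht => by
    have htm : t ∈ Ioo L 0 := ⟨by linarith [ht.1], ht.2⟩
    have hp := hasSum_sq_fc (continuous_slice cF htm)
    simp only [norm_fc_slice hF pF htm] at hp
    have hinj := (hp.summable.comp_injective (i := fun n : ℕ => (n : ℤ)) Nat.cast_injective)
    calc Q ≤ ∑' n : ℕ, (‖laurent L F n‖ * Real.exp (n * t)) ^ 2 := by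
          refine sQ.tsum_le_tsum (fun n => ?_) (by exact_mod_cast hinj)
          rw [mul_pow, ← Real.exp_nat_mul]
          gcongr ‖laurent L F n‖ ^ 2 * Real.exp ?_
          have : (0 : ℝ) ≤ n := by positivity
          push_cast
          nlinarith [ht.1]
      _ ≤ ∑' n : ℤ, (‖laurent L F n‖ * Real.exp (n * t)) ^ 2 := by
          have := tsum_comp_le_tsum_of_inj hp.summable (fun n => sq_nonneg _)
            (i := fun n : ℕ => (n : ℤ)) Nat.cast_injective
          exact_mod_cast this
      _ = _ := hp.tsum_eq
  have hQx : Q * (-x / 2) ≤ (2 * Real.pi)⁻¹ * (Real.pi * η ^ 2) := by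
    have i := intervalIntegrable_tail he (x := x / 2) (by linarith) le_rfl (by linarith)
    have : ∫ t in (x / 2)..0, Q ≤ ∫ t in (x / 2)..0, (2 * Real.pi)⁻¹ * e t :=
      intervalIntegral.integral_mono_on_of_le_Ioo (by linarith) (by simp) (i.const_mul _) hQt
    rw [intervalIntegral.integral_const, intervalIntegral.integral_const_mul, smul_eq_mul] at this
    calc Q * (-x / 2) = (0 - x / 2) * Q := by ring
      _ ≤ _ := this
      _ ≤ _ := by gcongr
  have hgeo : HasSum (fun n : ℕ => Real.exp (n * x)) (1 - Real.exp x)⁻¹ := by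
    have := hasSum_geometric_of_lt_one (Real.exp_pos x).le (Real.exp_lt_one_iff.2 hx0)
    simpa only [← Real.exp_nat_mul] using this
  have hgeo' : -x * (1 - Real.exp x)⁻¹ ≤ 2 := by
    have h4 : Real.exp x * (1 - x) ≤ 1 := by
      have := Real.add_one_le_exp (-x)
      calc Real.exp x * (1 - x) ≤ Real.exp x * Real.exp (-x) := by gcongr; linarith
        _ = 1 := by rw [← Real.exp_add]; simp
    have h5 : 0 < 1 - Real.exp x := sub_pos.2 (Real.exp_lt_one_iff.2 hx0)
    rw [← div_eq_mul_inv, div_le_iff₀ h5]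
    nlinarith [Real.exp_pos x]
  have hpos : |x| * ∑' n : ℕ, ‖laurent L F n‖ * Real.exp (n * x) ≤ 3 / 2 * η := by
    have hb : ∑' n : ℕ, ‖laurent L F n‖ * Real.exp (n * x) ≤
        (1 / 2) * (η⁻¹ * Q + η * (1 - Real.exp x)⁻¹) := by
      have hh := ((sQ.hasSum.mul_left η⁻¹).add (hgeo.mul_left η)).mul_left (1 / 2)
      refine hasSum_le (fun n => ?_) s1.hasSum hh
      have : 0 ≤ η⁻¹ * (‖laurent L F n‖ - η) ^ 2 := by positivity
      have e2 : η⁻¹ * (‖laurent L F n‖ - η) ^ 2 =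
          η⁻¹ * ‖laurent L F n‖ ^ 2 + η - 2 * ‖laurent L F n‖ := by field_simp; ring
      have hexp := Real.exp_pos (n * x)
      nlinarith
    rw [abs_of_neg hx0]
    calc -x * ∑' n : ℕ, ‖laurent L F n‖ * Real.exp (n * x)
        ≤ -x * ((1 / 2) * (η⁻¹ * Q + η * (1 - Real.exp x)⁻¹)) := by gcongr; linarith
      _ = η⁻¹ * (Q * (-x / 2)) + η / 2 * (-x * (1 - Real.exp x)⁻¹) := by ring
      _ ≤ η⁻¹ * ((2 * Real.pi)⁻¹ * (Real.pi * η ^ 2)) + η / 2 * 2 := by gcongr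
      _ = 3 / 2 * η := by field_simp; ring
  have hnegs : ∑' n : ℕ, ‖laurent L F (-(n + 1 : ℕ))‖ * Real.exp (-(n + 1 : ℕ) * x) ≤ M :=
    s2.tsum_le_tsum hneg sM
  calc |x| * ‖F (pt x θ)‖ ≤ |x| * ∑' n, ‖fc (fun θ => F (pt x θ)) n‖ := by gcongr
    _ ≤ 3 / 2 * η + ε / 4 := by
        rw [hsplit, mul_add]
        refine add_le_add hpos (le_trans ?_ h2)
        gcongr
    _ ≤ ε := by rw [hη]; linarith

/-! ### Semi-stiff maps near one boundary line -/

/-- A harmonic map of finite energy on the strip, in the coordinate `ζ = x + iθ`: `v` is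
`2πi`-periodic, with `∂_ζ v = f` and `conj (∂_ζ̄ v) = g` holomorphic and square integrable on a
period. -/
structure StripMap (L : ℝ) (v f g : ℂ → ℂ) : Prop where
  neg : L < 0
  hf : DifferentiableOn ℂ f (strip L)
  hg : DifferentiableOn ℂ g (strip L)
  pf : Function.Periodic f (2 * Real.pi * I)
  pg : Function.Periodic g (2 * Real.pi * I)
  pv : Function.Periodic v (2 * Real.pi * I)
  cv : ContinuousOn v (strip L)
  hvx : ∀ x ∈ Ioo L 0, ∀ θ, HasDerivAt (fun t => v (pt t θ)) (f (pt x θ) + conj (g (pt x θ))) x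
  hvt : ∀ x ∈ Ioo L 0, ∀ θ,
    HasDerivAt (fun s => v (pt x s)) (I * (f (pt x θ) - conj (g (pt x θ)))) θ
  energy : IntegrableOn
    (fun x => ∫ θ in (0 : ℝ)..(2 * Real.pi), (‖f (pt x θ)‖ ^ 2 + ‖g (pt x θ)‖ ^ 2)) (Ioo L 0)

/-- A semi-stiff map near the boundary line `Re ζ = 0`: the modulus of `v` has trace one, and the
Fourier coefficients of the normal component `v ∧ ∂ₓ v = Im (conj v · ∂ₓ v)` tend to zero at the
line. -/
structure EndData (L : ℝ) (v f g : ℂ → ℂ) : Prop extends StripMap L v f g where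
  trace : Tendsto (fun x => ∫ θ in (0 : ℝ)..(2 * Real.pi), (‖v (pt x θ)‖ - 1) ^ 2)
    (𝓝[<] 0) (𝓝 0)
  flux : ∀ n, Tendsto (fun x => fc (fun θ =>
    ((conj (v (pt x θ)) * (f (pt x θ) + conj (g (pt x θ)))).im : ℂ)) n) (𝓝[<] 0) (𝓝 0)

namespace StripMap

variable {L : ℝ} {v f g : ℂ → ℂ}

lemma continuous_v (h : StripMap L v f g) {x : ℝ} (hx : x ∈ Ioo L 0) :
    Continuous fun θ => v (pt x θ) := continuous_slice (continuousOn_slice h.cv) hx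

lemma continuous_f (h : StripMap L v f g) {x : ℝ} (hx : x ∈ Ioo L 0) :
    Continuous fun θ => f (pt x θ) := continuous_slice (continuousOn_slice h.hf.continuousOn) hx

lemma continuous_g (h : StripMap L v f g) {x : ℝ} (hx : x ∈ Ioo L 0) :
    Continuous fun θ => g (pt x θ) := continuous_slice (continuousOn_slice h.hg.continuousOn) hx

end StripMap

namespace EndData

variable {L : ℝ} {v f g : ℂ → ℂ}

/-- Complex conjugation of the map exchanges `f` and `g`. -/
lemma conj_symm (h : EndData L v f g) : EndData L (fun ζ => conj (v ζ)) g f where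
  neg := h.neg
  hf := h.hg
  hg := h.hf
  pf := h.pg
  pg := h.pf
  pv ζ := by simp only [h.pv ζ]
  cv := continuous_conj.comp_continuousOn h.cv
  hvx x hx θ := by
    have h1 := (h.hvx x hx θ).star
    have e : g (pt x θ) + conj (f (pt x θ)) = star (f (pt x θ) + conj (g (pt x θ))) := by
      simp [add_comm]
    rw [e]; exact h1
  hvt x hx θ := by
    have h1 := (h.hvt x hx θ).star
    have e : I * (g (pt x θ) - conj (f (pt x θ))) =
        star (I * (f (pt x θ) - conj (g (pt x θ)))) := by
      simp; ring
    rw [e]; exact h1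
  energy := by simpa only [add_comm] using h.energy
  trace := by simpa using h.trace
  flux n := by
    have h1 := (h.flux n).neg
    rw [neg_zero] at h1
    refine h1.congr fun x => ?_
    rw [← neg_one_mul, ← fc_const_mul]
    congr 1
    ext θ
    have : conj (conj (v (pt x θ))) * (g (pt x θ) + conj (f (pt x θ))) =
        conj (conj (v (pt x θ)) * (f (pt x θ) + conj (g (pt x θ)))) := by
      simp only [map_mul, map_add, RingHomCompTriple.comp_apply, RingHom.id_apply]; ring
    rw [this, conj_im]; push_cast; ring

lemma mono (h : EndData L v f g) {L' : ℝ} (hL : L ≤ L') (hL' : L' < 0) : EndData L' v f g where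
  neg := hL'
  hf := h.hf.mono fun _ hζ => ⟨hL.trans_lt hζ.1, hζ.2⟩
  hg := h.hg.mono fun _ hζ => ⟨hL.trans_lt hζ.1, hζ.2⟩
  pf := h.pf
  pg := h.pg
  pv := h.pv
  cv := h.cv.mono fun _ hζ => ⟨hL.trans_lt hζ.1, hζ.2⟩
  hvx x hx := h.hvx x ⟨hL.trans_lt hx.1, hx.2⟩
  hvt x hx := h.hvt x ⟨hL.trans_lt hx.1, hx.2⟩
  energy := h.energy.mono_set (Ioo_subset_Ioo_left hL)
  trace := h.trace
  flux := h.flux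

lemma integrable_energy_f (h : EndData L v f g) :
    IntegrableOn (fun x => ∫ θ in (0 : ℝ)..(2 * Real.pi), ‖f (pt x θ)‖ ^ 2) (Ioo L 0) := by
  refine h.energy.mono' ?_ ?_
  · exact (continuousOn_circ (φ := fun x θ => ‖f (pt x θ)‖ ^ 2)
      (continuousOn_comp₁ (G := fun z => ‖z‖ ^ 2) (by fun_prop)
        (continuousOn_slice h.hf.continuousOn))).aestronglyMeasurable measurableSet_Ioo
  · refine (ae_restrict_iff' measurableSet_Ioo).2 (ae_of_all _ fun x hx => ?_)
    have cf := h.continuous_f hx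
    have cg := h.continuous_g hx
    rw [Real.norm_of_nonneg (intervalIntegral.integral_nonneg Real.two_pi_pos.le
      fun _ _ => sq_nonneg _)]
    refine intervalIntegral.integral_mono_on Real.two_pi_pos.le
      ((cf.norm.pow 2).intervalIntegrable _ _)
      (((cf.norm.pow 2).add (cg.norm.pow 2)).intervalIntegrable _ _) fun θ _ => ?_
    have := sq_nonneg ‖g (pt x θ)‖
    linarith

/-- Quantitative form of the trace condition: `∫ (|v| - 1)² = o(|x|)`. -/
lemma integral_norm_sub_one_sq_le (h : EndData L v f g) {x : ℝ} (hx : x ∈ Ioo L 0) :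
    ∫ θ in (0 : ℝ)..(2 * Real.pi), (‖v (pt x θ)‖ - 1) ^ 2 ≤ 4 * |x| * ∫ t in x..0,
      ∫ θ in (0 : ℝ)..(2 * Real.pi), (‖f (pt t θ)‖ ^ 2 + ‖g (pt t θ)‖ ^ 2) := by
  set e : ℝ → ℝ := fun t =>
    ∫ θ in (0 : ℝ)..(2 * Real.pi), (‖f (pt t θ)‖ ^ 2 + ‖g (pt t θ)‖ ^ 2) with he
  have he0 : ∀ t, 0 ≤ e t := fun t =>
    intervalIntegral.integral_nonneg Real.two_pi_pos.le fun _ _ => by positivity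
  have cf := continuousOn_slice h.hf.continuousOn
  have cg := continuousOn_slice h.hg.continuousOn
  have cconj : ContinuousOn (Function.uncurry fun x θ => conj (g (pt x θ))) (Ioo L 0 ×ˢ univ) :=
    continuous_conj.comp_continuousOn cg
  have hmain : ∀ y ∈ Ioo x 0, ∫ θ in (0 : ℝ)..(2 * Real.pi), (‖v (pt x θ)‖ - 1) ^ 2 ≤
      2 * (∫ θ in (0 : ℝ)..(2 * Real.pi), (‖v (pt y θ)‖ - 1) ^ 2) +
      4 * |x| * ∫ t in x..0, e t := fun y hy => by
    have hyL : y ∈ Ioo L 0 := ⟨hx.1.trans hy.1, hy.2⟩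
    have hinc := integral_sq_sub_le (φ := fun x θ => v (pt x θ))
      (φ' := fun x θ => f (pt x θ) + conj (g (pt x θ))) (fun y hy => h.continuous_v hy)
      (cf.add cconj) h.hvx hx hyL hy.1.le
    have ii := intervalIntegrable_tail h.energy hx.1 hyL.2.le hy.1.le
    have hcirc : ContinuousOn (fun t => ∫ θ in (0 : ℝ)..(2 * Real.pi),
        ‖f (pt t θ) + conj (g (pt t θ))‖ ^ 2) (Ioo L 0) :=
      continuousOn_circ (φ := fun t θ => ‖f (pt t θ) + conj (g (pt t θ))‖ ^ 2)
        (continuousOn_comp₁ (G := fun z => ‖z‖ ^ 2) (by fun_prop) (cf.add cconj))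
    have hle : ∫ t in x..y, ∫ θ in (0 : ℝ)..(2 * Real.pi), ‖f (pt t θ) + conj (g (pt t θ))‖ ^ 2 ≤
        ∫ t in x..y, 2 * e t := by
      refine intervalIntegral.integral_mono_on hy.1.le ?_ (ii.const_mul 2) fun t ht => ?_
      · exact (hcirc.mono fun t ht =>
          ⟨hx.1.trans_le ht.1, ht.2.trans_lt hy.2⟩).intervalIntegrable_of_Icc hy.1.le
      · have htL : t ∈ Ioo L 0 := ⟨hx.1.trans_le ht.1, ht.2.trans_lt hy.2⟩
        have c1 := h.continuous_f htL
        have c2 := h.continuous_g htL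
        have c3 : Continuous fun θ => conj (g (pt t θ)) := continuous_conj.comp c2
        rw [he, ← intervalIntegral.integral_const_mul]
        refine intervalIntegral.integral_mono_on Real.two_pi_pos.le
          (((c1.add c3).norm.pow 2).intervalIntegrable _ _)
          ((((c1.norm.pow 2).add (c2.norm.pow 2)).const_mul 2).intervalIntegrable _ _) fun θ _ => ?_
        have := norm_add_le (f (pt t θ)) (conj (g (pt t θ)))
        rw [RCLike.norm_conj] at this
        have hn := norm_nonneg (f (pt t θ) + conj (g (pt t θ)))
        nlinarith [sq_nonneg (‖f (pt t θ)‖ - ‖g (pt t θ)‖)]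
    have hext : ∫ t in x..y, e t ≤ ∫ t in x..0, e t := by
      have i2 := intervalIntegrable_tail h.energy hyL.1 le_rfl hy.2.le
      rw [← intervalIntegral.integral_add_adjacent_intervals ii i2]
      have := intervalIntegral.integral_nonneg (μ := volume) hy.2.le fun t _ => he0 t
      linarith
    have hI0 : 0 ≤ ∫ t in x..0, e t := intervalIntegral.integral_nonneg hx.2.le fun t _ => he0 t
    have hbig : ∫ θ in (0 : ℝ)..(2 * Real.pi), ‖v (pt y θ) - v (pt x θ)‖ ^ 2 ≤
        |x| * (2 * ∫ t in x..0, e t) := by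
      refine hinc.trans ?_
      rw [intervalIntegral.integral_const_mul] at hle
      rw [abs_of_neg hx.2]
      have : 0 ≤ ∫ t in x..y, ∫ θ in (0 : ℝ)..(2 * Real.pi),
          ‖f (pt t θ) + conj (g (pt t θ))‖ ^ 2 :=
        intervalIntegral.integral_nonneg hy.1.le fun t _ =>
          intervalIntegral.integral_nonneg Real.two_pi_pos.le fun _ _ => sq_nonneg _
      exact mul_le_mul (by linarith [hy.2]) (by linarith) this (by linarith [hx.2])
    have c1 := ((h.continuous_v hx).norm.sub (continuous_const (y := (1 : ℝ)))).pow 2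
    have c2 : Continuous fun θ => 2 * (‖v (pt y θ)‖ - 1) ^ 2 :=
      (((h.continuous_v hyL).norm.sub (continuous_const (y := (1 : ℝ)))).pow 2).const_mul 2
    have c3 : Continuous fun θ => 2 * ‖v (pt y θ) - v (pt x θ)‖ ^ 2 :=
      (((h.continuous_v hyL).sub (h.continuous_v hx)).norm.pow 2).const_mul 2
    calc ∫ θ in (0 : ℝ)..(2 * Real.pi), (‖v (pt x θ)‖ - 1) ^ 2
        ≤ ∫ θ in (0 : ℝ)..(2 * Real.pi), (2 * (‖v (pt y θ)‖ - 1) ^ 2 +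
          2 * ‖v (pt y θ) - v (pt x θ)‖ ^ 2) := by
          refine intervalIntegral.integral_mono_on Real.two_pi_pos.le
            (c1.intervalIntegrable _ _) ((c2.add c3).intervalIntegrable _ _) fun θ _ => ?_
          have h1 := abs_norm_sub_norm_le (v (pt y θ)) (v (pt x θ))
          have h2 : (‖v (pt y θ)‖ - ‖v (pt x θ)‖) ^ 2 ≤ ‖v (pt y θ) - v (pt x θ)‖ ^ 2 := by
            rw [← sq_abs]; gcongr
          nlinarith [sq_nonneg ((‖v (pt y θ)‖ - 1) + (‖v (pt y θ)‖ - ‖v (pt x θ)‖))]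
      _ = 2 * (∫ θ in (0 : ℝ)..(2 * Real.pi), (‖v (pt y θ)‖ - 1) ^ 2) +
          2 * ∫ θ in (0 : ℝ)..(2 * Real.pi), ‖v (pt y θ) - v (pt x θ)‖ ^ 2 := by
          rw [intervalIntegral.integral_add (c2.intervalIntegrable _ _) (c3.intervalIntegrable _ _),
            intervalIntegral.integral_const_mul, intervalIntegral.integral_const_mul]
      _ ≤ _ := by linarith
  have hlim := (h.trace.const_mul 2).add_const (4 * |x| * ∫ t in x..0, e t)
  rw [mul_zero, zero_add] at hlim
  refine ge_of_tendsto hlim ?_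
  filter_upwards [Ioo_mem_nhdsLT hx.2] with y hy using hmain y hy

lemma eventually_f (h : EndData L v f g) {ε : ℝ} (hε : 0 < ε) :
    ∀ᶠ x in 𝓝[<] (0 : ℝ), ∀ θ, |x| * ‖f (pt x θ)‖ ≤ ε :=
  eventually_abs_mul_norm_le h.hf h.pf h.neg h.integrable_energy_f hε

lemma eventually_mem (h : EndData L v f g) : ∀ᶠ x in 𝓝[<] (0 : ℝ), x ∈ Ioo L 0 :=
  Ioo_mem_nhdsLT h.neg

lemma _root_.SemiStiff.lipschitz_of_hasDerivAt {E : Type*} [NormedAddCommGroup E]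
    [NormedSpace ℝ E] {φ φ' : ℝ → E} {M : ℝ}
    (h : ∀ θ, HasDerivAt φ (φ' θ) θ) (hM : ∀ θ, ‖φ' θ‖ ≤ M) (s t : ℝ) :
    ‖φ s - φ t‖ ≤ M * |s - t| :=
  convex_univ.norm_image_sub_le_of_norm_hasDerivWithin_le (f' := φ')
    (fun y _ => (h y).hasDerivWithinAt) (fun y _ => hM y) (mem_univ t) (mem_univ s)

/-- The modulus of `v` tends to one uniformly at the boundary line. -/
lemma eventually_norm_v (h : EndData L v f g) {ε : ℝ} (hε : 0 < ε) :
    ∀ᶠ x in 𝓝[<] (0 : ℝ), ∀ θ, |‖v (pt x θ)‖ - 1| ≤ ε := by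
  have htail := (tendsto_tail h.neg h.energy).eventually
    (ge_mem_nhds (by positivity : 0 < (ε / 2) ^ 2 / 4))
  filter_upwards [htail, h.eventually_mem, h.eventually_f (by positivity : 0 < ε / 4),
    h.conj_symm.eventually_f (by positivity : 0 < ε / 4), Ioo_mem_nhdsLT (by norm_num : (-1 : ℝ) < 0)]
    with x h1 hx h2 h3 hx1 θ₀
  have hx0 : 0 < |x| := abs_pos.2 hx.2.ne
  have hc := h.continuous_v hx
  have hL : ∀ s t, ‖v (pt x s) - v (pt x t)‖ ≤ ε / 2 / |x| * |s - t| := by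
    refine lipschitz_of_hasDerivAt (h.hvt x hx) fun θ => ?_
    rw [norm_mul, norm_I, one_mul, le_div_iff₀ hx0]
    have := norm_sub_le (f (pt x θ)) (conj (g (pt x θ)))
    rw [RCLike.norm_conj] at this
    nlinarith [h2 θ, h3 θ]
  have := abs_le_of_lipschitz_of_integral_sq (φ := fun θ => ‖v (pt x θ)‖ - 1)
    (hc.norm.sub continuous_const)
    (fun θ => by simp only [periodic_slice h.pv x θ]) (M := ε / 2 / |x|) (d := |x|) (ε := ε / 2) hx0
    (by rw [abs_of_neg hx.2]; linarith [hx1.1, Real.pi_gt_three])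
    (by positivity) (by positivity) (fun s t => ?_) (by field_simp; rfl) ?_ θ₀
  · linarith
  · refine le_trans ?_ (hL s t)
    rw [sub_sub_sub_cancel_right]
    exact abs_norm_sub_norm_le _ _
  · refine (h.integral_norm_sub_one_sq_le hx).trans ?_
    calc _ ≤ 4 * |x| * ((ε / 2) ^ 2 / 4) := by gcongr
      _ = _ := by ring

end EndData

/-! ### The potential of the current -/

/-- A real potential `k` of the closed form with `∂_ζ k = -conj v · f`, normalised by the condition
that all its Fourier coefficients vanish at the boundary line. -/
structure IsPotential (L : ℝ) (v f : ℂ → ℂ) (k : ℝ → ℝ → ℝ) : Prop where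
  hx : ∀ x ∈ Ioo L 0, ∀ θ,
    HasDerivAt (fun t => k t θ) (-2 * (conj (v (pt x θ)) * f (pt x θ)).re) x
  ht : ∀ x ∈ Ioo L 0, ∀ θ, HasDerivAt (k x) (2 * (conj (v (pt x θ)) * f (pt x θ)).im) θ
  periodic : ∀ x ∈ Ioo L 0, Function.Periodic (k x) (2 * Real.pi)
  coeff : ∀ n, Tendsto (fun x => fc (fun θ => (k x θ : ℂ)) n) (𝓝[<] 0) (𝓝 0)

lemma hasDerivAt_re {φ : ℝ → ℂ} {φ' : ℂ} {x : ℝ} (h : HasDerivAt φ φ' x) :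
    HasDerivAt (fun t => (φ t).re) φ'.re x :=
  reCLM.hasFDerivAt.comp_hasDerivAt x h

lemma hasDerivAt_im {φ : ℝ → ℂ} {φ' : ℂ} {x : ℝ} (h : HasDerivAt φ φ' x) :
    HasDerivAt (fun t => (φ t).im) φ'.im x :=
  imCLM.hasFDerivAt.comp_hasDerivAt x h

lemma hasDerivAt_conj {φ : ℝ → ℂ} {φ' : ℂ} {x : ℝ} (h : HasDerivAt φ φ' x) :
    HasDerivAt (fun t => conj (φ t)) (conj φ') x := h.star

namespace EndData

variable {L : ℝ} {v f g : ℂ → ℂ}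

lemma continuousOn_W (h : EndData L v f g) :
    ContinuousOn (fun ζ => conj (v ζ) * f ζ) (strip L) :=
  (continuous_conj.comp_continuousOn h.cv).mul h.hf.continuousOn

lemma continuousOn_deriv_f (h : EndData L v f g) : ContinuousOn (deriv f) (strip L) :=
  (differentiableOn_deriv h.hf).continuousOn

lemma hasDerivAt_W_left (h : EndData L v f g) {x : ℝ} (hx : x ∈ Ioo L 0) (θ : ℝ) :
    HasDerivAt (fun t => conj (v (pt t θ)) * f (pt t θ))
      (conj (f (pt x θ) + conj (g (pt x θ))) * f (pt x θ) +
        conj (v (pt x θ)) * deriv f (pt x θ)) x :=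
  (hasDerivAt_conj (h.hvx x hx θ)).mul (hasDerivAt_slice_left h.hf hx θ)

lemma hasDerivAt_W_right (h : EndData L v f g) {x : ℝ} (hx : x ∈ Ioo L 0) (θ : ℝ) :
    HasDerivAt (fun s => conj (v (pt x s)) * f (pt x s))
      (conj (I * (f (pt x θ) - conj (g (pt x θ)))) * f (pt x θ) +
        conj (v (pt x θ)) * (I * deriv f (pt x θ))) θ :=
  (hasDerivAt_conj (h.hvt x hx θ)).mul (hasDerivAt_slice_right h.hf hx θ)

/-- The form `-2 Re (conj v · f) dx + 2 Im (conj v · f) dθ` is closed. -/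
lemma _root_.SemiStiff.closed_identity (a b c d : ℂ) :
    2 * (conj (b + conj c) * b + conj a * d).im =
      -2 * (conj (I * (b - conj c)) * b + conj a * (I * d)).re := by
  simp; ring

lemma continuousOn_Wx (h : EndData L v f g) :
    ContinuousOn (fun ζ => conj (f ζ + conj (g ζ)) * f ζ + conj (v ζ) * deriv f ζ) (strip L) :=
  ((continuous_conj.comp_continuousOn (h.hf.continuousOn.add
    (continuous_conj.comp_continuousOn h.hg.continuousOn))).mul h.hf.continuousOn).add
    ((continuous_conj.comp_continuousOn h.cv).mul h.continuousOn_deriv_f)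

lemma continuousOn_Wt (h : EndData L v f g) :
    ContinuousOn (fun ζ => conj (I * (f ζ - conj (g ζ))) * f ζ + conj (v ζ) * (I * deriv f ζ))
      (strip L) :=
  ((continuous_conj.comp_continuousOn (continuousOn_const.mul (h.hf.continuousOn.sub
    (continuous_conj.comp_continuousOn h.hg.continuousOn)))).mul h.hf.continuousOn).add
    ((continuous_conj.comp_continuousOn h.cv).mul (continuousOn_const.mul h.continuousOn_deriv_f))

lemma continuous_P (h : EndData L v f g) {x : ℝ} (hx : x ∈ Ioo L 0) :
    Continuous fun θ => 2 * (conj (v (pt x θ)) * f (pt x θ)).im :=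
  continuous_const.mul (continuous_im.comp (continuous_slice (continuousOn_slice h.continuousOn_W) hx))

lemma continuous_Q (h : EndData L v f g) {x : ℝ} (hx : x ∈ Ioo L 0) :
    Continuous fun θ => -2 * (conj (v (pt x θ)) * f (pt x θ)).re :=
  continuous_const.mul (continuous_re.comp (continuous_slice (continuousOn_slice h.continuousOn_W) hx))

/-- The boundary conditions make `2 Im (conj v · f) = v ∧ ∂ₓ v - ∂_θ (|v|² - 1) / 2` vanish at the
boundary line, coefficient by coefficient. -/
lemma tendsto_fc_P (h : EndData L v f g) (n : ℤ) :
    Tendsto (fun x => fc (fun θ => ((2 * (conj (v (pt x θ)) * f (pt x θ)).im : ℝ) : ℂ)) n)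
      (𝓝[<] 0) (𝓝 0) := by
  have hsq : Tendsto (fun x => fc (fun θ => conj (v (pt x θ)) * v (pt x θ) - 1) n)
      (𝓝[<] 0) (𝓝 0) := by
    rw [Metric.tendsto_nhds]
    intro ε hε
    have h0 : 0 < min 1 (ε / 6) := by positivity
    filter_upwards [h.eventually_norm_v h0] with x hx
    rw [dist_zero_right]
    refine (norm_fc_le (M := ε / 2) (fun θ => ?_) n).trans_lt (by linarith)
    have e1 : conj (v (pt x θ)) * v (pt x θ) - 1 = ((‖v (pt x θ)‖ ^ 2 - 1 : ℝ) : ℂ) := by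
      rw [mul_comm, mul_conj, normSq_eq_norm_sq]; push_cast; ring
    rw [e1, norm_real, Real.norm_eq_abs,
      show ‖v (pt x θ)‖ ^ 2 - 1 = (‖v (pt x θ)‖ - 1) * (‖v (pt x θ)‖ + 1) by ring, abs_mul]
    have h1 := (hx θ).trans (min_le_left _ _)
    have h2 := (hx θ).trans (min_le_right _ _)
    have h3 : |‖v (pt x θ)‖ + 1| ≤ 3 := by
      rw [abs_le] at h1 ⊢; constructor <;> linarith
    calc _ ≤ ε / 6 * 3 := mul_le_mul h2 h3 (abs_nonneg _) (by positivity)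
      _ = ε / 2 := by ring
  have hlim := (h.flux n).sub (hsq.const_mul (1 / 2 * (n * I)))
  rw [mul_zero, sub_zero] at hlim
  refine hlim.congr' ?_
  filter_upwards [h.eventually_mem] with x hx
  have c1 := h.continuous_v hx
  have c2 := h.continuous_f hx
  have c3 : Continuous fun θ => conj (g (pt x θ)) := continuous_conj.comp (h.continuous_g hx)
  have c4 : Continuous fun θ => conj (v (pt x θ)) := continuous_conj.comp c1
  have c5 : Continuous fun θ => I * (f (pt x θ) - conj (g (pt x θ))) :=
    continuous_const.mul (c2.sub c3)
  have c6 : Continuous fun θ => conj (I * (f (pt x θ) - conj (g (pt x θ)))) :=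
    continuous_conj.comp c5
  have c7 : Continuous fun θ => conj (I * (f (pt x θ) - conj (g (pt x θ)))) * v (pt x θ) +
      conj (v (pt x θ)) * (I * (f (pt x θ) - conj (g (pt x θ)))) := (c6.mul c1).add (c4.mul c5)
  have hder := fc_deriv (φ := fun θ => conj (v (pt x θ)) * v (pt x θ) - 1)
    (fun θ => ((hasDerivAt_conj (h.hvt x hx θ)).mul (h.hvt x hx θ)).sub_const 1) c7
    (by have := periodic_slice h.pv x 0; simp only [zero_add] at this; simp only [this]) n
  have c8 : Continuous fun θ =>
      ((conj (v (pt x θ)) * (f (pt x θ) + conj (g (pt x θ)))).im : ℂ) :=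
    continuous_ofReal.comp (continuous_im.comp (c4.mul (c2.add c3)))
  rw [mul_assoc, ← hder, ← fc_const_mul, ← fc_sub c8 (c7.const_mul (1 / 2))]
  congr 1
  ext θ
  apply Complex.ext <;> simp <;> ring

/-- The closed form has no period: its integral over a circle does not depend on the circle, and
tends to zero at the boundary. -/
lemma integral_P_eq_zero (h : EndData L v f g) {x : ℝ} (hx : x ∈ Ioo L 0) :
    ∫ θ in (0 : ℝ)..(2 * Real.pi), 2 * (conj (v (pt x θ)) * f (pt x θ)).im = 0 := by
  set p : ℝ → ℝ := fun x => ∫ θ in (0 : ℝ)..(2 * Real.pi), 2 * (conj (v (pt x θ)) * f (pt x θ)).im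
    with hp
  have hder : ∀ y ∈ Ioo L 0, HasDerivAt p 0 y := fun y hy => by
    have h1 := hasDerivAt_integral 0 (2 * Real.pi)
      (φ := fun x θ => 2 * (conj (v (pt x θ)) * f (pt x θ)).im)
      (fun y hy => h.continuous_P hy)
      (continuousOn_comp₁ (G := fun z : ℂ => 2 * z.im) (by fun_prop)
        (continuousOn_slice h.continuousOn_Wx))
      (fun y hy θ => (hasDerivAt_im (h.hasDerivAt_W_left hy θ)).const_mul 2) hy
    have h2 : ∫ θ in (0 : ℝ)..(2 * Real.pi), 2 * (conj (f (pt y θ) + conj (g (pt y θ))) * f (pt y θ) +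
        conj (v (pt y θ)) * deriv f (pt y θ)).im = 0 := by
      simp only [closed_identity]
      rw [intervalIntegral.integral_eq_sub_of_hasDerivAt
        (fun θ _ => (hasDerivAt_re (h.hasDerivAt_W_right hy θ)).const_mul (-2))]
      · have e1 := periodic_slice h.pv y 0
        have e2 := periodic_slice h.pf y 0
        simp only [zero_add] at e1 e2
        rw [e1, e2, sub_self]
      · exact (continuous_const.mul (continuous_re.comp
          (continuous_slice (continuousOn_slice h.continuousOn_Wt) hy))).intervalIntegrable _ _
    rw [← h2]
    exact h1
  have hconst : ∀ y ∈ Ioo L 0, p y = p x := fun y hy =>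
    isOpen_Ioo.is_const_of_deriv_eq_zero (𝕜 := ℝ) (convex_Ioo L 0).isPreconnected
      (fun y hy => (hder y hy).differentiableAt.differentiableWithinAt)
      (fun y hy => (hder y hy).deriv) hy hx
  have hlim : Tendsto (fun y => (p y : ℂ)) (𝓝[<] 0) (𝓝 0) := by
    have := (h.tendsto_fc_P 0).const_mul (2 * Real.pi : ℂ)
    rw [mul_zero] at this
    refine this.congr fun y => ?_
    rw [← integral_ex_mul, hp, ← intervalIntegral.integral_ofReal]
    simp [ex_zero]
  have hlim2 : Tendsto (fun y => (p y : ℂ)) (𝓝[<] 0) (𝓝 (p x)) := by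
    refine tendsto_const_nhds.congr' ?_
    filter_upwards [h.eventually_mem] with y hy
    rw [hconst y hy]
  exact_mod_cast tendsto_nhds_unique hlim2 hlim

lemma integral_f_le (h : EndData L v f g) {x : ℝ} (hx : x ∈ Ioo L 0) :
    ∫ θ in (0 : ℝ)..(2 * Real.pi), 4 * ‖f (pt x θ)‖ ≤
      8 * Real.pi + ∫ θ in (0 : ℝ)..(2 * Real.pi), ‖f (pt x θ)‖ ^ 2 := by
  have c := h.continuous_f hx
  have c2 : Continuous fun θ => ‖f (pt x θ)‖ ^ 2 := c.norm.pow 2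
  have e : 8 * Real.pi + ∫ θ in (0 : ℝ)..(2 * Real.pi), ‖f (pt x θ)‖ ^ 2 =
      ∫ θ in (0 : ℝ)..(2 * Real.pi), (4 + ‖f (pt x θ)‖ ^ 2) := by
    rw [intervalIntegral.integral_add (by simp) (c2.intervalIntegrable _ _)]
    simp; ring
  rw [e]
  refine intervalIntegral.integral_mono_on Real.two_pi_pos.le
    ((continuous_const.mul c.norm).intervalIntegrable _ _)
    ((continuous_const.add (c.norm.pow 2)).intervalIntegrable _ _) fun θ _ => ?_
  nlinarith [sq_nonneg (‖f (pt x θ)‖ - 2)]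

/-- Existence of the normalised potential. -/
lemma exists_potential (h : EndData L v f g) (hv : ∀ x ∈ Ioo L 0, ∀ θ, ‖v (pt x θ)‖ ≤ 2) :
    ∃ k, IsPotential L v f k := by
  have hL := h.neg
  set P : ℝ → ℝ → ℝ := fun x θ => 2 * (conj (v (pt x θ)) * f (pt x θ)).im with hP
  set Q : ℝ → ℝ → ℝ := fun x θ => -2 * (conj (v (pt x θ)) * f (pt x θ)).re with hQ
  have hm : L / 2 ∈ Ioo L 0 := ⟨by linarith, by linarith⟩
  have cQ : ContinuousOn (Function.uncurry Q) (Ioo L 0 ×ˢ univ) :=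
    continuousOn_comp₁ (G := fun z : ℂ => -2 * z.re) (by fun_prop)
      (continuousOn_slice h.continuousOn_W)
  set k₀ : ℝ → ℝ → ℝ := fun x θ => (∫ s in (L / 2)..x, Q s 0) + ∫ s in (0 : ℝ)..θ, P x s with hk₀
  have sub : ∀ x ∈ Ioo L 0, uIcc (L / 2) x ⊆ Ioo L 0 := fun x hx =>
    (convex_Ioo L 0).ordConnected.uIcc_subset hm hx
  have cQ0 : ContinuousOn (fun s => Q s 0) (Ioo L 0) :=
    cQ.comp (f := fun s => (s, (0 : ℝ))) (by fun_prop) fun s hs => ⟨hs, trivial⟩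
  have k_t : ∀ x ∈ Ioo L 0, ∀ θ, HasDerivAt (k₀ x) (P x θ) θ := fun x hx θ =>
    (intervalIntegral.integral_hasDerivAt_right ((h.continuous_P hx).intervalIntegrable _ _)
      ((h.continuous_P hx).stronglyMeasurableAtFilter _ _) (h.continuous_P hx).continuousAt).const_add _
  have k_x : ∀ x ∈ Ioo L 0, ∀ θ, HasDerivAt (fun t => k₀ t θ) (Q x θ) x := fun x hx θ => by
    have h1 : HasDerivAt (fun t => ∫ s in (L / 2)..t, Q s 0) (Q x 0) x := by
      refine intervalIntegral.integral_hasDerivAt_right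
        ((cQ0.mono (sub x hx)).intervalIntegrable) ?_ (cQ0.continuousAt (Ioo_mem_nhds hx.1 hx.2))
      exact cQ0.stronglyMeasurableAtFilter isOpen_Ioo x hx
    have h2 := hasDerivAt_integral 0 θ (φ := P) (fun y hy => h.continuous_P hy)
      (continuousOn_comp₁ (G := fun z : ℂ => 2 * z.im) (by fun_prop)
        (continuousOn_slice h.continuousOn_Wx))
      (fun y hy θ => (hasDerivAt_im (h.hasDerivAt_W_left hy θ)).const_mul 2) hx
    have h3 : ∫ s in (0 : ℝ)..θ, 2 * (conj (f (pt x s) + conj (g (pt x s))) * f (pt x s) +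
        conj (v (pt x s)) * deriv f (pt x s)).im = Q x θ - Q x 0 := by
      simp only [closed_identity]
      rw [intervalIntegral.integral_eq_sub_of_hasDerivAt
        (fun θ _ => (hasDerivAt_re (h.hasDerivAt_W_right hx θ)).const_mul (-2))]
      exact (continuous_const.mul (continuous_re.comp
          (continuous_slice (continuousOn_slice h.continuousOn_Wt) hx))).intervalIntegrable _ _
    have h4 := h1.add h2
    rw [h3, add_sub_cancel] at h4
    exact h4
  have k_per : ∀ x ∈ Ioo L 0, Function.Periodic (k₀ x) (2 * Real.pi) := fun x hx θ => by
    have pP : Function.Periodic (P x) (2 * Real.pi) := fun θ => by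
      simp only [hP, periodic_slice h.pv x θ, periodic_slice h.pf x θ]
    have := pP.intervalIntegral_add_eq θ 0
    rw [zero_add, h.integral_P_eq_zero hx] at this
    have i : ∀ a b, IntervalIntegrable (P x) volume a b := fun a b =>
      (h.continuous_P hx).intervalIntegrable _ _
    simp only [hk₀]
    rw [← intervalIntegral.integral_add_adjacent_intervals (i 0 θ) (i θ (θ + 2 * Real.pi)), this,
      add_zero]
  have k_cont : ∀ x ∈ Ioo L 0, Continuous (k₀ x) := fun x hx =>
    continuous_iff_continuousAt.2 fun θ => (k_t x hx θ).continuousAt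
  -- the mean value of the potential over circles has a limit at the boundary
  set m : ℝ → ℝ := fun x => ∫ θ in (0 : ℝ)..(2 * Real.pi), k₀ x θ with hm_def
  set q : ℝ → ℝ := fun x => ∫ θ in (0 : ℝ)..(2 * Real.pi), Q x θ with hq_def
  have m_der : ∀ x ∈ Ioo L 0, HasDerivAt m (q x) x := fun x hx =>
    hasDerivAt_integral 0 (2 * Real.pi) k_cont cQ k_x hx
  have cq : ContinuousOn q (Ioo L 0) := continuousOn_circ cQ
  have iq : IntegrableOn q (Ioo L 0) := by
    have i0 : IntegrableOn (fun _ : ℝ => 8 * Real.pi) (Ioo L 0) :=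
      integrableOn_const (by simp)
    refine (i0.add h.integrable_energy_f).mono' (cq.aestronglyMeasurable measurableSet_Ioo) ?_
    refine (ae_restrict_iff' measurableSet_Ioo).2 (ae_of_all _ fun x hx => ?_)
    refine (intervalIntegral.norm_integral_le_integral_norm Real.two_pi_pos.le).trans
      (le_trans ?_ (h.integral_f_le hx))
    refine intervalIntegral.integral_mono_on Real.two_pi_pos.le
      ((h.continuous_Q hx).norm.intervalIntegrable _ _)
      ((continuous_const.mul (h.continuous_f hx).norm).intervalIntegrable _ _) fun θ _ => ?_
    have h1 := abs_re_le_norm (conj (v (pt x θ)) * f (pt x θ))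
    rw [norm_mul, RCLike.norm_conj] at h1
    have h2 := hv x hx θ
    rw [hQ, norm_mul, Real.norm_eq_abs, Real.norm_eq_abs, abs_neg, abs_two]
    nlinarith [norm_nonneg (f (pt x θ))]
  have m_eq : ∀ x ∈ Ioo L 0, m x = m (L / 2) + (∫ t in (L / 2)..0, q t) - ∫ t in x..0, q t :=
      fun x hx => by
    have h1 : ∫ t in (L / 2)..x, q t = m x - m (L / 2) :=
      intervalIntegral.integral_eq_sub_of_hasDerivAt (fun t ht => m_der t (sub x hx ht))
        ((cq.mono (sub x hx)).intervalIntegrable)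
    have h2 := intervalIntegral.integral_add_adjacent_intervals
      ((cq.mono (sub x hx)).intervalIntegrable (μ := volume))
      (intervalIntegrable_tail iq hx.1 le_rfl hx.2.le)
    linarith
  set c := (2 * Real.pi)⁻¹ * (m (L / 2) + ∫ t in (L / 2)..0, q t) with hc
  refine ⟨fun x θ => k₀ x θ - c, fun x hx θ => (k_x x hx θ).sub_const c,
    fun x hx θ => (k_t x hx θ).sub_const c, fun x hx θ => by simp only [k_per x hx θ], fun n => ?_⟩
  by_cases hn : n = 0
  · subst hn
    have hlim := ((tendsto_tail hL iq).const_mul (-(2 * Real.pi)⁻¹)).ofReal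
    rw [mul_zero, ofReal_zero] at hlim
    refine hlim.congr' ?_
    filter_upwards [h.eventually_mem] with x hx
    have e1 : ∫ θ in (0 : ℝ)..(2 * Real.pi), (k₀ x θ - c) = m x - 2 * Real.pi * c := by
      rw [intervalIntegral.integral_sub ((k_cont x hx).intervalIntegrable _ _) (by simp)]
      simp [hm_def]
    have e2 : fc (fun θ => ((k₀ x θ - c : ℝ) : ℂ)) 0 =
        (((2 * Real.pi)⁻¹ * (m x - 2 * Real.pi * c) : ℝ) : ℂ) := by
      rw [fc_eq, ← e1, ofReal_mul, ← intervalIntegral.integral_ofReal]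
      simp [ex_zero]
    rw [e2, m_eq x hx, hc]
    congr 1
    have := Real.pi_pos
    field_simp
    ring
  · have hlim := (h.tendsto_fc_P n).const_mul ((n * I : ℂ)⁻¹)
    rw [mul_zero] at hlim
    refine hlim.congr' ?_
    filter_upwards [h.eventually_mem] with x hx
    have h1 := fc_deriv (φ := fun θ => ((k₀ x θ - c : ℝ) : ℂ))
      (fun θ => ((k_t x hx θ).sub_const c).ofReal_comp)
      (continuous_ofReal.comp (h.continuous_P hx))
      (by have := k_per x hx 0; simp only [zero_add] at this; simp only [this]) n
    rw [h1, inv_mul_cancel_left₀]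
    simpa using hn

end EndData

/-! ### The hole-filling inequality -/

/-- An integrable function is frequently `o(1/|x|)`, since `1/x` is not integrable. -/
lemma frequently_abs_mul_le {e : ℝ → ℝ} {L : ℝ} (hL : L < 0) (he : IntegrableOn e (Ioo L 0))
    {η : ℝ} (hη : 0 < η) : ∃ᶠ x in 𝓝[<] (0 : ℝ), |x| * e x ≤ η := by
  intro hcon
  obtain ⟨y, hy, hy'⟩ := (mem_nhdsLT_iff_exists_Ioo_subset (a := (0 : ℝ))).1
    (inter_mem hcon (Ioo_mem_nhdsLT hL))
  simp only [mem_Iio] at hy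
  have hint : IntegrableOn (fun x : ℝ => x⁻¹) (Ioo y 0) := by
    have h1 : IntegrableOn (fun x => η⁻¹ * e x) (Ioo y 0) :=
      (he.mono_set fun x hx => (hy' hx).2).const_mul _
    refine h1.mono' measurable_inv.aestronglyMeasurable ?_
    refine (ae_restrict_iff' measurableSet_Ioo).2 (ae_of_all _ fun x hx => ?_)
    have h2 : η < |x| * e x := not_le.1 (hy' hx).1
    have h3 : 0 < |x| := abs_pos.2 hx.2.ne
    rw [Real.norm_eq_abs, abs_inv, inv_mul_eq_div, le_div_iff₀ hη, inv_mul_eq_div,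
      div_le_iff₀ h3]
    linarith
  rw [← intervalIntegrable_iff_integrableOn_Ioo_of_le hy.le, intervalIntegrable_inv_iff] at hint
  rcases hint with h | h
  · exact hy.ne h
  · exact h right_mem_uIcc

namespace IsPotential

variable {L : ℝ} {v f g : ℂ → ℂ} {k : ℝ → ℝ → ℝ}

lemma mono (hk : IsPotential L v f k) {L' : ℝ} (hL : L ≤ L') : IsPotential L' v f k where
  hx x hx := hk.hx x ⟨hL.trans_lt hx.1, hx.2⟩
  ht x hx := hk.ht x ⟨hL.trans_lt hx.1, hx.2⟩
  periodic x hx := hk.periodic x ⟨hL.trans_lt hx.1, hx.2⟩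
  coeff := hk.coeff

lemma continuous (hk : IsPotential L v f k) {x : ℝ} (hx : x ∈ Ioo L 0) : Continuous (k x) :=
  continuous_iff_continuousAt.2 fun θ => (hk.ht x hx θ).continuousAt

end IsPotential

namespace EndData

variable {L : ℝ} {v f g : ℂ → ℂ} {k : ℝ → ℝ → ℝ}

/-- The squared `L²` norm of the gradient of the potential over a circle. -/
noncomputable def gradSq (v f : ℂ → ℂ) (x : ℝ) : ℝ :=
  ∫ θ in (0 : ℝ)..(2 * Real.pi), 4 * ‖conj (v (pt x θ)) * f (pt x θ)‖ ^ 2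

lemma gradSq_nonneg (v f : ℂ → ℂ) (x : ℝ) : 0 ≤ gradSq v f x :=
  intervalIntegral.integral_nonneg Real.two_pi_pos.le fun _ _ => by positivity

lemma continuousOn_gradSq (h : EndData L v f g) : ContinuousOn (gradSq v f) (Ioo L 0) :=
  continuousOn_circ (continuousOn_comp₁ (G := fun z : ℂ => 4 * ‖z‖ ^ 2) (by fun_prop)
    (continuousOn_slice h.continuousOn_W))

lemma continuous_gradSq_slice (h : EndData L v f g) {x : ℝ} (hx : x ∈ Ioo L 0) :
    Continuous fun θ => 4 * ‖conj (v (pt x θ)) * f (pt x θ)‖ ^ 2 :=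
  continuous_const.mul
    ((continuous_slice (continuousOn_slice h.continuousOn_W) hx).norm.pow 2)

lemma integrableOn_gradSq (h : EndData L v f g) (hv : ∀ x ∈ Ioo L 0, ∀ θ, ‖v (pt x θ)‖ ≤ 2) :
    IntegrableOn (gradSq v f) (Ioo L 0) := by
  refine (h.integrable_energy_f.const_mul 16).mono'
    (h.continuousOn_gradSq.aestronglyMeasurable measurableSet_Ioo) ?_
  refine (ae_restrict_iff' measurableSet_Ioo).2 (ae_of_all _ fun x hx => ?_)
  rw [Real.norm_of_nonneg (gradSq_nonneg v f x), gradSq, ← intervalIntegral.integral_const_mul]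
  refine intervalIntegral.integral_mono_on Real.two_pi_pos.le
    ((h.continuous_gradSq_slice hx).intervalIntegrable _ _)
    ((continuous_const.mul ((h.continuous_f hx).norm.pow 2)).intervalIntegrable _ _) fun θ _ => ?_
  rw [norm_mul, RCLike.norm_conj, mul_pow]
  have h1 : ‖v (pt x θ)‖ ^ 2 ≤ 2 ^ 2 := by gcongr; exact hv x hx θ
  nlinarith [sq_nonneg ‖f (pt x θ)‖]

/-- The potential is small in `L²` near the boundary: `∫ k² ≤ |x| ∫ₓ⁰ ∫ |∇k|²`. -/
lemma integral_potential_sq_le (h : EndData L v f g) (hk : IsPotential L v f k)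
    (hv : ∀ x ∈ Ioo L 0, ∀ θ, ‖v (pt x θ)‖ ≤ 2) {x : ℝ} (hx : x ∈ Ioo L 0) :
    ∫ θ in (0 : ℝ)..(2 * Real.pi), k x θ ^ 2 ≤ |x| * ∫ t in x..0, gradSq v f t := by
  have hpi := Real.two_pi_pos
  have iD := h.integrableOn_gradSq hv
  have cC : ∀ y ∈ Ioo L 0, Continuous fun θ => (k y θ : ℂ) := fun y hy =>
    continuous_ofReal.comp (hk.continuous hy)
  have hinc : ∀ y ∈ Ioo x 0, (2 * Real.pi)⁻¹ *
      ∫ θ in (0 : ℝ)..(2 * Real.pi), ‖(k y θ : ℂ) - (k x θ : ℂ)‖ ^ 2 ≤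
      (2 * Real.pi)⁻¹ * (|x| * ∫ t in x..0, gradSq v f t) := fun y hy => by
    have hyL : y ∈ Ioo L 0 := ⟨hx.1.trans hy.1, hy.2⟩
    have cQ := continuousOn_comp₁ (G := fun z : ℂ => ((-2 * z.re : ℝ) : ℂ)) (by fun_prop)
      (continuousOn_slice h.continuousOn_W)
    have h1 := integral_sq_sub_le (φ := fun x θ => (k x θ : ℂ)) cC cQ
      (fun y hy θ => (hk.hx y hy θ).ofReal_comp) hx hyL hy.1.le
    have i1 := intervalIntegrable_tail iD hx.1 hy.2.le hy.1.le
    have hle : ∫ t in x..y, ∫ θ in (0 : ℝ)..(2 * Real.pi),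
        ‖((-2 * (conj (v (pt t θ)) * f (pt t θ)).re : ℝ) : ℂ)‖ ^ 2 ≤ ∫ t in x..y, gradSq v f t := by
      have c1 := continuousOn_circ (continuousOn_comp₁
        (G := fun z : ℂ => ‖((-2 * z.re : ℝ) : ℂ)‖ ^ 2) (by fun_prop)
        (continuousOn_slice h.continuousOn_W))
      refine intervalIntegral.integral_mono_on hy.1.le ((c1.mono fun t ht =>
        ⟨hx.1.trans_le ht.1, ht.2.trans_lt hy.2⟩).intervalIntegrable_of_Icc hy.1.le) i1
        fun t ht => ?_
      have htL : t ∈ Ioo L 0 := ⟨hx.1.trans_le ht.1, ht.2.trans_lt hy.2⟩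
      refine intervalIntegral.integral_mono_on hpi.le
        (Continuous.intervalIntegrable ?_ _ _)
        ((h.continuous_gradSq_slice htL).intervalIntegrable _ _) fun θ _ => ?_
      · exact (continuous_ofReal.comp (h.continuous_Q htL)).norm.pow 2
      · have := abs_re_le_norm (conj (v (pt t θ)) * f (pt t θ))
        rw [norm_real, Real.norm_eq_abs, sq_abs, mul_pow]
        have h2 : (conj (v (pt t θ)) * f (pt t θ)).re ^ 2 ≤ ‖conj (v (pt t θ)) * f (pt t θ)‖ ^ 2 := by
          rw [← sq_abs]; gcongr
        linarith
    have hext : ∫ t in x..y, gradSq v f t ≤ ∫ t in x..0, gradSq v f t := by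
      have i2 := intervalIntegrable_tail iD hyL.1 le_rfl hy.2.le
      rw [← intervalIntegral.integral_add_adjacent_intervals i1 i2]
      have := intervalIntegral.integral_nonneg (μ := volume) hy.2.le
        fun t _ => gradSq_nonneg v f t
      linarith
    have h0 : 0 ≤ ∫ t in x..0, gradSq v f t :=
      intervalIntegral.integral_nonneg hx.2.le fun t _ => gradSq_nonneg v f t
    gcongr
    refine h1.trans ?_
    rw [abs_of_neg hx.2]
    calc _ ≤ (y - x) * ∫ t in x..0, gradSq v f t := by
          have : 0 ≤ y - x := by linarith [hy.1]
          gcongr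
          exact hle.trans hext
      _ ≤ _ := by gcongr; linarith [hy.2]
  have hsum := hasSum_sq_fc (cC x hx)
  have hfin : ∀ S : Finset ℤ, ∑ n ∈ S, ‖fc (fun θ => (k x θ : ℂ)) n‖ ^ 2 ≤
      (2 * Real.pi)⁻¹ * (|x| * ∫ t in x..0, gradSq v f t) := fun S => by
    have hlim : Tendsto (fun y => ∑ n ∈ S, ‖fc (fun θ => (k y θ : ℂ)) n -
        fc (fun θ => (k x θ : ℂ)) n‖ ^ 2) (𝓝[<] 0)
        (𝓝 (∑ n ∈ S, ‖0 - fc (fun θ => (k x θ : ℂ)) n‖ ^ 2)) :=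
      tendsto_finsetSum _ fun n _ => ((((hk.coeff n).sub_const _).norm).pow 2)
    simp only [zero_sub, norm_neg] at hlim
    refine le_of_tendsto hlim ?_
    filter_upwards [Ioo_mem_nhdsLT hx.2] with y hy
    have hyL : y ∈ Ioo L 0 := ⟨hx.1.trans hy.1, hy.2⟩
    have hp := hasSum_sq_fc ((cC y hyL).sub (cC x hx))
    simp only [Pi.sub_apply] at hp
    refine le_trans ?_ (hinc y hy)
    refine le_trans (le_of_eq ?_) (sum_le_hasSum S (fun n _ => sq_nonneg _) hp)
    refine Finset.sum_congr rfl fun n _ => ?_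
    rw [← fc_sub (cC y hyL) (cC x hx)]
    rfl
  have hle := hasSum_le_of_sum_le hsum hfin
  have := le_of_mul_le_mul_left hle (by positivity)
  simpa using this

/-- The potential tends to zero uniformly at the boundary line. -/
lemma eventually_potential (h : EndData L v f g) (hk : IsPotential L v f k)
    (hv : ∀ x ∈ Ioo L 0, ∀ θ, ‖v (pt x θ)‖ ≤ 2) {ε : ℝ} (hε : 0 < ε) :
    ∀ᶠ x in 𝓝[<] (0 : ℝ), ∀ θ, |k x θ| ≤ ε := by
  have htail := (tendsto_tail h.neg (h.integrableOn_gradSq hv)).eventually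
    (ge_mem_nhds (by positivity : 0 < (ε / 2) ^ 2))
  filter_upwards [htail, h.eventually_mem, h.eventually_f (by positivity : 0 < ε / 8),
    Ioo_mem_nhdsLT (by norm_num : (-1 : ℝ) < 0)] with x h1 hx h2 hx1 θ₀
  have hx0 : 0 < |x| := abs_pos.2 hx.2.ne
  have hL : ∀ s t, ‖k x s - k x t‖ ≤ ε / 2 / |x| * |s - t| := by
    refine lipschitz_of_hasDerivAt (hk.ht x hx) fun θ => ?_
    rw [le_div_iff₀ hx0, norm_mul, Real.norm_eq_abs, Real.norm_eq_abs, abs_two]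
    have e1 := abs_im_le_norm (conj (v (pt x θ)) * f (pt x θ))
    rw [norm_mul, RCLike.norm_conj] at e1
    have e2 : ‖v (pt x θ)‖ * ‖f (pt x θ)‖ ≤ 2 * ‖f (pt x θ)‖ := by gcongr; exact hv x hx θ
    nlinarith [h2 θ]
  have := abs_le_of_lipschitz_of_integral_sq (φ := k x) (hk.continuous hx) (hk.periodic x hx)
    (M := ε / 2 / |x|) (d := |x|) (ε := ε / 2) hx0
    (by rw [abs_of_neg hx.2]; linarith [hx1.1, Real.pi_gt_three])
    (by positivity) (by positivity) hL (by field_simp; rfl)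
    ((h.integral_potential_sq_le hk hv hx).trans (by gcongr)) θ₀
  linarith

/-- The identity `Δk = -4|f|²`, in terms of `a = v`, `b = f`, `c = g`, `d = f'`. -/
lemma _root_.SemiStiff.laplace_identity (a b c d : ℂ) :
    -2 * (conj (b + conj c) * b + conj a * d).re +
      2 * (conj (I * (b - conj c)) * b + conj a * (I * d)).im = -4 * ‖b‖ ^ 2 := by
  rw [← normSq_eq_norm_sq, normSq_apply]
  simp; ring

/-- The hole-filling inequality for the potential: since `Δk = -|∇k|² / |v|²` and `k` is small,
testing the equation with `k` bounds the energy `T(x)` in `(x, 0)` by a multiple of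
`(|x| T(x) |T'(x)|)^{1/2}`, and `T(x)` cancels to leave `3/4 T ≤ |x| |T'|`. -/
lemma hole_filling (h : EndData L v f g) (hk : IsPotential L v f k)
    (hv : ∀ x ∈ Ioo L 0, ∀ θ, ‖v (pt x θ)‖ ≤ 2)
    (hv' : ∀ x ∈ Ioo L 0, ∀ θ, 1 / 2 ≤ ‖v (pt x θ)‖ ^ 2)
    (hk' : ∀ x ∈ Ioo L 0, ∀ θ, |k x θ| ≤ 1 / 20) {x : ℝ} (hx : x ∈ Ioo L 0) :
    3 / 4 * ∫ t in x..0, gradSq v f t ≤ |x| * gradSq v f x := by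
  have hpi := Real.two_pi_pos
  have iD := h.integrableOn_gradSq hv
  set P : ℝ → ℝ → ℝ := fun x θ => 2 * (conj (v (pt x θ)) * f (pt x θ)).im with hP
  set Q : ℝ → ℝ → ℝ := fun x θ => -2 * (conj (v (pt x θ)) * f (pt x θ)).re with hQ
  set Qx : ℝ → ℝ → ℝ := fun x θ => -2 * (conj (f (pt x θ) + conj (g (pt x θ))) * f (pt x θ) +
      conj (v (pt x θ)) * deriv f (pt x θ)).re with hQx
  set Pt : ℝ → ℝ → ℝ := fun x θ => 2 * (conj (I * (f (pt x θ) - conj (g (pt x θ)))) * f (pt x θ) +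
      conj (v (pt x θ)) * (I * deriv f (pt x θ))).im with hPt
  set D := gradSq v f with hD
  set G : ℝ → ℝ := fun x => ∫ θ in (0 : ℝ)..(2 * Real.pi), k x θ * Q x θ with hG
  have cW := continuousOn_slice h.continuousOn_W
  have cQ : ContinuousOn (Function.uncurry Q) (Ioo L 0 ×ˢ univ) :=
    continuousOn_comp₁ (G := fun z : ℂ => -2 * z.re) (by fun_prop) cW
  have cQx : ContinuousOn (Function.uncurry Qx) (Ioo L 0 ×ˢ univ) :=
    continuousOn_comp₁ (G := fun z : ℂ => -2 * z.re) (by fun_prop)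
      (continuousOn_slice h.continuousOn_Wx)
  have cPt : ContinuousOn (Function.uncurry Pt) (Ioo L 0 ×ˢ univ) :=
    continuousOn_comp₁ (G := fun z : ℂ => 2 * z.im) (by fun_prop)
      (continuousOn_slice h.continuousOn_Wt)
  have ck : ContinuousOn (Function.uncurry k) (Ioo L 0 ×ˢ univ) :=
    continuousOn_uncurry_of_hasDerivAt (fun y hy => hk.continuous hy) cQ hk.hx
  have hPQ : ∀ y θ, P y θ ^ 2 + Q y θ ^ 2 = 4 * ‖conj (v (pt y θ)) * f (pt y θ)‖ ^ 2 := fun y θ => by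
    rw [← normSq_eq_norm_sq, normSq_apply]; simp only [hP, hQ]; ring
  have G_der : ∀ y ∈ Ioo L 0, HasDerivAt G (∫ θ in (0 : ℝ)..(2 * Real.pi),
      (Q y θ * Q y θ + k y θ * Qx y θ)) y := fun y hy =>
    hasDerivAt_integral 0 (2 * Real.pi) (φ := fun y θ => k y θ * Q y θ)
      (φ' := fun y θ => Q y θ * Q y θ + k y θ * Qx y θ)
      (fun y hy => (hk.continuous hy).mul (h.continuous_Q hy))
      ((cQ.mul cQ).add (ck.mul cQx))
      (fun y hy θ => (hk.hx y hy θ).mul ((hasDerivAt_re (h.hasDerivAt_W_left hy θ)).const_mul (-2)))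
      hy
  have G_der_ge : ∀ y ∈ Ioo L 0, 9 / 10 * D y ≤ ∫ θ in (0 : ℝ)..(2 * Real.pi),
      (Q y θ * Q y θ + k y θ * Qx y θ) := fun y hy => by
    have c1 := h.continuous_P hy
    have c2 := h.continuous_Q hy
    have c3 := continuous_slice cQx hy
    have c4 := continuous_slice cPt hy
    have c5 := hk.continuous hy
    have c6 := h.continuous_gradSq_slice hy
    have parts : ∫ θ in (0 : ℝ)..(2 * Real.pi), k y θ * Pt y θ =
        -∫ θ in (0 : ℝ)..(2 * Real.pi), P y θ * P y θ := by
      have pk := hk.periodic y hy 0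
      have e1 := periodic_slice h.pv y 0
      have e2 := periodic_slice h.pf y 0
      simp only [zero_add] at pk e1 e2
      rw [intervalIntegral.integral_mul_deriv_eq_deriv_mul (fun θ _ => hk.ht y hy θ)
        (fun θ _ => (hasDerivAt_im (h.hasDerivAt_W_right hy θ)).const_mul 2)
        (c1.intervalIntegrable _ _) (c4.intervalIntegrable _ _), pk]
      simp only [hP, e1, e2]
      ring
    have c7 : Continuous fun θ => Q y θ * Q y θ + k y θ * Qx y θ := (c2.mul c2).add (c5.mul c3)
    have c8 : Continuous fun θ => k y θ * Pt y θ := c5.mul c4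
    have c9 : Continuous fun θ => P y θ * P y θ := c1.mul c1
    have c10 : Continuous fun θ => k y θ * Pt y θ + P y θ * P y θ := c8.add c9
    have e : ∫ θ in (0 : ℝ)..(2 * Real.pi), (Q y θ * Q y θ + k y θ * Qx y θ) =
        ∫ θ in (0 : ℝ)..(2 * Real.pi), ((Q y θ * Q y θ + k y θ * Qx y θ) +
          (k y θ * Pt y θ + P y θ * P y θ)) := by
      rw [intervalIntegral.integral_add (c7.intervalIntegrable _ _)
        (c10.intervalIntegrable _ _), intervalIntegral.integral_add
        (c8.intervalIntegrable _ _) (c9.intervalIntegrable _ _), parts]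
      ring
    rw [e, hD, gradSq, ← intervalIntegral.integral_const_mul]
    refine intervalIntegral.integral_mono_on hpi.le
      ((continuous_const.mul c6).intervalIntegrable _ _)
      ((c7.add c10).intervalIntegrable _ _) fun θ _ => ?_
    have id1 : Qx y θ + Pt y θ = -4 * ‖f (pt y θ)‖ ^ 2 := laplace_identity _ _ _ _
    have id2 := hPQ y θ
    have b1 := hk' y hy θ
    have b2 := hv' y hy θ
    have b3 : ‖conj (v (pt y θ)) * f (pt y θ)‖ ^ 2 = ‖v (pt y θ)‖ ^ 2 * ‖f (pt y θ)‖ ^ 2 := by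
      rw [norm_mul, RCLike.norm_conj, mul_pow]
    -- `|∇k|² = 4 |v|² |f|² ≥ 2 |f|²`, so `4 |k| |f|² ≤ |∇k|² / 10`
    have b4 : ‖f (pt y θ)‖ ^ 2 ≤ 2 * ‖conj (v (pt y θ)) * f (pt y θ)‖ ^ 2 := by
      rw [b3]; nlinarith [sq_nonneg ‖f (pt y θ)‖]
    have b5 : k y θ * ‖f (pt y θ)‖ ^ 2 ≤ 1 / 20 * ‖f (pt y θ)‖ ^ 2 := by
      gcongr; exact (le_abs_self _).trans b1
    have expand : (Q y θ * Q y θ + k y θ * Qx y θ) + (k y θ * Pt y θ + P y θ * P y θ) =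
        (P y θ ^ 2 + Q y θ ^ 2) + k y θ * (Qx y θ + Pt y θ) := by ring
    rw [expand, id1, id2]
    nlinarith
  have G_sq : ∀ y ∈ Ioo L 0, G y ^ 2 ≤ (|y| * ∫ t in y..0, D t) * D y := fun y hy => by
    have c2 := h.continuous_Q hy
    refine (sq_integral_mul_le hpi.le (hk.continuous hy).continuousOn c2.continuousOn).trans ?_
    have h1 := h.integral_potential_sq_le hk hv hy
    have h2 : ∫ θ in (0 : ℝ)..(2 * Real.pi), Q y θ ^ 2 ≤ D y := by
      refine intervalIntegral.integral_mono_on hpi.le ((c2.pow 2).intervalIntegrable _ _)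
        ((h.continuous_gradSq_slice hy).intervalIntegrable _ _) fun θ _ => ?_
      rw [← hPQ]
      have := sq_nonneg (P y θ)
      linarith
    exact mul_le_mul h1 h2 (intervalIntegral.integral_nonneg hpi.le fun _ _ => sq_nonneg _)
      (le_trans (intervalIntegral.integral_nonneg hpi.le fun _ _ => sq_nonneg _) h1)
  have hsub : ∀ y ∈ Ioo x 0, Icc x y ⊆ Ioo L 0 := fun y hy t ht =>
    ⟨hx.1.trans_le ht.1, ht.2.trans_lt hy.2⟩
  have G_inc : ∀ y ∈ Ioo x 0, 9 / 10 * ∫ t in x..y, D t ≤ G y - G x := fun y hy => by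
    have c : ContinuousOn (fun y => ∫ θ in (0 : ℝ)..(2 * Real.pi),
        (Q y θ * Q y θ + k y θ * Qx y θ)) (Ioo L 0) :=
      continuousOn_circ (φ := fun y θ => Q y θ * Q y θ + k y θ * Qx y θ)
        ((cQ.mul cQ).add (ck.mul cQx))
    have e := intervalIntegral.integral_eq_sub_of_hasDerivAt (a := x) (b := y)
      (fun t ht => G_der t (hsub y hy (by rwa [uIcc_of_le hy.1.le] at ht)))
      ((c.mono (hsub y hy)).intervalIntegrable_of_Icc hy.1.le)
    rw [← e, ← intervalIntegral.integral_const_mul]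
    exact intervalIntegral.integral_mono_on hy.1.le
      ((intervalIntegrable_tail iD hx.1 hy.2.le hy.1.le).const_mul _)
      ((c.mono (hsub y hy)).intervalIntegrable_of_Icc hy.1.le)
      fun t ht => G_der_ge t (hsub y hy ht)
  set T := ∫ t in x..0, D t with hT
  have T0 : 0 ≤ T := intervalIntegral.integral_nonneg hx.2.le fun t _ => gradSq_nonneg v f t
  -- along a sequence of circles the boundary term `G` tends to zero
  have key : 9 / 10 * T ≤ -G x := by
    refine le_of_forall_pos_le_add fun η hη => ?_
    have hη' : 0 < η ^ 2 / 4 / (T + 1) := by positivity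
    have ev := (tendsto_tail h.neg iD).eventually (ge_mem_nhds (by positivity : 0 < η / 2))
    obtain ⟨y, hy1, hy2, hy⟩ := ((frequently_abs_mul_le h.neg iD hη').and_eventually
      (ev.and (Ioo_mem_nhdsLT hx.2))).exists
    have hyL : y ∈ Ioo L 0 := ⟨hx.1.trans hy.1, hy.2⟩
    have split := intervalIntegral.integral_add_adjacent_intervals
      (intervalIntegrable_tail iD hx.1 hy.2.le hy.1.le)
      (intervalIntegrable_tail iD hyL.1 le_rfl hy.2.le)
    have nn : 0 ≤ ∫ t in x..y, D t :=
      intervalIntegral.integral_nonneg hy.1.le fun t _ => gradSq_nonneg v f t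
    have hGy : G y ≤ η / 2 := by
      have : G y ^ 2 ≤ (η / 2) ^ 2 := by
        calc G y ^ 2 ≤ (|y| * ∫ t in y..0, D t) * D y := G_sq y hyL
          _ = (|y| * D y) * ∫ t in y..0, D t := by ring
          _ ≤ (η ^ 2 / 4 / (T + 1)) * (T + 1) :=
              mul_le_mul hy1 (by linarith) (intervalIntegral.integral_nonneg hy.2.le
                fun t _ => gradSq_nonneg v f t) hη'.le
          _ = (η / 2) ^ 2 := by field_simp; ring
      exact (abs_le_of_sq_le_sq' this (by positivity)).2
    have := G_inc y hy
    linarith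
  have h1 : (9 / 10 * T) ^ 2 ≤ |x| * T * D x := by
    calc (9 / 10 * T) ^ 2 ≤ (-G x) ^ 2 := by gcongr
      _ = G x ^ 2 := by ring
      _ ≤ _ := G_sq x hx
  rcases T0.eq_or_lt with h0 | h0
  · rw [← h0, mul_zero]
    exact mul_nonneg (abs_nonneg _) (gradSq_nonneg v f x)
  · have : T * (81 / 100 * T) ≤ T * (|x| * D x) := by nlinarith
    have := le_of_mul_le_mul_left this h0
    linarith

end EndData

/-! ### Energy decay at the boundary line -/

namespace EndData

variable {L : ℝ} {v f g : ℂ → ℂ} {k : ℝ → ℝ → ℝ}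

lemma hasDerivAt_tail {e : ℝ → ℝ} {L x : ℝ} (he : IntegrableOn e (Ioo L 0))
    (hc : ContinuousOn e (Ioo L 0)) (hx : x ∈ Ioo L 0) :
    HasDerivAt (fun y => ∫ t in y..0, e t) (-e x) x :=
  intervalIntegral.integral_hasDerivAt_left (intervalIntegrable_tail he hx.1 le_rfl hx.2.le)
    (hc.stronglyMeasurableAtFilter isOpen_Ioo x hx)
    (hc.continuousAt (isOpen_Ioo.mem_nhds hx))

/-- Integrating the hole-filling inequality gives the decay `∫ₓ⁰ ∫ |∇k|² = O(|x|^{3/4})`. -/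
lemma exists_energy_decay (h : EndData L v f g) (hk : IsPotential L v f k)
    (hv : ∀ x ∈ Ioo L 0, ∀ θ, ‖v (pt x θ)‖ ≤ 2)
    (hv' : ∀ x ∈ Ioo L 0, ∀ θ, 1 / 2 ≤ ‖v (pt x θ)‖ ^ 2)
    (hk' : ∀ x ∈ Ioo L 0, ∀ θ, |k x θ| ≤ 1 / 20) :
    ∃ C, 0 ≤ C ∧ ∀ x ∈ Ioo (L / 2) 0,
      ∫ t in x..0, gradSq v f t ≤ C * (-x) ^ (3 / 4 : ℝ) := by
  have iD := h.integrableOn_gradSq hv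
  set T : ℝ → ℝ := fun x => ∫ t in x..0, gradSq v f t with hT
  have hL := h.neg
  have hder : ∀ x ∈ Ioo L 0, HasDerivAt (fun y => T y * (-y) ^ (-(3 / 4) : ℝ))
      (-gradSq v f x * (-x) ^ (-(3 / 4) : ℝ) +
        T x * (-1 * (-(3 / 4)) * (-x) ^ (-(3 / 4) - 1 : ℝ))) x := fun x hx =>
    (hasDerivAt_tail iD h.continuousOn_gradSq hx).mul
      ((hasDerivAt_id x).neg.rpow_const (p := -(3 / 4)) (Or.inl (by simpa using hx.2.ne)))
  have hanti : AntitoneOn (fun y => T y * (-y) ^ (-(3 / 4) : ℝ)) (Ioo L 0) := by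
    refine antitoneOn_of_deriv_nonpos (convex_Ioo _ _)
      (fun x hx => (hder x hx).continuousAt.continuousWithinAt)
      (fun x hx => ?_) fun x hx => ?_
    · rw [interior_Ioo] at hx
      exact (hder x hx).differentiableAt.differentiableWithinAt
    · rw [interior_Ioo] at hx
      rw [(hder x hx).deriv]
      have h1 := h.hole_filling hk hv hv' hk' hx
      have hx0 : 0 < -x := by linarith [hx.2]
      have e : (-x) ^ (-(3 / 4) : ℝ) = (-x) ^ (-(3 / 4) - 1 : ℝ) * (-x) := by
        rw [← Real.rpow_add_one hx0.ne']; norm_num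
      rw [abs_of_neg hx.2] at h1
      have h2 : 0 < (-x) ^ (-(3 / 4) - 1 : ℝ) := by positivity
      rw [e]
      have : (3 / 4 * T x - -x * gradSq v f x) * (-x) ^ (-(3 / 4) - 1 : ℝ) ≤ 0 :=
        mul_nonpos_of_nonpos_of_nonneg (by linarith) h2.le
      linarith
  have hT0 : ∀ x < 0, 0 ≤ T x := fun x hx =>
    intervalIntegral.integral_nonneg hx.le fun t _ => gradSq_nonneg v f t
  refine ⟨T (L / 2) * (-(L / 2)) ^ (-(3 / 4) : ℝ), ?_, fun x hx => ?_⟩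
  · exact mul_nonneg (hT0 _ (by linarith)) (Real.rpow_nonneg (by linarith) _)
  · have hx0 : 0 < -x := by linarith [hx.2]
    have h1 := hanti ⟨by linarith, by linarith⟩ ⟨by linarith [hx.1], hx.2⟩ hx.1.le
    simp only at h1
    rw [Real.rpow_neg hx0.le, ← div_eq_mul_inv, div_le_iff₀ (by positivity)] at h1
    exact h1

end EndData

/-- The situation after shrinking the strip: `v` is close to the unit circle, and the gradient of
the potential has Hölder-type energy decay. -/
structure RegularEnd (L : ℝ) (v f g : ℂ → ℂ) (k : ℝ → ℝ → ℝ) (C : ℝ) : Prop where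
  data : EndData L v f g
  potential : IsPotential L v f k
  ge : -1 ≤ L
  norm_le : ∀ x ∈ Ioo L 0, ∀ θ, ‖v (pt x θ)‖ ≤ 2
  le_norm_sq : ∀ x ∈ Ioo L 0, ∀ θ, 1 / 2 ≤ ‖v (pt x θ)‖ ^ 2
  nonneg : 0 ≤ C
  decay : ∀ x ∈ Ioo L 0, ∫ t in x..0, EndData.gradSq v f t ≤ C * (-x) ^ (3 / 4 : ℝ)

/-- Shrinking the strip gives `|v|` close to one, a potential below the hole-filling threshold, and
hence the energy decay. -/
lemma EndData.exists_regularEnd {L : ℝ} {v f g : ℂ → ℂ} (h : EndData L v f g) :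
    ∃ L' k C, RegularEnd L' v f g k C := by
  obtain ⟨a, ha, ha'⟩ := (mem_nhdsLT_iff_exists_Ioo_subset (a := (0 : ℝ))).1
    (inter_mem (h.eventually_norm_v (by norm_num : (0 : ℝ) < 1 / 10)) (Ioo_mem_nhdsLT h.neg))
  simp only [mem_Iio] at ha
  set b := max a (max L (-1)) with hb
  have hb0 : b < 0 := max_lt ha (max_lt h.neg (by norm_num))
  have haL := h.neg
  have h1 := h.mono (le_max_left L (-1) |>.trans (le_max_right a _)) hb0
  have hn : ∀ x ∈ Ioo b 0, ∀ θ, |‖v (pt x θ)‖ - 1| ≤ 1 / 10 := fun x hx =>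
    (ha' ⟨(le_max_left _ _).trans_lt hx.1, hx.2⟩).1
  have hn2 : ∀ x ∈ Ioo b 0, ∀ θ, ‖v (pt x θ)‖ ≤ 2 := fun x hx θ => by
    have := abs_le.1 (hn x hx θ); linarith
  have hn3 : ∀ x ∈ Ioo b 0, ∀ θ, 1 / 2 ≤ ‖v (pt x θ)‖ ^ 2 := fun x hx θ => by
    have := abs_le.1 (hn x hx θ); nlinarith
  obtain ⟨k, hk⟩ := h1.exists_potential hn2
  obtain ⟨c, hc, hc'⟩ := (mem_nhdsLT_iff_exists_Ioo_subset (a := (0 : ℝ))).1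
    (h1.eventually_potential hk hn2 (by norm_num : (0 : ℝ) < 1 / 20))
  simp only [mem_Iio] at hc
  set d := max c b with hd
  have hd0 : d < 0 := max_lt hc hb0
  have hbd : b ≤ d := le_max_right _ _
  have hsub : ∀ {x}, x ∈ Ioo d 0 → x ∈ Ioo b 0 := fun hx => ⟨hbd.trans_lt hx.1, hx.2⟩
  obtain ⟨C, hC0, hC⟩ := (h1.mono hbd hd0).exists_energy_decay (hk.mono hbd)
    (fun x hx => hn2 x (hsub hx)) (fun x hx => hn3 x (hsub hx))
    (fun x hx => hc' ⟨(le_max_left _ _).trans_lt hx.1, hx.2⟩)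
  have hde : d ≤ d / 2 := by linarith
  have hsub2 : ∀ {x}, x ∈ Ioo (d / 2) 0 → x ∈ Ioo b 0 := fun hx => hsub ⟨hde.trans_lt hx.1, hx.2⟩
  refine ⟨d / 2, k, C, h1.mono (hbd.trans hde) (by linarith), hk.mono (hbd.trans hde), ?_,
    fun x hx => hn2 x (hsub2 hx), fun x hx => hn3 x (hsub2 hx), hC0, hC⟩
  have : -1 ≤ b := (le_max_right L (-1)).trans (le_max_right a _)
  linarith

/-! ### The boundary relation between `f` and `v² · conj f` -/

namespace RegularEnd

variable {L C : ℝ} {v f g : ℂ → ℂ} {k : ℝ → ℝ → ℝ}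

/-- The trace condition `|v| = 1` in product with `f`, on a circle where `|x| ∫ |∇v|²` is not large.
-/
lemma norm_fc_one_sub_le (h : RegularEnd L v f g k C) {x : ℝ} (hx : x ∈ Ioo L 0) (n : ℤ) {δ : ℝ}
    (hδ : 0 ≤ δ)
    (h1 : |x| * ∫ θ in (0 : ℝ)..(2 * Real.pi), (‖f (pt x θ)‖ ^ 2 + ‖g (pt x θ)‖ ^ 2) ≤ 1)
    (h2 : ∫ t in x..0,
      ∫ θ in (0 : ℝ)..(2 * Real.pi), (‖f (pt t θ)‖ ^ 2 + ‖g (pt t θ)‖ ^ 2) ≤ δ ^ 2) :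
    ‖fc (fun θ => (1 - ‖v (pt x θ)‖ ^ 2 : ℝ) * f (pt x θ)) n‖ ≤ 6 * δ := by
  have hpi := Real.two_pi_pos
  have cv := h.data.continuous_v hx
  have cf := h.data.continuous_f hx
  have cg := h.data.continuous_g hx
  have c1 : Continuous fun θ => ‖v (pt x θ)‖ - 1 := cv.norm.sub continuous_const
  have c2 : Continuous fun θ => |‖v (pt x θ)‖ - 1| * ‖f (pt x θ)‖ := c1.abs.mul cf.norm
  have c3 : Continuous fun θ => ‖f (pt x θ)‖ ^ 2 + ‖g (pt x θ)‖ ^ 2 :=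
    (cf.norm.pow 2).add (cg.norm.pow 2)
  have c4 : Continuous fun θ => (1 - ‖v (pt x θ)‖ ^ 2 : ℝ) * f (pt x θ) :=
    (continuous_ofReal.comp (continuous_const.sub (cv.norm.pow 2))).mul cf
  have e0 : ∫ θ in (0 : ℝ)..(2 * Real.pi), |‖v (pt x θ)‖ - 1| * ‖f (pt x θ)‖ ≤ 2 * δ := by
    refine (abs_le_of_sq_le_sq' ?_ (by positivity)).2
    refine (sq_integral_mul_le hpi.le c1.abs.continuousOn cf.norm.continuousOn).trans ?_
    simp only [sq_abs]
    have e1 := h.data.integral_norm_sub_one_sq_le hx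
    have e2 : ∫ θ in (0 : ℝ)..(2 * Real.pi), ‖f (pt x θ)‖ ^ 2 ≤
        ∫ θ in (0 : ℝ)..(2 * Real.pi), (‖f (pt x θ)‖ ^ 2 + ‖g (pt x θ)‖ ^ 2) := by
      refine intervalIntegral.integral_mono_on hpi.le ((cf.norm.pow 2).intervalIntegrable _ _)
        (c3.intervalIntegrable _ _) fun θ _ => ?_
      have := sq_nonneg ‖g (pt x θ)‖
      linarith
    have e3 : 0 ≤ ∫ θ in (0 : ℝ)..(2 * Real.pi), ‖f (pt x θ)‖ ^ 2 :=
      intervalIntegral.integral_nonneg hpi.le fun _ _ => sq_nonneg _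
    set τ := ∫ t in x..0,
      ∫ θ in (0 : ℝ)..(2 * Real.pi), (‖f (pt t θ)‖ ^ 2 + ‖g (pt t θ)‖ ^ 2)
    set e := ∫ θ in (0 : ℝ)..(2 * Real.pi), (‖f (pt x θ)‖ ^ 2 + ‖g (pt x θ)‖ ^ 2)
    have hτ : 0 ≤ τ := intervalIntegral.integral_nonneg hx.2.le fun t _ =>
      intervalIntegral.integral_nonneg hpi.le fun _ _ => by positivity
    calc _ ≤ (4 * |x| * τ) * e := mul_le_mul e1 e2 e3 (by positivity)
      _ = 4 * (|x| * e) * τ := by ring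
      _ ≤ 4 * 1 * δ ^ 2 := by gcongr
      _ = _ := by ring
  refine (norm_fc_le_integral n).trans ?_
  have e4 : ∫ θ in (0 : ℝ)..(2 * Real.pi), ‖((1 - ‖v (pt x θ)‖ ^ 2 : ℝ) : ℂ) * f (pt x θ)‖ ≤
      ∫ θ in (0 : ℝ)..(2 * Real.pi), 3 * (|‖v (pt x θ)‖ - 1| * ‖f (pt x θ)‖) := by
    refine intervalIntegral.integral_mono_on hpi.le (c4.norm.intervalIntegrable _ _)
      ((continuous_const.mul c2).intervalIntegrable _ _) fun θ _ => ?_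
    rw [norm_mul, norm_real, Real.norm_eq_abs, ← mul_assoc]
    gcongr
    rw [show 1 - ‖v (pt x θ)‖ ^ 2 = -((‖v (pt x θ)‖ - 1) * (1 + ‖v (pt x θ)‖)) by ring, abs_neg,
      abs_mul, mul_comm, abs_of_nonneg (by positivity : 0 ≤ 1 + ‖v (pt x θ)‖)]
    gcongr
    linarith [h.norm_le x hx θ]
  rw [intervalIntegral.integral_const_mul] at e4
  have e5 : (2 * Real.pi)⁻¹ ≤ 1 := inv_le_one_of_one_le₀ (by linarith [Real.pi_gt_three])
  calc _ ≤ 1 * (3 * (2 * δ)) := by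
        refine mul_le_mul e5 (e4.trans (by linarith)) ?_ zero_le_one
        exact intervalIntegral.integral_nonneg hpi.le fun _ _ => norm_nonneg _
    _ = _ := by ring

/-- The product of `v` with `∂_θ k = 2 Im (conj v · f)`, on a circle where `|x| ∫ |∇v|²` is not
large; the derivative is moved away from the small potential `k` by integration by parts. -/
lemma norm_fc_mul_deriv_le (h : RegularEnd L v f g k C) {x : ℝ} (hx : x ∈ Ioo L 0) (n : ℤ) {δ : ℝ}
    (hδ : 0 ≤ δ)
    (h1 : |x| * ∫ θ in (0 : ℝ)..(2 * Real.pi), (‖f (pt x θ)‖ ^ 2 + ‖g (pt x θ)‖ ^ 2) ≤ 1)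
    (h2 : ∫ t in x..0, EndData.gradSq v f t ≤ δ ^ 2) :
    ‖fc (fun θ => v (pt x θ) * (2 * (conj (v (pt x θ)) * f (pt x θ)).im : ℝ)) n‖ ≤
      6 * (1 + |(n : ℝ)|) * δ := by
  have hpi := Real.two_pi_pos
  have cv := h.data.continuous_v hx
  have cf := h.data.continuous_f hx
  have cg := h.data.continuous_g hx
  have ck := h.potential.continuous hx
  set w' : ℝ → ℂ := fun θ => (-n : ℤ) * I * ex (-n) θ * v (pt x θ) +
      ex (-n) θ * (I * (f (pt x θ) - conj (g (pt x θ)))) with hw'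
  have cex := continuous_ex (-n)
  have cw' : Continuous w' := ((continuous_const.mul cex).mul cv).add
    (cex.mul (continuous_const.mul (cf.sub (continuous_conj.comp cg))))
  have hw : ∀ θ, HasDerivAt (fun θ => ex (-n) θ * v (pt x θ)) (w' θ) θ := fun θ =>
    (hasDerivAt_ex (-n) θ).mul (h.data.hvt x hx θ)
  have p1 := ex_periodic (-n) 0
  have p2 := periodic_slice h.data.pv x 0
  have p3 := h.potential.periodic x hx 0
  simp only [zero_add] at p1 p2 p3
  have parts := integral_mul_deriv_periodic hw
    (fun θ => (h.potential.ht x hx θ).ofReal_comp) cw'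
    (continuous_ofReal.comp (h.data.continuous_P hx)) (by rw [p1, p2]) (by rw [p3])
  set N : ℝ := 1 + |(n : ℝ)| with hN
  have hN1 : 1 ≤ N := by have := abs_nonneg (n : ℝ); linarith
  have hw'le : ∀ θ, ‖w' θ‖ ≤ 2 * N + (‖f (pt x θ)‖ + ‖g (pt x θ)‖) := fun θ => by
    refine (norm_add_le _ _).trans ?_
    simp only [norm_mul, norm_I, norm_ex, one_mul, mul_one, Int.cast_neg, norm_neg,
      norm_intCast]
    have a1 := norm_sub_le (f (pt x θ)) (conj (g (pt x θ)))
    rw [RCLike.norm_conj] at a1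
    have a2 := h.norm_le x hx θ
    have a3 := abs_nonneg (n : ℝ)
    have a4 : |(n : ℝ)| * ‖v (pt x θ)‖ ≤ |(n : ℝ)| * 2 := by gcongr
    linarith
  have cm : Continuous fun θ => 2 * N + (‖f (pt x θ)‖ + ‖g (pt x θ)‖) :=
    continuous_const.add (cf.norm.add cg.norm)
  have c3 : Continuous fun θ => ‖f (pt x θ)‖ ^ 2 + ‖g (pt x θ)‖ ^ 2 :=
    (cf.norm.pow 2).add (cg.norm.pow 2)
  have e0 : ∫ θ in (0 : ℝ)..(2 * Real.pi),
      (2 * N + (‖f (pt x θ)‖ + ‖g (pt x θ)‖)) * |k x θ| ≤ 12 * N * δ := by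
    refine (abs_le_of_sq_le_sq' ?_ (by positivity)).2
    refine (sq_integral_mul_le hpi.le cm.continuousOn ck.abs.continuousOn).trans ?_
    simp only [sq_abs]
    have e1 := (h.data.integral_potential_sq_le h.potential h.norm_le hx)
    set e := ∫ θ in (0 : ℝ)..(2 * Real.pi), (‖f (pt x θ)‖ ^ 2 + ‖g (pt x θ)‖ ^ 2) with he
    have e2 : ∫ θ in (0 : ℝ)..(2 * Real.pi), (2 * N + (‖f (pt x θ)‖ + ‖g (pt x θ)‖)) ^ 2 ≤
        3 * (4 * N ^ 2 * (2 * Real.pi) + e) := by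
      have : 3 * (4 * N ^ 2 * (2 * Real.pi) + e) = ∫ θ in (0 : ℝ)..(2 * Real.pi),
          3 * (4 * N ^ 2 + (‖f (pt x θ)‖ ^ 2 + ‖g (pt x θ)‖ ^ 2)) := by
        rw [intervalIntegral.integral_const_mul, intervalIntegral.integral_add (by simp)
          (c3.intervalIntegrable _ _)]
        simp; ring
      rw [this]
      refine intervalIntegral.integral_mono_on hpi.le ((cm.pow 2).intervalIntegrable _ _)
        ((continuous_const.mul (continuous_const.add c3)).intervalIntegrable _ _) fun θ _ => ?_
      nlinarith [sq_nonneg (2 * N - ‖f (pt x θ)‖), sq_nonneg (2 * N - ‖g (pt x θ)‖),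
        sq_nonneg (‖f (pt x θ)‖ - ‖g (pt x θ)‖)]
    have hT : 0 ≤ ∫ t in x..0, EndData.gradSq v f t :=
      intervalIntegral.integral_nonneg hx.2.le fun t _ => EndData.gradSq_nonneg v f t
    have he0 : 0 ≤ e := intervalIntegral.integral_nonneg hpi.le fun _ _ => by positivity
    have hx1 : |x| ≤ 1 := by rw [abs_of_neg hx.2]; linarith [hx.1, h.ge]
    calc _ ≤ (3 * (4 * N ^ 2 * (2 * Real.pi) + e)) * (|x| * ∫ t in x..0, EndData.gradSq v f t) :=
          mul_le_mul e2 e1 (intervalIntegral.integral_nonneg hpi.le fun _ _ => sq_nonneg _)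
            (by positivity)
      _ = 3 * (4 * N ^ 2 * (2 * Real.pi) * |x| + |x| * e) * ∫ t in x..0, EndData.gradSq v f t := by
          ring
      _ ≤ 3 * (4 * N ^ 2 * (2 * 4) * 1 + 1) * δ ^ 2 := by
          gcongr
          exact Real.pi_le_four
      _ ≤ 3 * (4 * N ^ 2 * (2 * 4) * 1 + N ^ 2) * δ ^ 2 := by
          gcongr; nlinarith
      _ ≤ _ := by nlinarith [sq_nonneg (N * δ)]
  have e6 : (2 * Real.pi)⁻¹ ≤ 1 / 2 := by
    rw [inv_le_comm₀ hpi (by norm_num)]; linarith [Real.pi_gt_three]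
  have e7 : fc (fun θ => v (pt x θ) * ((2 * (conj (v (pt x θ)) * f (pt x θ)).im : ℝ) : ℂ)) n =
      (2 * Real.pi : ℂ)⁻¹ * -∫ θ in (0 : ℝ)..(2 * Real.pi), w' θ * (k x θ : ℂ) := by
    rw [fc_eq, ← parts]
    simp only [mul_assoc]
  rw [e7, norm_mul, norm_neg]
  have e8 : ‖(2 * Real.pi : ℂ)⁻¹‖ = (2 * Real.pi)⁻¹ := by
    rw [norm_inv, norm_mul, Complex.norm_real, Real.norm_of_nonneg Real.pi_pos.le]; simp
  rw [e8]
  have e9 : ‖∫ θ in (0 : ℝ)..(2 * Real.pi), w' θ * (k x θ : ℂ)‖ ≤ 12 * N * δ := by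
    refine (intervalIntegral.norm_integral_le_integral_norm hpi.le).trans (le_trans ?_ e0)
    refine intervalIntegral.integral_mono_on hpi.le
      ((cw'.mul (continuous_ofReal.comp ck)).norm.intervalIntegrable _ _)
      ((cm.mul ck.abs).intervalIntegrable _ _) fun θ _ => ?_
    rw [norm_mul, norm_real, Real.norm_eq_abs]
    gcongr
    exact hw'le θ
  calc _ ≤ 1 / 2 * (12 * N * δ) := mul_le_mul e6 e9 (norm_nonneg _) (by norm_num)
    _ = _ := by ring

/-- Along a sequence of circles approaching the boundary line, `f` and `v² · conj f` have the same
Fourier coefficients in the limit; this is the weak form of `|v| = 1`, `Im (conj v · f) = 0`. -/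
lemma frequently_norm_fc_sub_le (h : RegularEnd L v f g k C) (n : ℤ) {η : ℝ} (hη : 0 < η) :
    ∃ᶠ x in 𝓝[<] (0 : ℝ), ‖fc (fun θ => f (pt x θ)) n -
      fc (fun θ => v (pt x θ) ^ 2 * conj (f (pt x θ))) n‖ ≤ η := by
  set N : ℝ := 1 + |(n : ℝ)| with hN
  have hN1 : 1 ≤ N := by have := abs_nonneg (n : ℝ); linarith
  set δ : ℝ := η / (12 * N) with hδ
  have hδ0 : 0 < δ := by positivity
  have ev1 := (tendsto_tail h.data.neg h.data.energy).eventually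
    (ge_mem_nhds (by positivity : 0 < δ ^ 2))
  have ev2 := (tendsto_tail h.data.neg (h.data.integrableOn_gradSq h.norm_le)).eventually
    (ge_mem_nhds (by positivity : 0 < δ ^ 2))
  refine ((frequently_abs_mul_le h.data.neg h.data.energy one_pos).and_eventually
    (ev1.and (ev2.and h.data.eventually_mem))).mono ?_
  rintro x ⟨h1, h2, h3, hx⟩
  have b1 := h.norm_fc_one_sub_le hx n hδ0.le h1 h2
  have b2 := h.norm_fc_mul_deriv_le hx n hδ0.le h1 h3
  have cv := h.data.continuous_v hx
  have cf := h.data.continuous_f hx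
  have cP := h.data.continuous_P hx
  have c4 : Continuous fun θ => ((1 - ‖v (pt x θ)‖ ^ 2 : ℝ) : ℂ) * f (pt x θ) :=
    (continuous_ofReal.comp (continuous_const.sub (cv.norm.pow 2))).mul cf
  have c5 : Continuous fun θ => I * (v (pt x θ) *
      ((2 * (conj (v (pt x θ)) * f (pt x θ)).im : ℝ) : ℂ)) :=
    continuous_const.mul (cv.mul (continuous_ofReal.comp cP))
  have c6 : Continuous fun θ => v (pt x θ) ^ 2 * conj (f (pt x θ)) :=
    (cv.pow 2).mul (continuous_conj.comp cf)
  rw [← fc_sub cf c6]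
  have e : (fun θ => f (pt x θ) - v (pt x θ) ^ 2 * conj (f (pt x θ))) = fun θ =>
      ((1 - ‖v (pt x θ)‖ ^ 2 : ℝ) : ℂ) * f (pt x θ) + I * (v (pt x θ) *
      ((2 * (conj (v (pt x θ)) * f (pt x θ)).im : ℝ) : ℂ)) := by
    funext θ
    have e1 : ((‖v (pt x θ)‖ ^ 2 : ℝ) : ℂ) = conj (v (pt x θ)) * v (pt x θ) := by
      rw [conj_mul']; push_cast; rfl
    have e2 : ((2 * (conj (v (pt x θ)) * f (pt x θ)).im : ℝ) : ℂ) =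
        -I * (conj (v (pt x θ)) * f (pt x θ) - v (pt x θ) * conj (f (pt x θ))) := by
      have := Complex.sub_conj (conj (v (pt x θ)) * f (pt x θ))
      simp only [map_mul, RingHomCompTriple.comp_apply, RingHom.id_apply] at this
      rw [this]
      linear_combination ((2 * (conj (v (pt x θ)) * f (pt x θ)).im : ℝ) : ℂ) * I_sq
    rw [e2, Complex.ofReal_sub, Complex.ofReal_one, e1]
    linear_combination (v (pt x θ) * (conj (v (pt x θ)) * f (pt x θ) -
      v (pt x θ) * conj (f (pt x θ)))) * I_sq
  rw [e, fc_add c4 c5, fc_const_mul]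
  refine (norm_add_le _ _).trans ?_
  rw [norm_mul, norm_I, one_mul]
  calc _ ≤ 6 * δ + 6 * N * δ := add_le_add b1 b2
    _ ≤ 12 * N * δ := by nlinarith
    _ = η := by rw [hδ]; field_simp

/-- Bounds for the Fourier coefficients of `v² · conj f` near the boundary line pass to the
Laurent coefficients of `f`. -/
lemma norm_laurent_le (h : RegularEnd L v f g k C) (n : ℤ) {K : ℝ}
    (hK : ∀ᶠ x in 𝓝[<] (0 : ℝ), ‖fc (fun θ => v (pt x θ) ^ 2 * conj (f (pt x θ))) n‖ ≤ K) :
    ‖laurent L f n‖ ≤ K := by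
  by_contra! hlt
  set η := (‖laurent L f n‖ - K) / 2 with hη
  have hη0 : 0 < η := by rw [hη]; linarith
  have lim : Tendsto (fun x : ℝ => ‖laurent L f n‖ * Real.exp (n * x)) (𝓝[<] 0)
      (𝓝 (‖laurent L f n‖ * Real.exp (n * 0))) :=
    ((by fun_prop : Continuous fun x : ℝ => ‖laurent L f n‖ * Real.exp (n * x)).tendsto
      0).mono_left nhdsWithin_le_nhds
  rw [mul_zero, Real.exp_zero, mul_one] at lim
  have ev := lim.eventually (lt_mem_nhds (show K + η < ‖laurent L f n‖ by rw [hη]; linarith))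
  obtain ⟨x, h1, h2, h3, hx⟩ := ((h.frequently_norm_fc_sub_le n hη0).and_eventually
    (hK.and (ev.and h.data.eventually_mem))).exists
  rw [← norm_fc_slice h.data.hf h.data.pf hx] at h3
  have := norm_sub_norm_le (fc (fun θ => f (pt x θ)) n)
    (fc (fun θ => v (pt x θ) ^ 2 * conj (f (pt x θ))) n)
  linarith

end RegularEnd

/-! ### Decay of the Laurent coefficients -/

lemma rpow_three_quarters_le {s : ℝ} (hs : 0 ≤ s) : s ^ (3 / 4 : ℝ) ≤ 1 + s := by
  have := Real.rpow_le_rpow hs (by linarith : s ≤ 1 + s) (by norm_num : (0 : ℝ) ≤ 3 / 4)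
  refine this.trans ?_
  exact (Real.rpow_le_rpow_of_exponent_le (by linarith) (by norm_num)).trans_eq (Real.rpow_one _)

lemma one_add_abs_rpow_neg {n : ℤ} (hn : 0 ≤ n) (s : ℝ) : ((n : ℝ) + 1) ^ (-s) = pw s n := by
  have : (0 : ℝ) ≤ n := by exact_mod_cast hn
  rw [pw, abs_of_nonneg this, add_comm]

/-- Exponential decay beats any power, with the exponent `2` as a sample. -/
lemma exp_le_pw_two {δ : ℝ} (hδ : 0 < δ) {n : ℤ} (hn : 0 ≤ n) :
    Real.exp (-(n * δ)) ≤ 2 * Real.exp δ / δ ^ 2 * pw 2 n := by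
  have hn' : (0 : ℝ) ≤ n := by exact_mod_cast hn
  have h1 := Real.quadratic_le_exp_of_nonneg (x := (n + 1) * δ) (by positivity)
  have h2 : Real.exp (-(n * δ)) = Real.exp δ / Real.exp ((n + 1) * δ) := by
    rw [← Real.exp_sub]; ring_nf
  rw [h2, ← one_add_abs_rpow_neg hn, Real.rpow_neg (by positivity), Real.rpow_two,
    div_mul_eq_mul_div, ← div_eq_mul_inv, div_div, div_le_div_iff₀ (by positivity) (by positivity)]
  have h3 : (n + 1) ^ 2 * δ ^ 2 ≤ 2 * Real.exp ((n + 1) * δ) := by nlinarith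
  nlinarith [Real.exp_pos δ]

namespace RegularEnd

variable {L C : ℝ} {v f g : ℂ → ℂ} {k : ℝ → ℝ → ℝ}

/-- `∫ v² · conj (f e^{nζ}) dθ`, which is `2π e^{nx}` times a Fourier coefficient of `v² · conj f`.
-/
noncomputable def momentY (v f : ℂ → ℂ) (n : ℤ) (x : ℝ) : ℂ :=
  ∫ θ in (0 : ℝ)..(2 * Real.pi), v (pt x θ) ^ 2 * conj (f (pt x θ) * Complex.exp (n * pt x θ))

lemma momentY_eq (v f : ℂ → ℂ) (n : ℤ) (x : ℝ) :
    momentY v f n x = Complex.exp (n * x) * (2 * Real.pi *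
      fc (fun θ => v (pt x θ) ^ 2 * conj (f (pt x θ))) n) := by
  rw [← integral_ex_mul, momentY, ← intervalIntegral.integral_const_mul]
  congr 1
  ext θ
  have : conj (Complex.exp (n * pt x θ)) = Complex.exp (n * x) * ex (-n) θ := by
    rw [← Complex.exp_conj, ex, ← Complex.exp_add]
    congr 1
    simp [pt]; ring
  rw [map_mul, this]; ring

lemma norm_momentY (v f : ℂ → ℂ) (n : ℤ) (x : ℝ) :
    ‖momentY v f n x‖ = Real.exp (n * x) * (2 * Real.pi *
      ‖fc (fun θ => v (pt x θ) ^ 2 * conj (f (pt x θ))) n‖) := by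
  rw [momentY_eq, norm_mul, norm_mul, norm_mul, Complex.norm_exp, Complex.norm_real,
    Real.norm_of_nonneg Real.pi_pos.le]
  simp

/-- The `x`- and `θ`-derivatives of `v² · conj A` for holomorphic `A`, in terms of
`a = v`, `b = f`, `c = g`, `d = A`, `e = A'`. -/
lemma _root_.SemiStiff.moment_identity (a b c d e : ℂ) :
    2 * a * (b + conj c) * conj d + a ^ 2 * conj e =
      4 * (a * b * conj d) + I * (2 * a * (I * (b - conj c)) * conj d + a ^ 2 * conj (I * e)) := by
  rw [map_mul, conj_I]
  linear_combination (-2 * a * (b - conj c) * conj d + a ^ 2 * conj e) * I_sq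

/-- The `x`-derivative of the integrand is `4 v f · conj (f e^{nζ})` plus a multiple of a
`θ`-derivative, which integrates to zero. -/
lemma hasDerivAt_momentY (h : RegularEnd L v f g k C) (n : ℤ) {x : ℝ} (hx : x ∈ Ioo L 0) :
    HasDerivAt (momentY v f n) (∫ θ in (0 : ℝ)..(2 * Real.pi),
      4 * (v (pt x θ) * f (pt x θ) * conj (f (pt x θ) * Complex.exp (n * pt x θ)))) x := by
  set A : ℂ → ℂ := fun ζ => f ζ * Complex.exp (n * ζ) with hA
  have dA : DifferentiableOn ℂ A (strip L) := h.data.hf.mul (by fun_prop)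
  have pA : Function.Periodic A (2 * Real.pi * I) := fun ζ => by
    simp only [hA, h.data.pf ζ, mul_add, Complex.exp_add, Complex.exp_int_mul_two_pi_mul_I, mul_one]
  have cA := dA.continuousOn
  have cA' := (differentiableOn_deriv dA).continuousOn
  have cv := h.data.cv
  have cf := h.data.hf.continuousOn
  have cg := h.data.hg.continuousOn
  have cX : ContinuousOn (fun ζ => 2 * v ζ * (f ζ + conj (g ζ)) * conj (A ζ) +
      v ζ ^ 2 * conj (deriv A ζ)) (strip L) :=
    (((continuousOn_const.mul cv).mul (cf.add (continuous_conj.comp_continuousOn cg))).mul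
      (continuous_conj.comp_continuousOn cA)).add
      ((cv.pow 2).mul (continuous_conj.comp_continuousOn cA'))
  have cT : ContinuousOn (fun ζ => 2 * v ζ * (I * (f ζ - conj (g ζ))) * conj (A ζ) +
      v ζ ^ 2 * conj (I * deriv A ζ)) (strip L) :=
    (((continuousOn_const.mul cv).mul (continuousOn_const.mul
      (cf.sub (continuous_conj.comp_continuousOn cg)))).mul
      (continuous_conj.comp_continuousOn cA)).add
      ((cv.pow 2).mul (continuous_conj.comp_continuousOn (continuousOn_const.mul cA')))
  have sq : ∀ {φ : ℝ → ℂ} {φ' : ℂ} {t : ℝ}, HasDerivAt φ φ' t →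
      HasDerivAt (fun t => φ t ^ 2) (2 * φ t * φ') t := fun {φ φ' t} hφ => by
    have := hφ.mul hφ
    have e1 : (fun t => φ t ^ 2) = φ * φ := by funext t; simp [sq]
    rw [e1, show 2 * φ t * φ' = φ' * φ t + φ t * φ' by ring]
    exact this
  have h1 := hasDerivAt_integral 0 (2 * Real.pi)
    (φ := fun x θ => v (pt x θ) ^ 2 * conj (A (pt x θ)))
    (fun y hy => continuous_slice (continuousOn_slice
      ((cv.pow 2).mul (continuous_conj.comp_continuousOn cA))) hy)
    (continuousOn_slice cX)
    (fun y hy θ => (sq (h.data.hvx y hy θ)).mul (hasDerivAt_conj (hasDerivAt_slice_left dA hy θ))) hx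
  have hper : ∫ θ in (0 : ℝ)..(2 * Real.pi), (2 * v (pt x θ) * (I * (f (pt x θ) -
      conj (g (pt x θ)))) * conj (A (pt x θ)) + v (pt x θ) ^ 2 * conj (I * deriv A (pt x θ))) =
      0 := by
    rw [intervalIntegral.integral_eq_sub_of_hasDerivAt
      (f := fun θ => v (pt x θ) ^ 2 * conj (A (pt x θ)))
      (fun θ _ => (sq (h.data.hvt x hx θ)).mul
        (hasDerivAt_conj (hasDerivAt_slice_right dA hx θ)))
      ((continuous_slice (continuousOn_slice cT) hx).intervalIntegrable _ _)]
    have e1 := periodic_slice h.data.pv x 0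
    have e2 := periodic_slice pA x 0
    simp only [zero_add] at e1 e2
    rw [e1, e2, sub_self]
  have c1 : Continuous fun θ => 4 * (v (pt x θ) * f (pt x θ) * conj (A (pt x θ))) :=
    continuous_slice (continuousOn_slice (continuousOn_const.mul
      ((cv.mul cf).mul (continuous_conj.comp_continuousOn cA)))) hx
  have c2 : Continuous fun θ => I * (2 * v (pt x θ) * (I * (f (pt x θ) -
      conj (g (pt x θ)))) * conj (A (pt x θ)) + v (pt x θ) ^ 2 * conj (I * deriv A (pt x θ))) :=
    continuous_const.mul (continuous_slice (continuousOn_slice cT) hx)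
  simp only [moment_identity] at h1
  rw [intervalIntegral.integral_add (c1.intervalIntegrable _ _) (c2.intervalIntegrable _ _),
    intervalIntegral.integral_const_mul I, hper, mul_zero, add_zero] at h1
  exact h1

lemma norm_deriv_momentY_le (h : RegularEnd L v f g k C) (n : ℤ) {x : ℝ} (hx : x ∈ Ioo L 0) :
    ‖∫ θ in (0 : ℝ)..(2 * Real.pi),
      4 * (v (pt x θ) * f (pt x θ) * conj (f (pt x θ) * Complex.exp (n * pt x θ)))‖ ≤
      4 * (EndData.gradSq v f x * Real.exp (n * x)) := by
  have hpi := Real.two_pi_pos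
  rw [EndData.gradSq, ← intervalIntegral.integral_mul_const, ← intervalIntegral.integral_const_mul]
  refine intervalIntegral.norm_integral_le_of_norm_le hpi.le (ae_of_all _ fun θ _ => ?_)
    ((continuous_const.mul ((h.data.continuous_gradSq_slice hx).mul
      continuous_const)).intervalIntegrable _ _)
  simp only [norm_mul, RCLike.norm_conj, Complex.norm_exp, Complex.norm_ofNat]
  have e1 : ((n : ℂ) * pt x θ).re = n * x := by simp [pt]
  rw [e1]
  have h1 := h.norm_le x hx θ
  have h2 := h.le_norm_sq x hx θ
  have h3 : ‖v (pt x θ)‖ ≤ 4 * ‖v (pt x θ)‖ ^ 2 := by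
    have := norm_nonneg (v (pt x θ)); nlinarith
  have h4 : 0 ≤ ‖f (pt x θ)‖ ^ 2 * Real.exp (n * x) := by positivity
  nlinarith

/-- Energy decay makes the moments, hence the Laurent coefficients of `f`, decay like
`n^{-3/4}`. -/
lemma exists_norm_momentY_le (h : RegularEnd L v f g k C) :
    ∃ K, 0 ≤ K ∧ ∀ n : ℤ, 0 ≤ n → ∀ y ∈ Ioo (L / 2) 0, ‖momentY v f n y‖ ≤ K * pw (3 / 4) n := by
  have hL := h.data.neg
  have hpi := Real.two_pi_pos
  set x₁ := L / 2 with hx₁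
  have hx1 : x₁ ∈ Ioo L 0 := ⟨by linarith, by linarith⟩
  set T : ℝ → ℝ := fun x => ∫ t in x..0, EndData.gradSq v f t with hT
  have iD := h.data.integrableOn_gradSq h.norm_le
  have hT0 : ∀ x < 0, 0 ≤ T x := fun x hx =>
    intervalIntegral.integral_nonneg hx.le fun t _ => EndData.gradSq_nonneg v f t
  set M₀ : ℝ := ∫ θ in (0 : ℝ)..(2 * Real.pi), ‖v (pt x₁ θ)‖ ^ 2 * ‖f (pt x₁ θ)‖ with hM₀
  have hM0 : 0 ≤ M₀ := intervalIntegral.integral_nonneg hpi.le fun _ _ => by positivity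
  have hT1 := hT0 x₁ hx1.2
  have hC := h.nonneg
  have hx1' : 0 < -x₁ := by linarith [hx1.2]
  refine ⟨24 * C + (M₀ + 4 * T x₁) * (3 / (-x₁)), by positivity, fun n hn y hy => ?_⟩
  have hn' : (0 : ℝ) ≤ n := by exact_mod_cast hn
  set m : ℝ := n + 1 with hm
  have hm1 : 1 ≤ m := by linarith
  have hpw : m ^ (-(3 / 4) : ℝ) = pw (3 / 4) n := one_add_abs_rpow_neg hn _
  have hp0 := pw_pos (3 / 4) n
  have hexp3 : ∀ t, -1 ≤ t → Real.exp (n * t) ≤ 3 * Real.exp (m * t) := fun t ht => by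
    have : Real.exp (n * t) = Real.exp (-t) * Real.exp (m * t) := by
      rw [← Real.exp_add]; congr 1; rw [hm]; ring
    rw [this]
    gcongr
    exact (Real.exp_le_exp.2 (by linarith)).trans (Real.exp_one_lt_d9.le.trans (by norm_num))
  -- `Φ` is a primitive of a majorant of `-T' e^{nt}`: the term `T n e^{nt}` left by partial
  -- integration is at most `C |t|^{3/4} n e^{nt}`, and `s^{3/4} ≤ 1 + s` with `s = m |t|` makes
  -- this elementary.
  set Φ : ℝ → ℝ := fun t => -T t * Real.exp (n * t) +
    3 * C * pw (3 / 4) n * ((2 - m * t) * Real.exp (m * t)) with hΦ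
  set Φ' : ℝ → ℝ := fun t => EndData.gradSq v f t * Real.exp (n * t) -
    T t * (Real.exp (n * t) * n) + 3 * C * pw (3 / 4) n * (m * (1 - m * t) * Real.exp (m * t))
    with hΦ'
  have hΦd : ∀ t ∈ Ioo L 0, HasDerivAt Φ (Φ' t) t := fun t ht => by
    have e1 := EndData.hasDerivAt_tail iD h.data.continuousOn_gradSq ht
    have lin : ∀ c : ℝ, HasDerivAt (fun t : ℝ => c * t) c t := fun c => by
      have := (hasDerivAt_id t).const_mul c
      rw [mul_one] at this
      exact this
    have e2 := (e1.neg.mul (lin n).exp).add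
      ((((lin m).const_sub 2).mul (lin m).exp).const_mul (3 * C * pw (3 / 4) n))
    have e3 : Φ' t = -(-EndData.gradSq v f t) * Real.exp (n * t) +
        -T t * (Real.exp (n * t) * n) + 3 * C * pw (3 / 4) n * (-m * Real.exp (m * t) +
        (2 - m * t) * (Real.exp (m * t) * m)) := by
      rw [hΦ']; ring
    rw [e3]; exact e2
  have hΦge : ∀ t ∈ Ioo L 0, EndData.gradSq v f t * Real.exp (n * t) ≤ Φ' t := fun t ht => by
    have ht0 : 0 < -t := by linarith [ht.2]
    have a1 : T t ≤ C * (pw (3 / 4) n * (1 - m * t)) := by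
      refine (h.decay t ht).trans ?_
      gcongr
      have : (-t) ^ (3 / 4 : ℝ) = m ^ (-(3 / 4) : ℝ) * (m * -t) ^ (3 / 4 : ℝ) := by
        rw [Real.mul_rpow (by positivity) ht0.le, ← mul_assoc, ← Real.rpow_add (by positivity)]
        norm_num
      rw [this, hpw]
      gcongr
      refine (rpow_three_quarters_le (by positivity)).trans (by linarith)
    have a2 := hexp3 t (by linarith [ht.1, h.ge])
    have a3 : 0 ≤ 1 - m * t := by nlinarith
    have a4 : T t * (Real.exp (n * t) * n) ≤
        C * (pw (3 / 4) n * (1 - m * t)) * (3 * Real.exp (m * t) * m) := by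
      refine mul_le_mul a1 ?_ (by positivity) (by positivity)
      exact mul_le_mul a2 (by linarith) hn' (by positivity)
    have : C * (pw (3 / 4) n * (1 - m * t)) * (3 * Real.exp (m * t) * m) =
      3 * C * pw (3 / 4) n * (m * (1 - m * t) * Real.exp (m * t)) := by ring
    rw [hΦ']
    linarith
  have hsub : ∀ t ∈ Icc x₁ y, t ∈ Ioo L 0 := fun t ht =>
    ⟨hx1.1.trans_le ht.1, ht.2.trans_lt hy.2⟩
  have hB := image_norm_le_of_norm_deriv_right_le_deriv_boundary'
    (f := momentY v f n) (a := x₁) (b := y)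
    (B := fun t => ‖momentY v f n x₁‖ + 4 * (Φ t - Φ x₁)) (B' := fun t => 4 * Φ' t)
    (fun t ht => (h.hasDerivAt_momentY n (hsub t ht)).continuousAt.continuousWithinAt)
    (fun t ht => (h.hasDerivAt_momentY n (hsub t ⟨ht.1, ht.2.le⟩)).hasDerivWithinAt)
    (by simp)
    (fun t ht => ((((hΦd t (hsub t ht)).sub_const _).const_mul 4).const_add
      _).continuousAt.continuousWithinAt)
    (fun t ht => ((((hΦd t (hsub t ⟨ht.1, ht.2.le⟩)).sub_const _).const_mul 4).const_add
      _).hasDerivWithinAt)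
    (fun t ht => (h.norm_deriv_momentY_le n (hsub t ⟨ht.1, ht.2.le⟩)).trans
      (by have := hΦge t (hsub t ⟨ht.1, ht.2.le⟩); linarith)) ⟨hy.1.le, le_rfl⟩
  have b1 : ‖momentY v f n x₁‖ ≤ M₀ * Real.exp (n * x₁) := by
    rw [hM₀, ← intervalIntegral.integral_mul_const]
    have cv := h.data.continuous_v hx1
    have cf := h.data.continuous_f hx1
    refine intervalIntegral.norm_integral_le_of_norm_le hpi.le (ae_of_all _ fun θ _ => ?_)
      ((((cv.norm.pow 2).mul cf.norm).mul continuous_const).intervalIntegrable _ _)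
    simp [Complex.norm_exp, pt, mul_assoc]
  have b2 : Φ y ≤ 6 * C * pw (3 / 4) n := by
    have hy0 : 0 ≤ T y * Real.exp (n * y) := mul_nonneg (hT0 y hy.2) (Real.exp_nonneg _)
    have : (2 - m * y) * Real.exp (m * y) ≤ 2 := by
      have e1 := Real.add_one_le_exp (-(m * y))
      rw [Real.exp_neg] at e1
      have e2 := Real.exp_pos (m * y)
      have e3 : (-(m * y) + 1) * Real.exp (m * y) ≤ 1 := by
        rwa [← le_div_iff₀ e2, one_div]
      have e4 : Real.exp (m * y) ≤ 1 := Real.exp_le_one_iff.2 (by nlinarith [hy.2])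
      linarith
    have : 3 * C * pw (3 / 4) n * ((2 - m * y) * Real.exp (m * y)) ≤ 3 * C * pw (3 / 4) n * 2 := by
      gcongr
    rw [hΦ]
    linarith
  have b3 : -Φ x₁ ≤ T x₁ * Real.exp (n * x₁) := by
    have : 0 ≤ 3 * C * pw (3 / 4) n * ((2 - m * x₁) * Real.exp (m * x₁)) := by
      have : 0 ≤ 2 - m * x₁ := by nlinarith
      positivity
    rw [hΦ]
    linarith
  have b4 : Real.exp (n * x₁) ≤ 3 / (-x₁) * pw (3 / 4) n := by
    refine (hexp3 x₁ (by linarith [hx1.1, h.ge])).trans ?_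
    have e1 := Real.add_one_le_exp (m * (-x₁))
    have e2 : m ^ (-1 : ℝ) ≤ pw (3 / 4) n := by
      rw [← hpw]; exact Real.rpow_le_rpow_of_exponent_le hm1 (by norm_num)
    rw [Real.rpow_neg_one] at e2
    have e3 : Real.exp (m * x₁) ≤ (-x₁)⁻¹ * m⁻¹ := by
      rw [← mul_inv, show m * x₁ = -(m * (-x₁)) by ring, Real.exp_neg]
      gcongr
      linarith
    calc 3 * Real.exp (m * x₁) ≤ 3 * ((-x₁)⁻¹ * m⁻¹) := by gcongr
      _ ≤ 3 * ((-x₁)⁻¹ * pw (3 / 4) n) := by gcongr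
      _ = _ := by ring
  calc ‖momentY v f n y‖ ≤ ‖momentY v f n x₁‖ + 4 * (Φ y - Φ x₁) := hB
    _ ≤ (M₀ + 4 * T x₁) * Real.exp (n * x₁) + 24 * C * pw (3 / 4) n := by linarith
    _ ≤ (M₀ + 4 * T x₁) * (3 / (-x₁) * pw (3 / 4) n) + 24 * C * pw (3 / 4) n := by gcongr
    _ = _ := by ring

lemma exists_norm_laurent_le (h : RegularEnd L v f g k C) :
    ∃ A, 0 ≤ A ∧ ∀ n : ℤ, 0 ≤ n → ‖laurent L f n‖ ≤ A * pw (3 / 4) n := by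
  obtain ⟨K, hK0, hK⟩ := h.exists_norm_momentY_le
  refine ⟨K, hK0, fun n hn => h.norm_laurent_le n ?_⟩
  have lim : Tendsto (fun x : ℝ => Real.exp (n * x)) (𝓝[<] 0) (𝓝 (Real.exp (n * 0))) :=
    ((by fun_prop : Continuous fun x : ℝ => Real.exp (n * x)).tendsto 0).mono_left
      nhdsWithin_le_nhds
  rw [mul_zero, Real.exp_zero] at lim
  have hL := h.data.neg
  filter_upwards [lim.eventually (lt_mem_nhds (by norm_num : (1 / 2 : ℝ) < 1)),
    Ioo_mem_nhdsLT (by linarith : L / 2 < 0)] with x h1 hx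
  have h2 := hK n hn x hx
  rw [norm_momentY] at h2
  set F := ‖fc (fun θ => v (pt x θ) ^ 2 * conj (f (pt x θ))) n‖
  have hF : 0 ≤ F := norm_nonneg _
  have : 1 / 2 * (2 * 3 * F) ≤ Real.exp (n * x) * (2 * Real.pi * F) := by
    gcongr
    exact Real.pi_gt_three.le
  linarith

end RegularEnd

/-! ### Boundary regularity -/

lemma summable_of_le_pw {φ : ℤ → ℂ} {A s : ℝ} (hs : 1 < s) (h : ∀ n, ‖φ n‖ ≤ A * pw s n) :
    Summable fun n => ‖φ n‖ :=
  Summable.of_nonneg_of_le (fun _ => norm_nonneg _) h ((summable_pw hs).mul_left A)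

namespace EndData

variable {L : ℝ} {v f g : ℂ → ℂ}

/-- Towards `-∞` the Fourier coefficients decay exponentially, in particular like `|n|^{-7/4}`. -/
lemma exists_fc_neg_le (h : EndData L v f g) :
    ∃ A, 0 ≤ A ∧ ∀ᶠ x in 𝓝[<] (0 : ℝ), ∀ n : ℤ, n < 0 →
      ‖fc (fun θ => f (pt x θ)) n‖ ≤ A * pw (7 / 4) n := by
  have hL := h.neg
  obtain ⟨M, hM0, hM⟩ := laurent_neg_bound h.hf h.pf hL
  have hδ : 0 < -(L / 4) := by linarith
  refine ⟨M * (2 * Real.exp (-(L / 4)) / (-(L / 4)) ^ 2), by positivity, ?_⟩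
  filter_upwards [Ioo_mem_nhdsLT (by linarith : L / 2 < 0)] with x hx n hn
  obtain ⟨m, rfl⟩ : ∃ m : ℕ, n = -m := ⟨n.natAbs, by omega⟩
  rw [norm_fc_slice h.hf h.pf ⟨by linarith [hx.1], hx.2⟩]
  calc _ ≤ ‖laurent L f (-m)‖ * Real.exp (-m * (L / 2)) := by
        refine mul_le_mul_of_nonneg_left (Real.exp_le_exp.2 ?_) (norm_nonneg _)
        push_cast
        exact mul_le_mul_of_nonpos_left hx.1.le (neg_nonpos.2 (Nat.cast_nonneg m))
    _ ≤ M * Real.exp (m * (L / 4)) := hM m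
    _ = M * Real.exp (-((m : ℤ) * -(L / 4))) := by push_cast; ring_nf
    _ ≤ M * (2 * Real.exp (-(L / 4)) / (-(L / 4)) ^ 2 * pw 2 m) := by
        gcongr
        exact exp_le_pw_two hδ (by positivity)
    _ ≤ M * (2 * Real.exp (-(L / 4)) / (-(L / 4)) ^ 2 * pw (7 / 4) m) := by
        gcongr
        exact pw_le_pw (by norm_num) _
    _ = _ := by rw [pw_neg]; ring

/-- Bounds for the Laurent coefficients of `f` with nonnegative index bound its Fourier
coefficients near the boundary line. -/
lemma exists_fc_le_of_laurent_le (h : EndData L v f g) {L' s A : ℝ} (hf : EndData L' v f g)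
    (hs : s ≤ 7 / 4) (hA : 0 ≤ A)
    (hl : ∀ n : ℤ, 0 ≤ n → ‖laurent L' f n‖ ≤ A * pw s n) :
    ∃ A, 0 ≤ A ∧ ∀ᶠ x in 𝓝[<] (0 : ℝ), (∀ n : ℤ, ‖fc (fun θ => f (pt x θ)) n‖ ≤ A * pw s n) ∧
      ∀ n : ℤ, n < 0 → ‖fc (fun θ => f (pt x θ)) n‖ ≤ A * pw (7 / 4) n := by
  obtain ⟨A', hA'0, hA'⟩ := h.exists_fc_neg_le
  refine ⟨max A A', le_max_of_le_left hA, ?_⟩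
  filter_upwards [hA', hf.eventually_mem] with x h1 hx
  have h2 : ∀ n : ℤ, n < 0 → ‖fc (fun θ => f (pt x θ)) n‖ ≤ max A A' * pw (7 / 4) n := fun n hn =>
    (h1 n hn).trans (mul_le_mul_of_nonneg_right (le_max_right _ _) (pw_pos _ _).le)
  refine ⟨fun n => ?_, h2⟩
  rcases lt_or_ge n 0 with hn | hn
  · refine (h2 n hn).trans (mul_le_mul_of_nonneg_left (pw_le_pw hs n) (le_max_of_le_left hA))
  · rw [norm_fc_slice hf.hf hf.pf hx]
    have hn' : (0 : ℝ) ≤ n := by exact_mod_cast hn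
    have : Real.exp (n * x) ≤ 1 := Real.exp_le_one_iff.2 (by nlinarith [hx.2])
    calc _ ≤ ‖laurent L' f n‖ * 1 := by gcongr
      _ ≤ A * pw s n := by rw [mul_one]; exact hl n hn
      _ ≤ _ := mul_le_mul_of_nonneg_right (le_max_left _ _) (pw_pos _ _).le

/-- Near the boundary line the coefficients of `f` decay like `|n|^{-3/4}`, and faster towards `-∞`.
-/
lemma exists_fc_f_le_three_quarters (h : EndData L v f g) :
    ∃ A, 0 ≤ A ∧ ∀ᶠ x in 𝓝[<] (0 : ℝ),
      (∀ n : ℤ, ‖fc (fun θ => f (pt x θ)) n‖ ≤ A * pw (3 / 4) n) ∧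
      ∀ n : ℤ, n < 0 → ‖fc (fun θ => f (pt x θ)) n‖ ≤ A * pw (7 / 4) n := by
  obtain ⟨L', k, C, hR⟩ := h.exists_regularEnd
  obtain ⟨A, hA0, hA⟩ := hR.exists_norm_laurent_le
  exact h.exists_fc_le_of_laurent_le hR.data (by norm_num) hA0 hA

/-- The Fourier coefficients of `v` decay like `|n|^{-7/4}`, uniformly near the boundary line. -/
lemma exists_fc_v_le (h : EndData L v f g) :
    ∃ B, 0 ≤ B ∧ ∀ᶠ x in 𝓝[<] (0 : ℝ), ∀ n : ℤ, ‖fc (fun θ => v (pt x θ)) n‖ ≤ B * pw (7 / 4) n := by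
  obtain ⟨A, hA0, hA⟩ := h.exists_fc_f_le_three_quarters
  obtain ⟨A', hA'0, hA'⟩ := h.conj_symm.exists_fc_f_le_three_quarters
  refine ⟨2 * (A + A') + 2, by positivity, ?_⟩
  filter_upwards [hA, hA', h.eventually_mem, h.eventually_norm_v one_pos] with x h1 h2 hx h3 n
  have cf := h.continuous_f hx
  have cg := h.continuous_g hx
  have cgc : Continuous fun θ => conj (g (pt x θ)) := continuous_conj.comp cg
  have hp := pw_pos (7 / 4) n
  rcases eq_or_ne n 0 with rfl | hn
  · have : ‖fc (fun θ => v (pt x θ)) 0‖ ≤ 2 :=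
      norm_fc_le (fun θ => by have := abs_le.1 (h3 θ); linarith) 0
    have e : pw (7 / 4) 0 = 1 := by simp [pw]
    rw [e]
    linarith
  · have hn1 : (1 : ℝ) ≤ |(n : ℝ)| := by exact_mod_cast Int.one_le_abs hn
    have e1 := fc_deriv (h.hvt x hx) (continuous_const.mul (cf.sub cgc))
      (by have := periodic_slice h.pv x 0; rwa [zero_add] at this) n
    rw [fc_const_mul, fc_sub cf cgc, fc_conj] at e1
    have e2 : |(n : ℝ)| * ‖fc (fun θ => v (pt x θ)) n‖ =
        ‖fc (fun θ => f (pt x θ)) n - conj (fc (fun θ => g (pt x θ)) (-n))‖ := by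
      have := congrArg norm e1
      rw [norm_mul, norm_mul, norm_mul, norm_I, one_mul, mul_one, norm_intCast] at this
      exact this.symm
    have e3 := norm_sub_le (fc (fun θ => f (pt x θ)) n) (conj (fc (fun θ => g (pt x θ)) (-n)))
    rw [RCLike.norm_conj] at e3
    have e4 := h1.1 n
    have e5 := h2.1 (-n)
    rw [pw_neg] at e5
    have e6 : pw (3 / 4) n ≤ 2 * |(n : ℝ)| * pw (7 / 4) n := by
      have : pw (3 / 4) n = pw (7 / 4) n * (1 + |(n : ℝ)|) := by
        rw [pw, pw, ← Real.rpow_add_one (by positivity)]; norm_num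
      rw [this]
      nlinarith
    have e7 : |(n : ℝ)| * ‖fc (fun θ => v (pt x θ)) n‖ ≤
        |(n : ℝ)| * (2 * (A + A') * pw (7 / 4) n) := by
      rw [e2]
      calc _ ≤ (A + A') * pw (3 / 4) n := by linarith
        _ ≤ (A + A') * (2 * |(n : ℝ)| * pw (7 / 4) n) := by gcongr
        _ = _ := by ring
    have := le_of_mul_le_mul_left e7 (by linarith)
    linarith

/-- Bootstrapping through `f ≈ v² · conj f` improves the decay of the coefficients of `f` to the
summable rate `|n|^{-5/4}`. -/
lemma exists_fc_f_le_five_quarters (h : EndData L v f g) :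
    ∃ A, 0 ≤ A ∧ ∀ᶠ x in 𝓝[<] (0 : ℝ), ∀ n : ℤ,
      ‖fc (fun θ => f (pt x θ)) n‖ ≤ A * pw (5 / 4) n := by
  obtain ⟨A, hA0, hA⟩ := h.exists_fc_f_le_three_quarters
  obtain ⟨B, hB0, hB⟩ := h.exists_fc_v_le
  obtain ⟨L', k, C, hR⟩ := h.exists_regularEnd
  set K := B * B * convC (7 / 4) * A * hankC with hK
  have hK0 : 0 ≤ K := by
    have h1 := convC_nonneg (7 / 4)
    have h2 : 0 ≤ hankC := by
      have h3 : 0 ≤ ∑' j, pw (5 / 4) j := tsum_nonneg fun j => (pw_pos _ j).le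
      have h4 : 0 ≤ ∑' j, pw (7 / 4) j := tsum_nonneg fun j => (pw_pos _ j).le
      unfold hankC; positivity
    positivity
  have hl : ∀ n : ℤ, 0 ≤ n → ‖laurent L' f n‖ ≤ K * pw (5 / 4) n := fun n hn => by
    refine hR.norm_laurent_le n ?_
    filter_upwards [hA, hB, h.eventually_mem] with x h1 h2 hx
    have cv := h.continuous_v hx
    have cf := h.continuous_f hx
    have pv := periodic_slice h.pv x
    have h3 : ∀ m, ‖fc (fun θ => v (pt x θ) * v (pt x θ)) m‖ ≤
        B * B * convC (7 / 4) * pw (7 / 4) m := fun m =>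
      norm_le_of_hasSum_conv (by norm_num) h2 h2
        (hasSum_fc_mul cv pv (summable_of_le_pw (by norm_num) h2) cv m)
    have hs := hasSum_fc_mul (cv.mul cv) (pv.mul pv)
      (summable_of_le_pw (by norm_num : (1 : ℝ) < 7 / 4) h3) (continuous_conj.comp cf) n
    rw [← (Equiv.addLeft n).hasSum_iff] at hs
    have e : (fun θ => v (pt x θ) ^ 2 * conj (f (pt x θ))) =
        fun θ => v (pt x θ) * v (pt x θ) * conj (f (pt x θ)) := by
      funext θ; rw [sq]
    rw [e]
    refine norm_le_of_hasSum_hankel (β := fun j => conj (fc (fun θ => f (pt x θ)) j)) h3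
      (fun j hj => by rw [RCLike.norm_conj]; exact h1.1 j)
      (fun j hj => by rw [RCLike.norm_conj]; exact h1.2 j hj) hn ?_
    have e2 : (fun j => fc (fun θ => v (pt x θ) * v (pt x θ)) (n + j) *
        conj (fc (fun θ => f (pt x θ)) j)) =
        (fun m => fc (fun θ => v (pt x θ) * v (pt x θ)) m *
          fc (fun θ => conj (f (pt x θ))) (n - m)) ∘ Equiv.addLeft n := by
      funext j
      simp only [Function.comp_apply, Equiv.coe_addLeft]
      rw [fc_conj, show -(n - (n + j)) = j by ring]
    rw [e2]
    exact hs
  obtain ⟨A', h0, h1⟩ := h.exists_fc_le_of_laurent_le hR.data (by norm_num) hK0 hl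
  exact ⟨A', h0, h1.mono fun x hx => hx.1⟩

lemma exists_norm_f_le (h : EndData L v f g) :
    ∃ M, ∀ᶠ x in 𝓝[<] (0 : ℝ), ∀ θ, ‖f (pt x θ)‖ ≤ M := by
  obtain ⟨A, hA0, hA⟩ := h.exists_fc_f_le_five_quarters
  refine ⟨∑' n, A * pw (5 / 4) n, ?_⟩
  filter_upwards [hA, h.eventually_mem] with x h1 hx θ
  have hs := summable_of_le_pw (by norm_num) h1
  refine (norm_le_tsum_fc (h.continuous_f hx) (periodic_slice h.pf x) hs θ).trans ?_
  exact hs.tsum_le_tsum h1 ((summable_pw (by norm_num)).mul_left A)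

/-- The natural boundary condition holds uniformly: `Im (conj v · f)` tends to zero. -/
lemma eventually_im_le (h : EndData L v f g) {ε : ℝ} (hε : 0 < ε) :
    ∀ᶠ x in 𝓝[<] (0 : ℝ), ∀ θ, |2 * (conj (v (pt x θ)) * f (pt x θ)).im| ≤ ε := by
  obtain ⟨A, hA0, hA⟩ := h.exists_fc_f_le_five_quarters
  obtain ⟨B, hB0, hB⟩ := h.exists_fc_v_le
  set P : ℝ → ℝ → ℝ := fun x θ => 2 * (conj (v (pt x θ)) * f (pt x θ)).im with hP
  set K := B * A * convC (5 / 4) with hK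
  have hfcP : ∀ᶠ x in 𝓝[<] (0 : ℝ), ∀ n, ‖fc (fun θ => (P x θ : ℂ)) n‖ ≤ 2 * K * pw (5 / 4) n := by
    filter_upwards [hA, hB, h.eventually_mem] with x h1 h2 hx n
    have cvc : Continuous fun θ => conj (v (pt x θ)) := continuous_conj.comp (h.continuous_v hx)
    have cf := h.continuous_f hx
    have h3 : ∀ m, ‖fc (fun θ => conj (v (pt x θ))) m‖ ≤ B * pw (5 / 4) m := fun m => by
      rw [fc_conj, RCLike.norm_conj, ← pw_neg]
      exact (h2 (-m)).trans (mul_le_mul_of_nonneg_left (pw_le_pw (by norm_num) _) hB0)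
    have h4 : ∀ m, ‖fc (fun θ => conj (v (pt x θ)) * f (pt x θ)) m‖ ≤ K * pw (5 / 4) m := fun m =>
      norm_le_of_hasSum_conv (by norm_num) h3 h1
        (hasSum_fc_mul cvc (fun θ => by
          have := periodic_slice h.pv x θ
          simp only at this
          simp only [this])
          (summable_of_le_pw (by norm_num) h3) cf m)
    have cW : Continuous fun θ => conj (v (pt x θ)) * f (pt x θ) := cvc.mul cf
    have cWc : Continuous fun θ => conj (conj (v (pt x θ)) * f (pt x θ)) := continuous_conj.comp cW
    have e : (fun θ => (P x θ : ℂ)) = fun θ => -I * (conj (v (pt x θ)) * f (pt x θ) -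
        conj (conj (v (pt x θ)) * f (pt x θ))) := by
      funext θ
      rw [Complex.sub_conj, hP]
      linear_combination ((2 * (conj (v (pt x θ)) * f (pt x θ)).im : ℝ) : ℂ) * I_sq
    rw [e, fc_const_mul, fc_sub cW cWc, fc_conj, norm_mul, norm_neg, norm_I, one_mul]
    refine (norm_sub_le _ _).trans ?_
    rw [RCLike.norm_conj]
    have := h4 (-n)
    rw [pw_neg] at this
    linarith [h4 n]
  have lim : Tendsto (fun x => ∑' n, ‖fc (fun θ => (P x θ : ℂ)) n‖) (𝓝[<] 0)
      (𝓝 (∑' _ : ℤ, (0 : ℝ))) :=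
    tendsto_tsum_of_dominated_convergence
      ((summable_pw (by norm_num : (1 : ℝ) < 5 / 4)).mul_left (2 * K))
      (fun n => by
        have := (h.tendsto_fc_P n).norm
        rw [norm_zero] at this
        exact this)
      (hfcP.mono fun x hx n => by rw [norm_norm]; exact hx n)
  rw [tsum_zero] at lim
  filter_upwards [lim.eventually (ge_mem_nhds hε), hfcP, h.eventually_mem] with x h1 h2 hx θ
  have cP : Continuous fun θ => (P x θ : ℂ) := continuous_ofReal.comp (h.continuous_P hx)
  have := norm_le_tsum_fc cP (fun θ => by
    have e1 := periodic_slice h.pv x θ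
    have e2 := periodic_slice h.pf x θ
    simp only at e1 e2
    simp only [hP, e1, e2]) (summable_of_le_pw (by norm_num) h2) θ
  rw [norm_real, Real.norm_eq_abs] at this
  exact this.trans h1

end EndData

/-! ### The degree in terms of Fourier coefficients -/

lemma wedge_eq_im (a b : ℂ) : wedge a b = (conj a * b).im := by
  simp [wedge]; ring

/-- The degree integral of a periodic `C¹` function is `∑ₙ n |φₙ|²`. -/
lemma hasSum_degree {φ φ' : ℝ → ℂ} (hφ : ∀ θ, HasDerivAt φ (φ' θ) θ) (hφ' : Continuous φ')
    (pφ : φ (2 * Real.pi) = φ 0) :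
    HasSum (fun n : ℤ => (n : ℝ) * ‖fc φ n‖ ^ 2)
      ((2 * Real.pi)⁻¹ * ∫ θ in (0 : ℝ)..(2 * Real.pi), wedge (φ θ) (φ' θ)) := by
  have cφ : Continuous φ := continuous_iff_continuousAt.2 fun θ => (hφ θ).continuousAt
  have cI : Continuous fun θ => I * φ' θ := continuous_const.mul hφ'
  have cψ : Continuous fun θ => φ θ - I * φ' θ := cφ.sub cI
  have q1 : Continuous fun θ => ‖φ θ‖ ^ 2 := cφ.norm.pow 2
  have q2 : Continuous fun θ => ‖φ' θ‖ ^ 2 := hφ'.norm.pow 2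
  have q3 : Continuous fun θ => ‖φ θ - I * φ' θ‖ ^ 2 := cψ.norm.pow 2
  have q4 : Continuous fun θ => ‖φ θ - I * φ' θ‖ ^ 2 - ‖φ' θ‖ ^ 2 := q3.sub q2
  have h1 := hasSum_sq_fc cφ
  have h2 := hasSum_sq_fc hφ'
  have h3 := hasSum_sq_fc cψ
  have e1 : ∀ n : ℤ, fc (fun θ => φ θ - I * φ' θ) n = (1 + n) * fc φ n := fun n => by
    rw [fc_sub cφ cI, fc_const_mul, fc_deriv hφ hφ' pφ]
    linear_combination -n * fc φ n * I_sq
  have h4 := ((h3.sub h2).sub h1).mul_left (1 / 2)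
  have e2 : (fun n : ℤ => (n : ℝ) * ‖fc φ n‖ ^ 2) = fun n => 1 / 2 *
      (‖fc (fun θ => φ θ - I * φ' θ) n‖ ^ 2 - ‖fc φ' n‖ ^ 2 - ‖fc φ n‖ ^ 2) := by
    funext n
    rw [e1, fc_deriv hφ hφ' pφ, norm_mul, norm_mul, norm_mul, norm_I]
    have a1 : ‖(1 + n : ℂ)‖ = |1 + (n : ℝ)| := by
      rw [← Real.norm_eq_abs, ← Complex.norm_real]; push_cast; rfl
    have a2 : ‖(n : ℂ)‖ = |(n : ℝ)| := by
      rw [← Real.norm_eq_abs, ← Complex.norm_real]; push_cast; rfl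
    rw [a1, a2, mul_pow, mul_pow, mul_one, sq_abs, sq_abs]
    ring
  rw [e2]
  have e3 : (2 * Real.pi)⁻¹ * ∫ θ in (0 : ℝ)..(2 * Real.pi), wedge (φ θ) (φ' θ) = 1 / 2 *
      ((2 * Real.pi)⁻¹ * (∫ θ in (0 : ℝ)..(2 * Real.pi), ‖φ θ - I * φ' θ‖ ^ 2) -
      (2 * Real.pi)⁻¹ * (∫ θ in (0 : ℝ)..(2 * Real.pi), ‖φ' θ‖ ^ 2) -
      (2 * Real.pi)⁻¹ * ∫ θ in (0 : ℝ)..(2 * Real.pi), ‖φ θ‖ ^ 2) := by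
    rw [← mul_sub, ← mul_sub, ← intervalIntegral.integral_sub
      (q3.intervalIntegrable _ _) (q2.intervalIntegrable _ _),
      ← intervalIntegral.integral_sub
      (q4.intervalIntegrable _ _) (q1.intervalIntegrable _ _), mul_left_comm,
      ← intervalIntegral.integral_const_mul (1 / 2)]
    congr 2
    ext θ
    simp only [← normSq_eq_norm_sq, normSq_apply, wedge]
    simp
    ring
  rw [e3]
  exact h4

lemma fc_sub_of_intervalIntegrable {φ ψ : ℝ → ℂ} (hφ : IntervalIntegrable φ volume 0 (2 * Real.pi))
    (hψ : IntervalIntegrable ψ volume 0 (2 * Real.pi)) (n : ℤ) :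
    fc (fun θ => φ θ - ψ θ) n = fc φ n - fc ψ n := by
  simp only [fc_eq, mul_sub]
  rw [intervalIntegral.integral_sub, mul_sub]
  · exact hφ.continuousOn_mul (continuous_ex _).continuousOn
  · exact hψ.continuousOn_mul (continuous_ex _).continuousOn

instance : IsFiniteMeasure angleMeasure := by unfold angleMeasure; infer_instance

lemma intervalIntegrable_of_memLp {g : ℝ → ℂ} (hg : MemLp g 2 angleMeasure) :
    IntervalIntegrable g volume 0 (2 * Real.pi) := by
  rw [intervalIntegrable_iff_integrableOn_Ioc_of_le Real.two_pi_pos.le]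
  exact hg.integrable one_le_two

lemma abs_sq_sub_sq_le {a b : ℂ} {η : ℝ} (hη : 0 < η) :
    |‖a‖ ^ 2 - ‖b‖ ^ 2| ≤ η * ‖b‖ ^ 2 + (1 + η⁻¹) * ‖a - b‖ ^ 2 := by
  have h1 := abs_norm_sub_norm_le a b
  set s := ‖a‖ - ‖b‖ with hs
  have e : ‖a‖ ^ 2 - ‖b‖ ^ 2 = s * (2 * ‖b‖) + s ^ 2 := by rw [hs]; ring
  have h2 : |s| ^ 2 ≤ ‖a - b‖ ^ 2 := by gcongr
  have h3 : 2 * |s| * ‖b‖ ≤ η * ‖b‖ ^ 2 + η⁻¹ * |s| ^ 2 := by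
    have : 0 ≤ η⁻¹ * (η * ‖b‖ - |s|) ^ 2 := by positivity
    have e2 : η⁻¹ * (η * ‖b‖ - |s|) ^ 2 = η * ‖b‖ ^ 2 + η⁻¹ * |s| ^ 2 - 2 * |s| * ‖b‖ := by
      field_simp; ring
    linarith
  have h4 : 0 < η⁻¹ := by positivity
  calc |‖a‖ ^ 2 - ‖b‖ ^ 2| ≤ |s| * (2 * ‖b‖) + |s| ^ 2 := by
        rw [e]
        refine (abs_add_le _ _).trans_eq ?_
        rw [abs_mul, abs_of_nonneg (by positivity : 0 ≤ 2 * ‖b‖), abs_pow]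
    _ ≤ η * ‖b‖ ^ 2 + η⁻¹ * |s| ^ 2 + |s| ^ 2 := by linarith
    _ ≤ η * ‖b‖ ^ 2 + η⁻¹ * ‖a - b‖ ^ 2 + ‖a - b‖ ^ 2 := by gcongr
    _ = _ := by ring

/-- A periodic `C¹` function has finite `H^{1/2}` norm. -/
lemma summable_half_of_contDiff {φ φ' : ℝ → ℂ} (hφ : ∀ θ, HasDerivAt φ (φ' θ) θ)
    (hφ' : Continuous φ') (pφ : φ (2 * Real.pi) = φ 0) :
    Summable fun n : ℤ => (1 + |(n : ℝ)|) * ‖fc φ n‖ ^ 2 := by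
  have cφ : Continuous φ := continuous_iff_continuousAt.2 fun θ => (hφ θ).continuousAt
  refine Summable.of_nonneg_of_le (fun n => by positivity) (fun n => ?_)
    (((hasSum_sq_fc cφ).summable.mul_left 2).add (hasSum_sq_fc hφ').summable)
  rw [fc_deriv hφ hφ' pφ, norm_mul, norm_mul, norm_I, mul_one, norm_intCast, mul_pow]
  have : |(n : ℝ)| ≤ 1 + |(n : ℝ)| ^ 2 := by nlinarith [sq_nonneg (|(n : ℝ)| - 1)]
  nlinarith [sq_nonneg ‖fc φ n‖]

/-- The `H^{1/2}` degree of `g` is `∑ₙ n |gₙ|²`. -/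
lemma HasDegree.hasSum {g : ℝ → ℂ} {d : ℤ} (hg : MemLp g 2 angleMeasure) (h : HasDegree g d) :
    HasSum (fun n : ℤ => (n : ℝ) * ‖fc g n‖ ^ 2) d := by
  obtain ⟨H, hH, hlim, hdeg⟩ := h
  have ig := intervalIntegrable_of_memLp hg
  have cH : ∀ k, Continuous (H k) := fun k => (hH k).contDiff.continuous
  have cH' : ∀ k, Continuous (deriv (H k)) := fun k => (hH k).contDiff.continuous_deriv (by simp)
  have dH : ∀ k θ, HasDerivAt (H k) (deriv (H k) θ) θ := fun k θ =>
    ((hH k).contDiff.differentiable (by simp) θ).hasDerivAt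
  have pH : ∀ k, H k (2 * Real.pi) = H k 0 := fun k => by
    have := (hH k).periodic 0; rwa [zero_add] at this
  have hsub : ∀ k n, fc (fun θ => H k θ - g θ) n = fc (H k) n - fc g n := fun k n =>
    fc_sub_of_intervalIntegrable ((cH k).intervalIntegrable _ _) ig n
  have hfin : ∀ᶠ k in atTop, halfNormSq (fun θ => H k θ - g θ) ≠ ⊤ :=
    (hlim.eventually (gt_mem_nhds ENNReal.zero_lt_top)).mono fun k hk => hk.ne
  have hN : ∀ k, halfNormSq (fun θ => H k θ - g θ) ≠ ⊤ →
      Summable (fun n : ℤ => (1 + |(n : ℝ)|) * ‖fc (H k) n - fc g n‖ ^ 2) ∧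
      ∑' n : ℤ, (1 + |(n : ℝ)|) * ‖fc (H k) n - fc g n‖ ^ 2 =
        (halfNormSq (fun θ => H k θ - g θ)).toReal := fun k hk => by
    have e : halfNormSq (fun θ => H k θ - g θ) =
        ∑' n : ℤ, ENNReal.ofReal ((1 + |(n : ℝ)|) * ‖fc (H k) n - fc g n‖ ^ 2) := by
      rw [halfNormSq]
      simp only [← hsub]
      rfl
    have hs : Summable (fun n : ℤ => (1 + |(n : ℝ)|) * ‖fc (H k) n - fc g n‖ ^ 2) := by
      rw [e] at hk
      have := ENNReal.summable_toReal hk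
      refine this.congr fun n => ENNReal.toReal_ofReal (by positivity)
    refine ⟨hs, ?_⟩
    rw [e, ← ENNReal.ofReal_tsum_of_nonneg (fun n => by positivity) hs, ENNReal.toReal_ofReal]
    exact tsum_nonneg fun n => by positivity
  have hSg : Summable fun n : ℤ => (1 + |(n : ℝ)|) * ‖fc g n‖ ^ 2 := by
    obtain ⟨k, hk⟩ := hfin.exists
    refine Summable.of_nonneg_of_le (fun n => by positivity) (fun n => ?_)
      (((summable_half_of_contDiff (dH k) (cH' k) (pH k)).mul_left 2).add
        ((hN k hk).1.mul_left 2))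
    have h1 : ‖fc g n‖ ≤ ‖fc (H k) n‖ + ‖fc (H k) n - fc g n‖ := by
      have := norm_sub_norm_le (fc g n) (fc (H k) n)
      rw [norm_sub_rev] at this
      linarith
    have h2 : ‖fc g n‖ ^ 2 ≤ 2 * ‖fc (H k) n‖ ^ 2 + 2 * ‖fc (H k) n - fc g n‖ ^ 2 := by
      have h0 := norm_nonneg (fc g n)
      nlinarith [sq_nonneg (‖fc (H k) n‖ - ‖fc (H k) n - fc g n‖)]
    calc _ ≤ (1 + |(n : ℝ)|) * (2 * ‖fc (H k) n‖ ^ 2 + 2 * ‖fc (H k) n - fc g n‖ ^ 2) := by gcongr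
      _ = _ := by ring
  have hSd : Summable fun n : ℤ => (n : ℝ) * ‖fc g n‖ ^ 2 := by
    refine Summable.of_norm_bounded hSg fun n => ?_
    rw [Real.norm_eq_abs, abs_mul, abs_sq]
    gcongr
    linarith [abs_nonneg (n : ℝ)]
  set N := ∑' n : ℤ, (1 + |(n : ℝ)|) * ‖fc g n‖ ^ 2 with hNdef
  have hN0 : 0 ≤ N := tsum_nonneg fun n => by positivity
  -- the weighted inequality `||a|² - |b|²| ≤ η |b|² + (1 + η⁻¹) |a - b|²` gives continuity of the
  -- degree
  have hest : ∀ η : ℝ, 0 < η → ∀ᶠ k in atTop,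
      |smoothDegree (H k) - ∑' n : ℤ, (n : ℝ) * ‖fc g n‖ ^ 2| ≤ η * N +
        (1 + η⁻¹) * (halfNormSq (fun θ => H k θ - g θ)).toReal := fun η hη => by
    filter_upwards [hfin] with k hk
    have hd := hasSum_degree (dH k) (cH' k) (pH k)
    have hs := hd.sub hSd.hasSum
    obtain ⟨s1, s2⟩ := hN k hk
    have hb := (hSg.hasSum.mul_left η).add (s1.hasSum.mul_left (1 + η⁻¹))
    rw [s2] at hb
    have hterm : ∀ n : ℤ, |(n : ℝ) * ‖fc (H k) n‖ ^ 2 - (n : ℝ) * ‖fc g n‖ ^ 2| ≤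
        η * ((1 + |(n : ℝ)|) * ‖fc g n‖ ^ 2) +
        (1 + η⁻¹) * ((1 + |(n : ℝ)|) * ‖fc (H k) n - fc g n‖ ^ 2) := fun n => by
      rw [← mul_sub, abs_mul]
      have h1 := abs_sq_sub_sq_le (a := fc (H k) n) (b := fc g n) hη
      calc _ ≤ (1 + |(n : ℝ)|) * (η * ‖fc g n‖ ^ 2 + (1 + η⁻¹) * ‖fc (H k) n - fc g n‖ ^ 2) := by
            gcongr
            linarith [abs_nonneg (n : ℝ)]
        _ = _ := by ring
    rw [abs_le]
    constructor
    · have := hasSum_le (fun n => (abs_le.1 (hterm n)).1) hb.neg hs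
      exact this
    · exact hasSum_le (fun n => (abs_le.1 (hterm n)).2) hs hb
  have hreal : Tendsto (fun k => (halfNormSq (fun θ => H k θ - g θ)).toReal) atTop (𝓝 0) := by
    have := (ENNReal.tendsto_toReal ENNReal.zero_ne_top).comp hlim
    rw [ENNReal.toReal_zero] at this
    exact this
  have hle : ∀ η : ℝ, 0 < η → |(d : ℝ) - ∑' n : ℤ, (n : ℝ) * ‖fc g n‖ ^ 2| ≤ η * N := fun η hη => by
    have l1 := ((hdeg.sub_const (∑' n : ℤ, (n : ℝ) * ‖fc g n‖ ^ 2)).abs)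
    have l2 := (hreal.const_mul (1 + η⁻¹)).const_add (η * N)
    rw [mul_zero, add_zero] at l2
    exact le_of_tendsto_of_tendsto l1 l2 (hest η hη)
  have hzero : |(d : ℝ) - ∑' n : ℤ, (n : ℝ) * ‖fc g n‖ ^ 2| ≤ 0 := by
    refine le_of_forall_pos_le_add fun ε hε => ?_
    refine (hle (ε / (N + 1)) (by positivity)).trans ?_
    rw [zero_add, div_mul_eq_mul_div, div_le_iff₀ (by positivity)]
    nlinarith
  have : (d : ℝ) = ∑' n : ℤ, (n : ℝ) * ‖fc g n‖ ^ 2 := by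
    rw [← sub_eq_zero, ← abs_nonpos_iff]; exact hzero
  rw [this]
  exact hSd.hasSum

/-- `L²` convergence implies convergence of the Fourier coefficients. -/
lemma tendsto_fc_of_eLpNorm {l : Filter ℝ} {φ : ℝ → ℝ → ℂ} {g : ℝ → ℂ} (hg : MemLp g 2 angleMeasure)
    (hφ : ∀ᶠ x in l, Continuous (φ x))
    (h : Tendsto (fun x => eLpNorm (fun θ => φ x θ - g θ) 2 angleMeasure) l (𝓝 0)) (n : ℤ) :
    Tendsto (fun x => fc (φ x) n) l (𝓝 (fc g n)) := by
  have ig := intervalIntegrable_of_memLp hg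
  rw [tendsto_iff_norm_sub_tendsto_zero]
  have hC : angleMeasure univ ^ (1 / (1 : ENNReal).toReal - 1 / (2 : ENNReal).toReal) ≠ ⊤ :=
    ENNReal.rpow_ne_top_of_nonneg (by norm_num) (measure_ne_top _ _)
  have h1 : Tendsto (fun x => (eLpNorm (fun θ => φ x θ - g θ) 2 angleMeasure *
      angleMeasure univ ^ (1 / (1 : ENNReal).toReal - 1 / (2 : ENNReal).toReal)).toReal) l
      (𝓝 0) := by
    have := (ENNReal.tendsto_toReal ENNReal.zero_ne_top).comp
      (by rw [← zero_mul (angleMeasure univ ^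
        (1 / (1 : ENNReal).toReal - 1 / (2 : ENNReal).toReal))]; exact
        ENNReal.Tendsto.mul_const (b := angleMeasure univ ^
        (1 / (1 : ENNReal).toReal - 1 / (2 : ENNReal).toReal)) h (Or.inr hC))
    rw [ENNReal.toReal_zero] at this
    exact this
  refine squeeze_zero' (Eventually.of_forall fun _ => norm_nonneg _) ?_ h1
  filter_upwards [hφ, h.eventually (gt_mem_nhds ENNReal.zero_lt_top)] with x hx hx2
  rw [← fc_sub_of_intervalIntegrable (hx.intervalIntegrable _ _) ig]
  refine (norm_fc_le_integral n).trans ?_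
  have e6 : (2 * Real.pi)⁻¹ ≤ 1 := inv_le_one_of_one_le₀ (by linarith [Real.pi_gt_three])
  have hm : AEStronglyMeasurable (fun θ => φ x θ - g θ) angleMeasure :=
    hx.aestronglyMeasurable.sub hg.1
  have h2 := eLpNorm_le_eLpNorm_mul_rpow_measure_univ (one_le_two) hm
  have h3 : ∫ θ in (0 : ℝ)..(2 * Real.pi), ‖φ x θ - g θ‖ =
      (eLpNorm (fun θ => φ x θ - g θ) 1 angleMeasure).toReal := by
    rw [intervalIntegral.integral_of_le Real.two_pi_pos.le, eLpNorm_one_eq_lintegral_enorm]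
    exact integral_norm_eq_lintegral_enorm hm
  have h4 : 0 ≤ ∫ θ in (0 : ℝ)..(2 * Real.pi), ‖φ x θ - g θ‖ :=
    intervalIntegral.integral_nonneg Real.two_pi_pos.le fun _ _ => norm_nonneg _
  calc _ ≤ 1 * ∫ θ in (0 : ℝ)..(2 * Real.pi), ‖φ x θ - g θ‖ := by gcongr
    _ ≤ _ := by
      rw [one_mul, h3]
      exact ENNReal.toReal_mono (ENNReal.mul_ne_top hx2.ne hC) h2

/-- The degree integrals of `C¹` maps converge to the degree of their `L²` limit when the Fourier
coefficients are uniformly `O(|n|^{-7/4})`. -/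
lemma HasDegree.tendsto_integral {l : Filter ℝ} {φ φ' : ℝ → ℝ → ℂ} {g : ℝ → ℂ} {d : ℤ} {B : ℝ}
    (hg : MemLp g 2 angleMeasure) (h : HasDegree g d)
    (hφ : ∀ᶠ x in l, (∀ θ, HasDerivAt (φ x) (φ' x θ) θ) ∧ Continuous (φ' x) ∧
      φ x (2 * Real.pi) = φ x 0 ∧ ∀ n, ‖fc (φ x) n‖ ≤ B * pw (7 / 4) n)
    (hlim : Tendsto (fun x => eLpNorm (fun θ => φ x θ - g θ) 2 angleMeasure) l (𝓝 0)) :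
    Tendsto (fun x => ∫ θ in (0 : ℝ)..(2 * Real.pi), wedge (φ x θ) (φ' x θ)) l
      (𝓝 (2 * Real.pi * d)) := by
  have hcoef := fun n => tendsto_fc_of_eLpNorm hg (hφ.mono fun x hx =>
    continuous_iff_continuousAt.2 fun θ => (hx.1 θ).continuousAt) hlim n
  have key : Tendsto (fun x => ∑' n : ℤ, (n : ℝ) * ‖fc (φ x) n‖ ^ 2) l
      (𝓝 (∑' n : ℤ, (n : ℝ) * ‖fc g n‖ ^ 2)) := by
    refine tendsto_tsum_of_dominated_convergence
      ((summable_pw (by norm_num : (1 : ℝ) < 5 / 2)).mul_left (B ^ 2))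
      (fun n => ((hcoef n).norm.pow 2).const_mul _) ?_
    filter_upwards [hφ] with x hx n
    rw [Real.norm_eq_abs, abs_mul, abs_sq]
    have e : pw (5 / 2) n = (1 + |(n : ℝ)|) * pw (7 / 4) n ^ 2 := by
      rw [← Real.rpow_natCast (pw (7 / 4) n), pw, pw, ← Real.rpow_mul (by positivity)]
      nth_rewrite 2 [← Real.rpow_one (1 + |(n : ℝ)|)]
      rw [← Real.rpow_add (by positivity)]
      norm_num
    rw [e]
    calc |(n : ℝ)| * ‖fc (φ x) n‖ ^ 2 ≤ (1 + |(n : ℝ)|) * (B * pw (7 / 4) n) ^ 2 := by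
          gcongr
          · linarith
          · exact hx.2.2.2 n
      _ = _ := by ring
  rw [(h.hasSum hg).tsum_eq] at key
  refine (key.const_mul (2 * Real.pi)).congr' ?_
  filter_upwards [hφ] with x hx
  rw [(hasSum_degree hx.1 hx.2.1 hx.2.2.1).tsum_eq, mul_inv_cancel_left₀ Real.two_pi_pos.ne']

/-! ### The Hopf differential and the degrees in the strip -/

/-- The angular velocity of `conj a · p` is that of `p` minus that of `a`; here `b` and `p'` stand
for the derivatives of `a` and `p`. -/
lemma logDeriv_identity {a b p p' : ℂ} (ha : a ≠ 0) (hp : p ≠ 0) :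
    ((conj b * p + conj a * p') / (conj a * p)).im = (p' / p).im - wedge a b / ‖a‖ ^ 2 := by
  have hca : conj a ≠ 0 := (map_ne_zero _).2 ha
  have e1 : (conj b * p + conj a * p') / (conj a * p) = conj (b / a) + p' / p := by
    rw [map_div₀]; field_simp
  have e2 : (b / a).im = wedge a b / ‖a‖ ^ 2 := by
    rw [div_im, ← normSq_eq_norm_sq, wedge]; ring
  rw [e1, add_im, conj_im, e2]; ring

namespace EndData

variable {L : ℝ} {v f g : ℂ → ℂ}

/-- The imaginary part of `f g`, which is the Hopf differential in the `ζ`-coordinate, tends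
to zero uniformly at the boundary line. -/
lemma eventually_im_mul_le (h : EndData L v f g) {ε : ℝ} (hε : 0 < ε) :
    ∀ᶠ x in 𝓝[<] (0 : ℝ), ∀ θ, |(f (pt x θ) * g (pt x θ)).im| ≤ ε := by
  obtain ⟨M, hM⟩ := h.exists_norm_f_le
  obtain ⟨M', hM'⟩ := h.conj_symm.exists_norm_f_le
  have hδ : 0 < ε / (4 * (|M| + |M'| + 1)) := by positivity
  filter_upwards [hM, hM', h.eventually_im_le hδ, h.conj_symm.eventually_im_le hδ,
    h.eventually_norm_v (by norm_num : (0 : ℝ) < 1 / 4)] with x h1 h2 h3 h4 h5 θ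
  set δ := ε / (4 * (|M| + |M'| + 1)) with hδdef
  have i3 := h3 θ
  have i4 := h4 θ
  have i5 := abs_le.1 (h5 θ)
  have j1 := (h1 θ).trans (le_abs_self M)
  have j2 := (h2 θ).trans (le_abs_self M')
  rw [RingHomCompTriple.comp_apply, RingHom.id_apply] at i4
  set a := v (pt x θ)
  set b := f (pt x θ)
  set c := g (pt x θ)
  have e : (b * c).im * ‖a‖ ^ 2 = (conj a * b).re * (a * c).im + (conj a * b).im * (a * c).re := by
    rw [← normSq_eq_norm_sq, normSq_apply]; simp; ring
  rw [abs_mul, abs_two] at i3 i4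
  have n1 : |(conj a * b).re| ≤ 2 * |M| := by
    refine (abs_re_le_norm _).trans ?_
    rw [norm_mul, RCLike.norm_conj]
    exact mul_le_mul (by linarith) j1 (norm_nonneg _) (by norm_num)
  have n2 : |(a * c).re| ≤ 2 * |M'| := by
    refine (abs_re_le_norm _).trans ?_
    rw [norm_mul]
    exact mul_le_mul (by linarith) j2 (norm_nonneg _) (by norm_num)
  have n3 : |(b * c).im * ‖a‖ ^ 2| ≤ (|M| + |M'|) * δ := by
    rw [e]
    refine (abs_add_le _ _).trans ?_
    rw [abs_mul, abs_mul]
    have k1 : |(conj a * b).re| * |(a * c).im| ≤ 2 * |M| * (δ / 2) :=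
      mul_le_mul n1 (by linarith) (abs_nonneg _) (by positivity)
    have k2 : |(conj a * b).im| * |(a * c).re| ≤ δ / 2 * (2 * |M'|) :=
      mul_le_mul (by linarith) n2 (abs_nonneg _) (by positivity)
    linarith
  have n4 : (|M| + |M'|) * δ ≤ ε / 4 := by
    rw [hδdef, mul_div_assoc', div_le_div_iff₀ (by positivity) (by norm_num)]
    nlinarith
  rw [abs_mul, abs_of_nonneg (sq_nonneg ‖a‖)] at n3
  have n5 : 1 / 4 ≤ ‖a‖ ^ 2 := by nlinarith
  nlinarith [abs_nonneg (b * c).im]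

/-- When `f g` is a nonzero constant, the degree integral of `v` is asymptotic to the winding of
`f`, because `(conj v · f)²` stays in the right half-plane near the boundary line. -/
lemma tendsto_integral_wedge (h : EndData L v f g) {c : ℂ} (hc : c ≠ 0)
    (hF : ∀ ζ ∈ strip L, f ζ * g ζ = c) :
    Tendsto (fun x => (∫ θ in (0 : ℝ)..(2 * Real.pi),
        wedge (v (pt x θ)) (I * (f (pt x θ) - conj (g (pt x θ))))) -
      ∫ θ in (0 : ℝ)..(2 * Real.pi), (I * deriv f (pt x θ) / f (pt x θ)).im) (𝓝[<] 0) (𝓝 0) := by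
  have hpi := Real.two_pi_pos
  obtain ⟨M, hM⟩ := h.exists_norm_f_le
  obtain ⟨M', hM'⟩ := h.conj_symm.exists_norm_f_le
  rw [Metric.tendsto_nhds]
  intro ε hε
  set K := |M| + |M'| + 1 with hK
  have hK1 : 1 ≤ K := by linarith [abs_nonneg M, abs_nonneg M']
  have hcn : 0 < ‖c‖ := norm_pos_iff.2 hc
  have hδ : 0 < min (1 / 4) (ε / (400 * K)) := by positivity
  have hδ' : 0 < ‖c‖ / (4 * K) := by positivity
  filter_upwards [hM, hM', h.eventually_im_le hδ', h.eventually_norm_v hδ, h.eventually_mem]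
    with x h1 h2 h3 h4 hx
  set δ := min (1 / 4) (ε / (400 * K)) with hδdef
  have cv := h.continuous_v hx
  have cf := h.continuous_f hx
  have cg := h.continuous_g hx
  have cvt : Continuous fun θ => I * (f (pt x θ) - conj (g (pt x θ))) :=
    continuous_const.mul (cf.sub (continuous_conj.comp cg))
  have cf' : Continuous fun θ => I * deriv f (pt x θ) := continuous_const.mul
    (continuous_slice (continuousOn_slice h.continuousOn_deriv_f) hx)
  have hmem : ∀ θ, pt x θ ∈ strip L := fun θ => pt_mem hx θ
  have hf0 : ∀ θ, f (pt x θ) ≠ 0 := fun θ h0 => hc (by rw [← hF _ (hmem θ), h0, zero_mul])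
  have hnv : ∀ θ, |‖v (pt x θ)‖ - 1| ≤ 1 / 4 := fun θ => (h4 θ).trans (min_le_left _ _)
  have hv0 : ∀ θ, v (pt x θ) ≠ 0 := fun θ h0 => by
    have := hnv θ
    rw [h0, norm_zero] at this
    norm_num at this
  have hfK : ∀ θ, ‖c‖ ≤ ‖f (pt x θ)‖ * K := fun θ => by
    rw [← hF _ (hmem θ), norm_mul]
    gcongr
    exact (h2 θ).trans (by linarith [le_abs_self M', abs_nonneg M])
  set W : ℝ → ℂ := fun θ => conj (v (pt x θ)) * f (pt x θ) with hW
  set W' : ℝ → ℂ := fun θ => conj (I * (f (pt x θ) - conj (g (pt x θ)))) * f (pt x θ) +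
        conj (v (pt x θ)) * (I * deriv f (pt x θ)) with hW'
  have hW0 : ∀ θ, W θ ≠ 0 := fun θ => mul_ne_zero ((map_ne_zero _).2 (hv0 θ)) (hf0 θ)
  have dW : ∀ θ, HasDerivAt W (W' θ) θ := fun θ => h.hasDerivAt_W_right hx θ
  have cW : Continuous W := (continuous_conj.comp cv).mul cf
  have cW' : Continuous W' := ((continuous_conj.comp cvt).mul cf).add
    ((continuous_conj.comp cv).mul cf')
  -- `|W|` is bounded below and `Im W` is small, so `W²` is close to the positive half-axis
  have hslit : ∀ θ, W θ * W θ ∈ slitPlane := fun θ => by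
    refine Or.inl ?_
    have a1 := h3 θ
    have a2 := hfK θ
    have a3 := abs_le.1 (hnv θ)
    have a4 : ‖W θ‖ = ‖v (pt x θ)‖ * ‖f (pt x θ)‖ := by rw [hW, norm_mul, RCLike.norm_conj]
    have a5 : ‖c‖ / (2 * K) ≤ ‖W θ‖ := by
      rw [a4, div_le_iff₀ (by positivity)]
      have := norm_nonneg (f (pt x θ))
      nlinarith
    have a6 : |(W θ).im| ≤ ‖c‖ / (8 * K) := by
      rw [abs_mul, abs_two] at a1
      have : ‖c‖ / (4 * K) = 2 * (‖c‖ / (8 * K)) := by field_simp; norm_num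
      rw [this] at a1
      linarith
    have a7 : (W θ * W θ).re = ‖W θ‖ ^ 2 - 2 * |(W θ).im| ^ 2 := by
      rw [← normSq_eq_norm_sq, normSq_apply, sq_abs]; simp; ring
    have a8 : ‖c‖ / (8 * K) = (‖c‖ / (2 * K)) / 4 := by field_simp; norm_num
    rw [a7]
    have a9 : 0 < ‖c‖ / (2 * K) := by positivity
    have a10 : (‖c‖ / (2 * K)) ^ 2 ≤ ‖W θ‖ ^ 2 := by gcongr
    have a11 : |(W θ).im| ^ 2 ≤ ((‖c‖ / (2 * K)) / 4) ^ 2 := by rw [← a8]; gcongr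
    nlinarith
  have dl : ∀ θ, HasDerivAt (fun θ => Complex.log (W θ * W θ))
      ((W' θ * W θ + W θ * W' θ) / (W θ * W θ)) θ := fun θ => by
    have dWW : HasDerivAt (fun θ => W θ * W θ) (W' θ * W θ + W θ * W' θ) θ := (dW θ).mul (dW θ)
    exact dWW.clog_real (hslit θ)
  have hlog : ∫ θ in (0 : ℝ)..(2 * Real.pi), W' θ / W θ = 0 := by
    have e1 : ∫ θ in (0 : ℝ)..(2 * Real.pi), (W' θ * W θ + W θ * W' θ) / (W θ * W θ) = 0 := by
      have c1 : Continuous fun θ => (W' θ * W θ + W θ * W' θ) / (W θ * W θ) :=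
        ((cW'.mul cW).add (cW.mul cW')).div (cW.mul cW) fun θ => mul_ne_zero (hW0 θ) (hW0 θ)
      rw [intervalIntegral.integral_eq_sub_of_hasDerivAt
        (fun θ _ => dl θ) (c1.intervalIntegrable _ _)]
      have p1 := periodic_slice h.pv x 0
      have p2 := periodic_slice h.pf x 0
      simp only [zero_add] at p1 p2
      simp only [hW, p1, p2, sub_self]
    have e2 : ∀ θ, (W' θ * W θ + W θ * W' θ) / (W θ * W θ) = 2 * (W' θ / W θ) := fun θ => by
      have := hW0 θ
      field_simp; ring
    simp only [e2] at e1
    rw [intervalIntegral.integral_const_mul] at e1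
    simpa using e1
  have cq : Continuous fun θ => W' θ / W θ := cW'.div cW hW0
  have him : ∫ θ in (0 : ℝ)..(2 * Real.pi), (W' θ / W θ).im = 0 := by
    have e := imCLM.intervalIntegral_comp_comm (cq.intervalIntegrable (μ := volume) 0 (2 * Real.pi))
    simp only [imCLM_apply] at e
    rw [e, hlog, zero_im]
  have cw : Continuous fun θ => wedge (v (pt x θ)) (I * (f (pt x θ) - conj (g (pt x θ)))) := by
    simp only [wedge_eq_im]
    exact continuous_im.comp ((continuous_conj.comp cv).mul cvt)
  have cwn : Continuous fun θ => wedge (v (pt x θ)) (I * (f (pt x θ) - conj (g (pt x θ)))) /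
      ‖v (pt x θ)‖ ^ 2 :=
    cw.div (cv.norm.pow 2) fun θ => pow_ne_zero _ (norm_ne_zero_iff.2 (hv0 θ))
  have clf : Continuous fun θ => (I * deriv f (pt x θ) / f (pt x θ)).im :=
    continuous_im.comp (cf'.div cf hf0)
  have hsplit : ∫ θ in (0 : ℝ)..(2 * Real.pi), (I * deriv f (pt x θ) / f (pt x θ)).im =
      ∫ θ in (0 : ℝ)..(2 * Real.pi), wedge (v (pt x θ)) (I * (f (pt x θ) - conj (g (pt x θ)))) /
        ‖v (pt x θ)‖ ^ 2 := by
    rw [← sub_eq_zero, ← intervalIntegral.integral_sub (clf.intervalIntegrable _ _)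
      (cwn.intervalIntegrable _ _), ← him]
    congr 1
    ext θ
    exact (logDeriv_identity (hv0 θ) (hf0 θ)).symm
  rw [hsplit, ← intervalIntegral.integral_sub (cw.intervalIntegrable _ _)
    (cwn.intervalIntegrable _ _), dist_zero_right]
  have hbound := intervalIntegral.norm_integral_le_of_norm_le_const (a := (0 : ℝ))
    (b := 2 * Real.pi) (C := 24 * K * δ)
    (f := fun θ => wedge (v (pt x θ)) (I * (f (pt x θ) - conj (g (pt x θ)))) -
      wedge (v (pt x θ)) (I * (f (pt x θ) - conj (g (pt x θ)))) / ‖v (pt x θ)‖ ^ 2)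
    (fun θ _ => by
      have a3 := abs_le.1 (hnv θ)
      have a4 := h4 θ
      set s := ‖v (pt x θ)‖ with hs
      have b1 : |wedge (v (pt x θ)) (I * (f (pt x θ) - conj (g (pt x θ))))| ≤ 2 * K := by
        rw [wedge_eq_im]
        refine (abs_im_le_norm _).trans ?_
        rw [norm_mul, norm_mul, norm_I, one_mul, RCLike.norm_conj]
        have c1 := norm_sub_le (f (pt x θ)) (conj (g (pt x θ)))
        rw [RCLike.norm_conj] at c1
        have c2 := (h1 θ).trans (le_abs_self M)
        have c3 := (h2 θ).trans (le_abs_self M')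
        exact mul_le_mul (by linarith) (by linarith) (norm_nonneg _) (by norm_num)
      have hs0 : 0 < s := by linarith
      have b2 : wedge (v (pt x θ)) (I * (f (pt x θ) - conj (g (pt x θ)))) -
          wedge (v (pt x θ)) (I * (f (pt x θ) - conj (g (pt x θ)))) / s ^ 2 =
          wedge (v (pt x θ)) (I * (f (pt x θ) - conj (g (pt x θ)))) *
          ((s - 1) * ((s + 1) / s ^ 2)) := by
        field_simp; ring
      have b3 : (s + 1) / s ^ 2 ≤ 12 := by
        rw [div_le_iff₀ (by positivity)]; nlinarith
      rw [b2, Real.norm_eq_abs, abs_mul, abs_mul,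
        abs_of_nonneg (by positivity : 0 ≤ (s + 1) / s ^ 2)]
      calc _ ≤ 2 * K * (δ * 12) := by gcongr
        _ = _ := by ring)
  refine hbound.trans_lt ?_
  rw [sub_zero, abs_of_pos hpi]
  have hδle : δ ≤ ε / (400 * K) := min_le_right _ _
  calc 24 * K * δ * (2 * Real.pi) ≤ 24 * K * (ε / (400 * K)) * (2 * 4) := by
        gcongr; exact Real.pi_le_four
    _ = 192 / 400 * ε := by field_simp; norm_num
    _ < ε := by linarith

end EndData

/-- The reflection `ζ ↦ L - conj ζ`, which exchanges the two boundary lines of the strip and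
preserves `θ = Im ζ`. -/
noncomputable def refl (L : ℝ) (ζ : ℂ) : ℂ := L - conj ζ

lemma refl_pt (L x θ : ℝ) : refl L (pt x θ) = pt (L - x) θ := by
  simp [refl, pt]; ring

lemma refl_mem {L : ℝ} {ζ : ℂ} (h : ζ ∈ strip L) : refl L ζ ∈ strip L := by
  have h1 := h.1
  have h2 := h.2
  constructor <;> simp [refl] <;> linarith

/-- If the Hopf function `f g` is asymptotically real on both boundary lines, it is a real
constant. -/
lemma exists_hopf_const {L : ℝ} {F : ℂ → ℂ} (hL : L < 0) (hF : DifferentiableOn ℂ F (strip L))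
    (pF : Function.Periodic F (2 * Real.pi * I))
    (h₀ : ∀ ε > 0, ∀ᶠ x in 𝓝[<] (0 : ℝ), ∀ θ, |(F (pt x θ)).im| ≤ ε)
    (h₁ : ∀ ε > 0, ∀ᶠ x in 𝓝[<] (0 : ℝ), ∀ θ, |(F (pt (L - x) θ)).im| ≤ ε) :
    ∃ c : ℝ, ∀ ζ ∈ strip L, F ζ = c := by
  set a := laurent L F with ha
  have hcoef : ∀ x ∈ Ioo L 0, ∀ n ε, (∀ θ, |(F (pt x θ)).im| ≤ ε) →
      ‖a n * Complex.exp (n * x) - conj (a (-n)) * Complex.exp (-(n * x))‖ ≤ 2 * ε :=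
    fun x hx n ε hε => by
    have cF : Continuous fun θ => F (pt x θ) :=
      continuous_slice (continuousOn_slice hF.continuousOn) hx
    have cFc : Continuous fun θ => conj (F (pt x θ)) := continuous_conj.comp cF
    have e := fc_sub cF cFc n
    rw [fc_conj, fc_slice hF pF hx, fc_slice hF pF hx, map_mul, ← Complex.exp_conj] at e
    simp only [map_neg, map_mul, Complex.conj_ofReal, map_intCast, Int.cast_neg, neg_mul] at e
    rw [← e]
    refine norm_fc_le (fun θ => ?_) n
    rw [Complex.sub_conj, norm_mul, norm_I, mul_one, norm_real, Real.norm_eq_abs, abs_mul, abs_two]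
    linarith [hε θ]
  have hev : ∀ᶠ x in 𝓝[<] (0 : ℝ), x ∈ Ioo L 0 := Ioo_mem_nhdsLT hL
  -- vanishing of `Im F` on the two lines gives two relations between `a n` and `conj (a (-n))`
  have eq0 : ∀ n, a n - conj (a (-n)) = 0 := fun n => by
    have cont : Continuous fun x : ℝ => a n * Complex.exp (n * x) -
        conj (a (-n)) * Complex.exp (-(n * x)) := by fun_prop
    have l1 := (cont.tendsto 0).mono_left (nhdsWithin_le_nhds (s := Iio 0))
    simp only [ofReal_zero, mul_zero, neg_zero, Complex.exp_zero, mul_one] at l1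
    have l2 : Tendsto (fun x : ℝ => a n * Complex.exp (n * x) -
        conj (a (-n)) * Complex.exp (-(n * x))) (𝓝[<] 0) (𝓝 0) := by
      rw [Metric.tendsto_nhds]
      intro ε hε
      filter_upwards [h₀ (ε / 4) (by positivity), hev] with x h hx
      rw [dist_zero_right]
      linarith [hcoef x hx n _ h]
    exact tendsto_nhds_unique l1 l2
  have eq1 : ∀ n, a n * Complex.exp (n * L) - conj (a (-n)) * Complex.exp (-(n * L)) = 0 :=
    fun n => by
    have cont : Continuous fun x : ℝ => a n * Complex.exp (n * (L - x : ℝ)) -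
        conj (a (-n)) * Complex.exp (-(n * (L - x : ℝ))) := by fun_prop
    have l1 := (cont.tendsto 0).mono_left (nhdsWithin_le_nhds (s := Iio 0))
    simp only [sub_zero] at l1
    have l2 : Tendsto (fun x : ℝ => a n * Complex.exp (n * (L - x : ℝ)) -
        conj (a (-n)) * Complex.exp (-(n * (L - x : ℝ)))) (𝓝[<] 0) (𝓝 0) := by
      rw [Metric.tendsto_nhds]
      intro ε hε
      filter_upwards [h₁ (ε / 4) (by positivity), hev] with x h hx
      rw [dist_zero_right]
      linarith [hcoef (L - x) ⟨by linarith [hx.2], by linarith [hx.1]⟩ n _ h]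
    exact tendsto_nhds_unique l1 l2
  have hzero : ∀ n : ℤ, n ≠ 0 → a n = 0 := fun n hn => by
    have e1 := eq1 n
    rw [← sub_eq_zero.1 (eq0 n), ← mul_sub] at e1
    refine (mul_eq_zero.1 e1).resolve_right fun h => ?_
    have h2 := sub_eq_zero.1 h
    have h3 : Real.exp (n * L) = Real.exp (-(n * L)) := by exact_mod_cast h2
    have h4 := Real.exp_injective h3
    have h5 : (n : ℝ) * L ≠ 0 := mul_ne_zero (by exact_mod_cast hn) hL.ne
    exact h5 (by linarith)
  have hreal : a 0 = ((a 0).re : ℂ) := by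
    have := eq0 0
    rw [neg_zero] at this
    exact (Complex.conj_eq_iff_re.1 (sub_eq_zero.1 this).symm).symm
  refine ⟨(a 0).re, fun ζ hζ => ?_⟩
  have hx : ζ.re ∈ Ioo L 0 := hζ
  have cF : Continuous fun θ => F (pt ζ.re θ) :=
    continuous_slice (continuousOn_slice hF.continuousOn) hx
  have hs := hasSum_fc cF (periodic_slice pF ζ.re) (summable_fc_slice hF pF hx) ζ.im
  have hs0 := hasSum_single (f := fun n => fc (fun θ => F (pt ζ.re θ)) n * ex n ζ.im) 0
    (fun n hn => by rw [fc_slice hF pF hx]; simp only [← ha, hzero n hn, zero_mul])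
  have e := hs.unique hs0
  have ez : pt ζ.re ζ.im = ζ := by simp [pt, Complex.re_add_im]
  rw [ez] at e
  rw [e, fc_slice hF pF hx, ex_zero, ← ha, ← hreal]
  simp

/-- The mean of the logarithmic derivative does not depend on the circle. -/
lemma integral_logDeriv_const {L : ℝ} {f : ℂ → ℂ} (hf : DifferentiableOn ℂ f (strip L))
    (pf : Function.Periodic f (2 * Real.pi * I)) (h0 : ∀ ζ ∈ strip L, f ζ ≠ 0) :
    ∃ K : ℝ, ∀ x ∈ Ioo L 0,
      ∫ θ in (0 : ℝ)..(2 * Real.pi), (I * deriv f (pt x θ) / f (pt x θ)).im = K := by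
  set q : ℂ → ℂ := fun ζ => I * deriv f ζ / f ζ with hq
  have dq : DifferentiableOn ℂ q (strip L) := ((differentiableOn_deriv hf).const_mul I).div hf h0
  have pd : Function.Periodic (deriv f) (2 * Real.pi * I) := fun ζ => by
    have e : (fun z => f (z + 2 * Real.pi * I)) = f := funext pf
    rw [← deriv_comp_add_const, e]
  have pq : Function.Periodic q (2 * Real.pi * I) := fun ζ => by simp only [hq, pf ζ, pd ζ]
  refine ⟨(2 * Real.pi * laurent L q 0).im, fun x hx => ?_⟩
  have cq : Continuous fun θ => q (pt x θ) :=
    continuous_slice (continuousOn_slice dq.continuousOn) hx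
  have e1 := imCLM.intervalIntegral_comp_comm (cq.intervalIntegrable (μ := volume) 0 (2 * Real.pi))
  simp only [imCLM_apply] at e1
  have e2 := integral_ex_mul (fun θ => q (pt x θ)) 0
  simp only [neg_zero, ex_zero, one_mul] at e2
  rw [fc_slice dq pq hx, Int.cast_zero, zero_mul, Complex.exp_zero, mul_one] at e2
  rw [e1, e2]

/-- The two degrees agree when the Hopf function is a nonzero constant. -/
lemma degree_eq_of_hopf_ne_zero {L : ℝ} {v f g : ℂ → ℂ} {c : ℂ} (h : EndData L v f g)
    (h' : EndData L (fun ζ => v (refl L ζ)) (fun ζ => -conj (g (refl L ζ)))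
      (fun ζ => -conj (f (refl L ζ)))) (hc : c ≠ 0) (hF : ∀ ζ ∈ strip L, f ζ * g ζ = c)
    {go gi : ℝ → ℂ} {p q : ℤ} (mo : MemLp go 2 angleMeasure) (mi : MemLp gi 2 angleMeasure)
    (hp : HasDegree go p) (hq : HasDegree gi q)
    (ho : Tendsto (fun x => eLpNorm (fun θ => v (pt x θ) - go θ) 2 angleMeasure) (𝓝[<] 0) (𝓝 0))
    (hi : Tendsto (fun x => eLpNorm (fun θ => v (pt (L - x) θ) - gi θ) 2 angleMeasure)
      (𝓝[<] 0) (𝓝 0)) : p = q := by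
  have hf0 : ∀ ζ ∈ strip L, f ζ ≠ 0 := fun ζ hζ h0 => hc (by rw [← hF ζ hζ, h0, zero_mul])
  have hg0 : ∀ ζ ∈ strip L, g ζ ≠ 0 := fun ζ hζ h0 => hc (by rw [← hF ζ hζ, h0, mul_zero])
  have deg : ∀ {v f g : ℂ → ℂ} (h : EndData L v f g) {go : ℝ → ℂ} {p : ℤ}
      (mo : MemLp go 2 angleMeasure) (hp : HasDegree go p)
      (ho : Tendsto (fun x => eLpNorm (fun θ => v (pt x θ) - go θ) 2 angleMeasure)
        (𝓝[<] 0) (𝓝 0)) (hF : ∃ c, c ≠ 0 ∧ ∀ ζ ∈ strip L, f ζ * g ζ = c) (K : ℝ)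
      (hK : ∀ x ∈ Ioo L 0,
        ∫ θ in (0 : ℝ)..(2 * Real.pi), (I * deriv f (pt x θ) / f (pt x θ)).im = K),
      2 * Real.pi * p = K := by
    rintro v f g h go p mo hp ho ⟨c, hc, hF⟩ K hK
    obtain ⟨B, hB0, hB⟩ := h.exists_fc_v_le
    have l1 := HasDegree.tendsto_integral (φ := fun x θ => v (pt x θ))
      (φ' := fun x θ => I * (f (pt x θ) - conj (g (pt x θ)))) (B := B) mo hp
      (by
        filter_upwards [hB, h.eventually_mem] with x hx hxL
        refine ⟨h.hvt x hxL, continuous_const.mul ((h.continuous_f hxL).sub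
          (continuous_conj.comp (h.continuous_g hxL))), ?_, hx⟩
        have := periodic_slice h.pv x 0
        rwa [zero_add] at this) ho
    have l2 := l1.sub (h.tendsto_integral_wedge hc hF)
    rw [sub_zero] at l2
    refine tendsto_nhds_unique (l2.congr' ?_) tendsto_const_nhds
    filter_upwards [h.eventually_mem] with x hx
    rw [sub_sub_cancel, hK x hx]
  obtain ⟨K, hK⟩ := integral_logDeriv_const h.hf h.pf hf0
  have e1 := deg h mo hp ho ⟨c, hc, hF⟩ K hK
  have e2 := deg h' mi hq (by simpa only [refl_pt] using hi)
    ⟨conj c, (map_ne_zero _).2 hc, fun ζ hζ => by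
      rw [← hF _ (refl_mem hζ), map_mul]; ring⟩ K (fun x hx => by
      have hx' : L - x ∈ Ioo L 0 := ⟨by linarith [hx.2], by linarith [hx.1]⟩
      rw [← hK (L - x) hx']
      congr 1
      ext θ
      have hm : pt (L - x) θ ∈ strip L := pt_mem hx' θ
      -- the reflected `f` is `-conj g`, and `g = c / f` winds opposite to `f`
      have d1 : I * deriv (fun ζ => -conj (g (refl L ζ))) (pt x θ) =
          -conj (I * deriv g (pt (L - x) θ)) := by
        have a1 := hasDerivAt_slice_right h'.hf hx θ
        have a2 := (hasDerivAt_conj (hasDerivAt_slice_right h.hg hx' θ)).neg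
        simp only [refl_pt] at a1
        exact a1.unique a2
      have d2 : deriv f (pt (L - x) θ) * g (pt (L - x) θ) +
          f (pt (L - x) θ) * deriv g (pt (L - x) θ) = 0 := by
        have nh := (isOpen_strip L).mem_nhds hm
        have a1 := (h.hf.differentiableAt nh).hasDerivAt.mul (h.hg.differentiableAt nh).hasDerivAt
        have a2 : HasDerivAt (f * g) 0 (pt (L - x) θ) :=
          (hasDerivAt_const _ c).congr_of_eventuallyEq
            (Filter.eventuallyEq_of_mem nh fun ζ hζ => hF ζ hζ)
        exact a1.unique a2
      rw [d1, refl_pt, neg_div_neg_eq, ← map_div₀, conj_im, ← neg_im]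
      congr 1
      have := hf0 _ hm
      have := hg0 _ hm
      field_simp
      linear_combination -d2)
  have e3 : (p : ℝ) = q := by
    have := Real.two_pi_pos
    have e : 2 * Real.pi * (p : ℝ) = 2 * Real.pi * q := by rw [e1, e2]
    exact mul_left_cancel₀ this.ne' e
  exact_mod_cast e3

/-! ### From the annulus to the strip -/

lemma exp_mem_annulus {ϱ : ℝ} (hϱ : 0 < ϱ) {ζ : ℂ} (hζ : ζ ∈ strip (Real.log ϱ)) :
    Complex.exp ζ ∈ annulus ϱ := by
  rw [annulus, mem_ofPred_eq, Complex.norm_exp]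
  exact ⟨(Real.log_lt_iff_lt_exp hϱ).1 hζ.1, Real.exp_lt_one_iff.2 hζ.2⟩

lemma log_mem_strip {ϱ : ℝ} (hϱ : 0 < ϱ) {z : ℂ} (hz : z ∈ annulus ϱ) :
    Complex.log z ∈ strip (Real.log ϱ) := by
  have h0 : 0 < ‖z‖ := hϱ.trans hz.1
  rw [strip, mem_ofPred_eq, Complex.log_re]
  exact ⟨Real.log_lt_log hϱ hz.1, Real.log_neg h0 hz.2⟩

lemma ne_zero_of_mem_annulus {ϱ : ℝ} (hϱ : 0 < ϱ) {z : ℂ} (hz : z ∈ annulus ϱ) : z ≠ 0 :=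
  norm_pos_iff.1 (hϱ.trans hz.1)

lemma isOpen_annulus (ϱ : ℝ) : IsOpen (annulus ϱ) :=
  (isOpen_lt continuous_const continuous_norm).inter (isOpen_lt continuous_norm continuous_const)

/-- One period `{L < Re ζ < 0, 0 < Im ζ ≤ 2π}` of the strip. -/
def period (L : ℝ) : Set ℂ := {ζ | ζ.re ∈ Ioo L 0 ∧ ζ.im ∈ Ioc 0 (2 * Real.pi)}

lemma measurableSet_period (L : ℝ) : MeasurableSet (period L) :=
  (measurable_re measurableSet_Ioo).inter (measurable_im measurableSet_Ioc)

lemma exp_image_period {ϱ : ℝ} (hϱ : 0 < ϱ) :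
    Complex.exp '' period (Real.log ϱ) = annulus ϱ := by
  ext z
  constructor
  · rintro ⟨ζ, hζ, rfl⟩
    exact exp_mem_annulus hϱ hζ.1
  · intro hz
    have h0 := ne_zero_of_mem_annulus hϱ hz
    have hs := log_mem_strip hϱ hz
    have h1 := Complex.neg_pi_lt_arg z
    have h2 := Complex.arg_le_pi z
    have hpi := Real.pi_pos
    rcases lt_or_ge 0 (arg z) with h | h
    · refine ⟨Complex.log z, ⟨hs, ?_⟩, Complex.exp_log h0⟩
      rw [Complex.log_im]
      exact ⟨h, by linarith⟩
    · refine ⟨Complex.log z + 2 * Real.pi * I, ⟨?_, ?_⟩, ?_⟩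
      · have : (Complex.log z + 2 * Real.pi * I).re = (Complex.log z).re := by simp
        rw [this]
        exact hs
      · have : (Complex.log z + 2 * Real.pi * I).im = arg z + 2 * Real.pi := by
          simp [Complex.log_im]
        rw [this]
        exact ⟨by linarith, by linarith⟩
      · rw [Complex.exp_add, Complex.exp_two_pi_mul_I, mul_one, Complex.exp_log h0]

lemma injOn_exp_period (L : ℝ) : InjOn Complex.exp (period L) := by
  intro a ha b hb hab
  obtain ⟨n, hn⟩ := Complex.exp_eq_exp_iff_exists_int.1 hab
  have him : a.im = b.im + n * (2 * Real.pi) := by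
    have := congrArg Complex.im hn; simpa using this
  have hpi := Real.two_pi_pos
  have h1 := ha.2; have h2 := hb.2
  have hlt : |(n : ℝ)| < 1 := by
    rw [abs_lt]
    constructor
    · by_contra! hc
      nlinarith [h1.1, h1.2, h2.1, h2.2]
    · by_contra! hc
      nlinarith [h1.1, h1.2, h2.1, h2.2]
  have hn0 : n = 0 := Int.abs_lt_one_iff.1 (by exact_mod_cast hlt)
  rw [hn, hn0]; simp

lemma period_integrable_iff {L : ℝ} (φ : ℂ → ℝ) : IntegrableOn φ (period L) ↔
    Integrable (fun p : ℝ × ℝ => φ (pt p.1 p.2))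
      ((volume.restrict (Ioo L 0)).prod (volume.restrict (Ioc 0 (2 * Real.pi)))) := by
  rw [Measure.prod_restrict, ← Measure.volume_eq_prod]
  have := (Complex.volume_preserving_equiv_real_prod.symm).integrableOn_comp_preimage
    (f := φ) (s := period L) measurableEquivRealProd.symm.measurableEmbedding
  rw [← this]
  have e : (measurableEquivRealProd.symm ⁻¹' period L) = Ioo L 0 ×ˢ Ioc 0 (2 * Real.pi) := by
    ext p; simp [period, measurableEquivRealProd_symm_apply]
  rw [e]
  have e2 : (φ ∘ measurableEquivRealProd.symm) = fun p : ℝ × ℝ => φ (pt p.1 p.2) := by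
    funext p; simp only [Function.comp_apply]; congr 1
    apply Complex.ext <;> simp [pt, measurableEquivRealProd_symm_apply]
  rw [e2]; rfl

lemma period_integral {L : ℝ} (φ : ℂ → ℝ) : ∫ ζ in period L, φ ζ =
    ∫ p : ℝ × ℝ, φ (pt p.1 p.2)
      ∂((volume.restrict (Ioo L 0)).prod (volume.restrict (Ioc 0 (2 * Real.pi)))) := by
  rw [Measure.prod_restrict, ← Measure.volume_eq_prod]
  rw [← (Complex.volume_preserving_equiv_real_prod.symm).setIntegral_preimage_emb
    measurableEquivRealProd.symm.measurableEmbedding φ (period L)]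
  have e : (measurableEquivRealProd.symm ⁻¹' period L) = Ioo L 0 ×ˢ Ioc 0 (2 * Real.pi) := by
    ext p; simp [period, measurableEquivRealProd_symm_apply]
  rw [e]
  refine integral_congr_ae (ae_of_all _ fun p => ?_)
  simp only
  congr 1
  apply Complex.ext <;> simp [pt, measurableEquivRealProd_symm_apply]

/-- Integration over the annulus in logarithmic polar coordinates `z = e^{x + iθ}`. -/
lemma annulus_change_of_variables {ϱ : ℝ} (hϱ : 0 < ϱ) (hϱ1 : ϱ < 1) {φ : ℂ → ℝ}
    (hφ : IntegrableOn φ (annulus ϱ)) :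
    IntegrableOn (fun x => ∫ θ in (0 : ℝ)..(2 * Real.pi),
      Real.exp x ^ 2 * φ (Complex.exp (pt x θ))) (Ioo (Real.log ϱ) 0) ∧
    ∫ z in annulus ϱ, φ z = ∫ x in (Real.log ϱ)..0, ∫ θ in (0 : ℝ)..(2 * Real.pi),
      Real.exp x ^ 2 * φ (Complex.exp (pt x θ)) := by
  set L := Real.log ϱ with hL
  have hL0 : L < 0 := Real.log_neg hϱ hϱ1
  set D : ℂ → ℂ →L[ℝ] ℂ := fun ζ =>
    (ContinuousLinearMap.toSpanSingleton ℂ (Complex.exp ζ)).restrictScalars ℝ with hD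
  have hder : ∀ ζ ∈ period L, HasFDerivWithinAt Complex.exp (D ζ) (period L) ζ := fun ζ _ =>
    ((Complex.hasDerivAt_exp ζ).hasFDerivAt.restrictScalars ℝ).hasFDerivWithinAt
  have hdet : ∀ ζ, |(D ζ).det| = Real.exp ζ.re ^ 2 := fun ζ => by
    have : (D ζ).det = ‖Complex.exp ζ‖ ^ 2 := by
      simp [hD, ContinuousLinearMap.det, LinearMap.det_restrictScalars, Algebra.norm_complex_eq,
        Complex.normSq_eq_norm_sq]
    rw [this, abs_of_nonneg (sq_nonneg _), Complex.norm_exp]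
  have h1 := hφ
  rw [← exp_image_period hϱ, integrableOn_image_iff_integrableOn_abs_det_fderiv_smul volume
    (measurableSet_period L) hder (injOn_exp_period L)] at h1
  have h2 := integral_image_eq_integral_abs_det_fderiv_smul volume
    (measurableSet_period L) hder (injOn_exp_period L) φ
  rw [exp_image_period hϱ] at h2
  simp only [hdet, smul_eq_mul] at h1 h2
  rw [period_integrable_iff] at h1
  rw [period_integral, integral_prod _ h1] at h2
  have h3 := h1.integral_prod_left
  simp only [pt_re] at h2 h3
  simp only [intervalIntegral.integral_of_le Real.two_pi_pos.le,
    intervalIntegral.integral_of_le hL0.le]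
  rw [integral_Ioc_eq_integral_Ioo (x := L)]
  exact ⟨h3, h2⟩

/-! ### Wirtinger derivatives of harmonic maps -/

lemma fderiv_apply_eq (u : ℂ → ℂ) (z w : ℂ) :
    fderiv ℝ u z w = dz u z * w + dzbar u z * conj w := by
  have : w = w.re • (1 : ℂ) + w.im • I := by simp
  conv_lhs => rw [this, map_add, map_smul, map_smul]
  have h1 : conj w = w.re - w.im * I := by apply Complex.ext <;> simp
  rw [h1, Complex.real_smul, Complex.real_smul, dz, dzbar]
  conv_rhs => rw [← Complex.re_add_im w]
  simp only [add_re, add_im, ofReal_re, ofReal_im, mul_re, mul_im, I_re, I_im, mul_zero, mul_one,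
    sub_zero, add_zero, zero_add]
  simp only [dx, dy]
  linear_combination (w.im * fderiv ℝ u z I) * I_sq

/-- For harmonic `u`, both `∂_z u` and the conjugate of `∂_z̄ u` are holomorphic. -/
lemma differentiableAt_dz_conj_dzbar {u : ℂ → ℂ} {s : Set ℂ} (hs : IsOpen s)
    (hu : InnerProductSpace.HarmonicOnNhd u s) {z : ℂ} (hz : z ∈ s) :
    DifferentiableAt ℂ (dz u) z ∧ DifferentiableAt ℂ (fun z => conj (dzbar u z)) z := by
  have hd : ∀ w ∈ s, DifferentiableAt ℝ u w := fun w hw =>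
    (hu w hw).1.differentiableAt (by norm_num)
  have h1 := HarmonicAt.differentiableAt_complex_partial ((hu z hz).comp_CLM reCLM)
  have h2 := HarmonicAt.differentiableAt_complex_partial ((hu z hz).comp_CLM imCLM)
  have e : ∀ (l : ℂ →L[ℝ] ℝ), ∀ w ∈ s, ∀ a, fderiv ℝ (⇑l ∘ u) w a = l (fderiv ℝ u w a) :=
    fun l w hw a => by
    rw [fderiv_comp w l.differentiableAt (hd w hw), l.fderiv]
    rfl
  have nh := hs.mem_nhds hz
  constructor
  · refine (((h1.add (h2.const_mul I)).const_mul (1 / 2 : ℂ))).congr_of_eventuallyEq ?_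
    filter_upwards [nh] with w hw
    simp only [Pi.add_apply, e reCLM w hw, e imCLM w hw, reCLM_apply, imCLM_apply, dz, dx, dy]
    conv_lhs => rw [← Complex.re_add_im (fderiv ℝ u w 1), ← Complex.re_add_im (fderiv ℝ u w I)]
    ring
  · refine ((h1.sub (h2.const_mul I)).div_const (2 : ℂ)).congr_of_eventuallyEq ?_
    filter_upwards [nh] with w hw
    simp only [Pi.sub_apply, e reCLM w hw, e imCLM w hw, reCLM_apply, imCLM_apply, dzbar, dx, dy]
    rw [map_div₀, Complex.conj_ofNat]
    congr 1
    apply Complex.ext <;> simp <;> ring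

/-! ### The strip map of a solution -/

/-- Reflection turns the inner boundary line into the line `Re ζ = 0`. -/
lemma StripMap.reflect {L : ℝ} {v f g : ℂ → ℂ} (h : StripMap L v f g) :
    StripMap L (fun ζ => v (refl L ζ)) (fun ζ => -conj (g (refl L ζ)))
      (fun ζ => -conj (f (refl L ζ))) := by
  have hx' : ∀ {x}, x ∈ Ioo L 0 → L - x ∈ Ioo L 0 := fun hx =>
    ⟨by linarith [hx.2], by linarith [hx.1]⟩
  have per : ∀ {F : ℂ → ℂ}, Function.Periodic F (2 * Real.pi * I) →
      Function.Periodic (fun ζ => F (refl L ζ)) (2 * Real.pi * I) := fun {F} pF ζ => by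
    have : refl L (ζ + 2 * Real.pi * I) = refl L ζ + 2 * Real.pi * I := by
      simp [refl, Complex.conj_ofNat]; ring
    simp only [this]
    exact pF _
  have hol : ∀ {F : ℂ → ℂ}, DifferentiableOn ℂ F (strip L) →
      DifferentiableOn ℂ (fun ζ => -conj (F (refl L ζ))) (strip L) := fun {F} hF ζ hζ => by
    have h1 : DifferentiableAt ℂ F (refl L ζ) :=
      hF.differentiableAt ((isOpen_strip L).mem_nhds (refl_mem hζ))
    have h2 : DifferentiableAt ℂ (fun w => F (L - w)) (conj ζ) :=
      DifferentiableAt.comp (conj ζ) (f := fun w => (L : ℂ) - w) h1 (by fun_prop)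
    have h3 := h2.conj_conj
    simp only [RingHomCompTriple.comp_apply, RingHom.id_apply] at h3
    exact h3.neg.differentiableWithinAt
  have crefl : Continuous (refl L) := by
    unfold refl; exact continuous_const.sub continuous_conj
  refine ⟨h.neg, hol h.hg, hol h.hf, ?_, ?_, per h.pv, ?_, ?_, ?_, ?_⟩
  · intro ζ
    have := per h.pg ζ
    simp only at this
    simp only [this]
  · intro ζ
    have := per h.pf ζ
    simp only at this
    simp only [this]
  · exact h.cv.comp crefl.continuousOn fun ζ hζ => refl_mem hζ
  · intro x hx θ
    have h1 := HasDerivAt.scomp x (h.hvx (L - x) (hx' hx) θ) ((hasDerivAt_id x).const_sub L)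
    simp only [refl_pt]
    have e : -conj (g (pt (L - x) θ)) + conj (-conj (f (pt (L - x) θ))) =
        (-1 : ℝ) • (f (pt (L - x) θ) + conj (g (pt (L - x) θ))) := by
      simp; ring
    rw [e]
    exact h1
  · intro x hx θ
    have h1 := h.hvt (L - x) (hx' hx) θ
    simp only [refl_pt]
    have e : I * (-conj (g (pt (L - x) θ)) - conj (-conj (f (pt (L - x) θ)))) =
        I * (f (pt (L - x) θ) - conj (g (pt (L - x) θ))) := by
      simp; ring
    rw [e]
    exact h1
  · have h1 := h.energy
    rw [← intervalIntegrable_iff_integrableOn_Ioo_of_le h.neg.le] at h1 ⊢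
    have h2 := (h1.comp_sub_left L).symm
    rw [sub_self, sub_zero] at h2
    simpa only [refl_pt, norm_neg, RCLike.norm_conj, add_comm] using h2

lemma norm_dz_le (u : ℂ → ℂ) (z : ℂ) : ‖dz u z‖ ≤ ‖fderiv ℝ u z‖ := by
  have h1 : ‖dx u z‖ ≤ ‖fderiv ℝ u z‖ := by
    have := (fderiv ℝ u z).le_opNorm 1; simpa [dx] using this
  have h2 : ‖dy u z‖ ≤ ‖fderiv ℝ u z‖ := by
    have := (fderiv ℝ u z).le_opNorm I; simpa [dy] using this
  rw [dz, norm_div, Complex.norm_ofNat]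
  have := norm_sub_le (dx u z) (I * dy u z)
  rw [norm_mul, norm_I, one_mul] at this
  linarith

lemma norm_dzbar_le (u : ℂ → ℂ) (z : ℂ) : ‖dzbar u z‖ ≤ ‖fderiv ℝ u z‖ := by
  have h1 : ‖dx u z‖ ≤ ‖fderiv ℝ u z‖ := by
    have := (fderiv ℝ u z).le_opNorm 1; simpa [dx] using this
  have h2 : ‖dy u z‖ ≤ ‖fderiv ℝ u z‖ := by
    have := (fderiv ℝ u z).le_opNorm I; simpa [dy] using this
  rw [dzbar, norm_div, Complex.norm_ofNat]
  have := norm_add_le (dx u z) (I * dy u z)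
  rw [norm_mul, norm_I, one_mul] at this
  linarith

/-- The map `u` in the logarithmic coordinate, `ζ ↦ u (e^ζ)`. -/
noncomputable def logV (u : ℂ → ℂ) : ℂ → ℂ := fun ζ => u (Complex.exp ζ)

/-- The derivative `∂_ζ (u (e^ζ)) = e^ζ ∂_z u (e^ζ)`. -/
noncomputable def logF (u : ℂ → ℂ) : ℂ → ℂ := fun ζ => Complex.exp ζ * dz u (Complex.exp ζ)

/-- The conjugate of the derivative `∂_ζ̄ (u (e^ζ))`. -/
noncomputable def logG (u : ℂ → ℂ) : ℂ → ℂ :=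
  fun ζ => Complex.exp ζ * conj (dzbar u (Complex.exp ζ))

/-- A solution in logarithmic coordinates. The Hopf coefficient satisfies `z² H_u(z) = f g`. -/
lemma IsSolution.stripMap {ϱ : ℝ} (hϱ0 : 0 < ϱ) (hϱ1 : ϱ < 1) {p q : ℤ} {u : ℂ → ℂ}
    (hu : IsSolution ϱ p q u) :
    StripMap (Real.log ϱ) (logV u) (logF u) (logG u) := by
  unfold logV logF logG
  have hmaps : MapsTo Complex.exp (strip (Real.log ϱ)) (annulus ϱ) := fun ζ hζ =>
    exp_mem_annulus hϱ0 hζ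
  have hol : ∀ z ∈ annulus ϱ, DifferentiableAt ℂ (dz u) z ∧
      DifferentiableAt ℂ (fun z => conj (dzbar u z)) z := fun z hz =>
    differentiableAt_dz_conj_dzbar (isOpen_annulus ϱ) hu.harmonic hz
  have d1 : DifferentiableOn ℂ (dz u) (annulus ϱ) := fun z hz =>
    (hol z hz).1.differentiableWithinAt
  have d2 : DifferentiableOn ℂ (fun z => conj (dzbar u z)) (annulus ϱ) := fun z hz =>
    (hol z hz).2.differentiableWithinAt
  have hd : ∀ z ∈ annulus ϱ, HasFDerivAt u (fderiv ℝ u z) z := fun z hz =>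
    ((hu.harmonic z hz).1.differentiableAt (by norm_num)).hasFDerivAt
  have hexp : ∀ ζ : ℂ, Complex.exp (ζ + 2 * Real.pi * I) = Complex.exp ζ := Complex.exp_periodic
  refine ⟨Real.log_neg hϱ0 hϱ1, ?_, ?_, ?_, ?_, ?_, ?_, ?_, ?_, ?_⟩
  · exact Complex.differentiable_exp.differentiableOn.mul
      (d1.comp Complex.differentiable_exp.differentiableOn hmaps)
  · exact Complex.differentiable_exp.differentiableOn.mul
      (d2.comp Complex.differentiable_exp.differentiableOn hmaps)
  · intro ζ; simp only [hexp]
  · intro ζ; simp only [hexp]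
  · intro ζ; simp only [hexp]
  · exact hu.memClass.1.contDiffOn.continuousOn.comp Complex.continuous_exp.continuousOn hmaps
  · intro x hx θ
    have h1 := (hd _ (hmaps (pt_mem hx θ))).comp_hasDerivAt x (hasDerivAt_pt_left x θ).cexp
    rw [fderiv_apply_eq] at h1
    have e : Complex.exp (pt x θ) * dz u (Complex.exp (pt x θ)) +
        conj (Complex.exp (pt x θ) * conj (dzbar u (Complex.exp (pt x θ)))) =
        dz u (Complex.exp (pt x θ)) * (Complex.exp (pt x θ) * 1) +
        dzbar u (Complex.exp (pt x θ)) * conj (Complex.exp (pt x θ) * 1) := by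
      simp; ring
    rw [e]
    exact h1
  · intro x hx θ
    have h1 := (hd _ (hmaps (pt_mem hx θ))).comp_hasDerivAt θ (hasDerivAt_pt_right x θ).cexp
    rw [fderiv_apply_eq] at h1
    have e : I * (Complex.exp (pt x θ) * dz u (Complex.exp (pt x θ)) -
        conj (Complex.exp (pt x θ) * conj (dzbar u (Complex.exp (pt x θ))))) =
        dz u (Complex.exp (pt x θ)) * (Complex.exp (pt x θ) * I) +
        dzbar u (Complex.exp (pt x θ)) * conj (Complex.exp (pt x θ) * I) := by
      simp; ring
    rw [e]
    exact h1
  · have hint : IntegrableOn (fun z => ‖dz u z‖ ^ 2 + ‖dzbar u z‖ ^ 2) (annulus ϱ) := by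
      have i1 : IntegrableOn (fun z => 2 * ‖fderiv ℝ u z‖ ^ 2) (annulus ϱ) :=
        (hu.memClass.1.memLp_fderiv.integrable_norm_pow (by norm_num)).const_mul 2
      have c1 : ContinuousOn (fun z => ‖dz u z‖ ^ 2 + ‖conj (dzbar u z)‖ ^ 2) (annulus ϱ) :=
        (d1.continuousOn.norm.pow 2).add (d2.continuousOn.norm.pow 2)
      simp only [RCLike.norm_conj] at c1
      refine i1.mono' (c1.aestronglyMeasurable (isOpen_annulus ϱ).measurableSet)
        (ae_of_all _ fun z => ?_)
      rw [Real.norm_of_nonneg (by positivity)]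
      have a1 : ‖dz u z‖ ^ 2 ≤ ‖fderiv ℝ u z‖ ^ 2 := by gcongr; exact norm_dz_le u z
      have a2 : ‖dzbar u z‖ ^ 2 ≤ ‖fderiv ℝ u z‖ ^ 2 := by gcongr; exact norm_dzbar_le u z
      linarith
    have h1 := (annulus_change_of_variables hϱ0 hϱ1 hint).1
    refine h1.congr_fun (fun x _ => ?_) measurableSet_Ioo
    simp only
    congr 1
    ext θ
    rw [norm_mul, norm_mul, RCLike.norm_conj, Complex.norm_exp, pt_re]
    ring

/-! ### The flux through circles -/

/-- The conservation law `div (v ∧ ∇v) = 0` in terms of `a = v`, `b = f`, `c = g`, `d = f'`,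
`e = g'`. -/
lemma conservation_identity (a b c d e : ℂ) :
    (conj (b + conj c) * (b + conj c) + conj a * (d + conj e)).im =
      -(conj (I * (b - conj c)) * (I * (b - conj c)) + conj a * (I * (I * d - conj (I * e)))).im := by
  simp; ring

namespace StripMap

variable {L : ℝ} {v f g : ℂ → ℂ}

/-- The normal component `v ∧ ∂ₓ v` of the current `v ∧ ∇v`. -/
noncomputable def normalCurrent (v f g : ℂ → ℂ) (x θ : ℝ) : ℝ :=
  (conj (v (pt x θ)) * (f (pt x θ) + conj (g (pt x θ)))).im

/-- The tangential component `v ∧ ∂_θ v` of the current `v ∧ ∇v`. -/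
noncomputable def tangentCurrent (v f g : ℂ → ℂ) (x θ : ℝ) : ℝ :=
  (conj (v (pt x θ)) * (I * (f (pt x θ) - conj (g (pt x θ))))).im

lemma continuousOn_normalCurrent (h : StripMap L v f g) :
    ContinuousOn (Function.uncurry (normalCurrent v f g)) (Ioo L 0 ×ˢ univ) :=
  continuousOn_slice (F := fun ζ => (conj (v ζ) * (f ζ + conj (g ζ))).im)
    (continuous_im.comp_continuousOn ((continuous_conj.comp_continuousOn h.cv).mul
      (h.hf.continuousOn.add (continuous_conj.comp_continuousOn h.hg.continuousOn))))

lemma continuousOn_tangentCurrent (h : StripMap L v f g) :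
    ContinuousOn (Function.uncurry (tangentCurrent v f g)) (Ioo L 0 ×ˢ univ) :=
  continuousOn_slice (F := fun ζ => (conj (v ζ) * (I * (f ζ - conj (g ζ)))).im)
    (continuous_im.comp_continuousOn ((continuous_conj.comp_continuousOn h.cv).mul
      (continuousOn_const.mul
        (h.hf.continuousOn.sub (continuous_conj.comp_continuousOn h.hg.continuousOn)))))

/-- The flux of the current weighted by a test function `ψ`: its derivative in `x` is the integral
of `(v ∧ ∇v) · ∇ψ` over the circle. -/
lemma hasDerivAt_flux (h : StripMap L v f g) {ψ ψx ψt : ℝ → ℝ → ℝ}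
    (cψ : ∀ x, Continuous (ψ x)) (cψ' : Continuous (Function.uncurry ψ))
    (cψx : Continuous (Function.uncurry ψx))
    (cψt : Continuous (Function.uncurry ψt))
    (hx : ∀ x θ, HasDerivAt (fun t => ψ t θ) (ψx x θ) x)
    (ht : ∀ x θ, HasDerivAt (ψ x) (ψt x θ) θ) (pψ : ∀ x, ψ x (2 * Real.pi) = ψ x 0)
    {x : ℝ} (hxL : x ∈ Ioo L 0) :
    HasDerivAt (fun x => ∫ θ in (0 : ℝ)..(2 * Real.pi), normalCurrent v f g x θ * ψ x θ)
      (∫ θ in (0 : ℝ)..(2 * Real.pi), (normalCurrent v f g x θ * ψx x θ +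
        tangentCurrent v f g x θ * ψt x θ)) x := by
  set N : ℝ → ℝ → ℝ := fun x θ => (conj (f (pt x θ) + conj (g (pt x θ))) *
    (f (pt x θ) + conj (g (pt x θ))) +
    conj (v (pt x θ)) * (deriv f (pt x θ) + conj (deriv g (pt x θ)))).im with hN
  have cN : ContinuousOn (Function.uncurry N) (Ioo L 0 ×ˢ univ) := by
    have c1 := h.hf.continuousOn.add (continuous_conj.comp_continuousOn h.hg.continuousOn)
    exact continuousOn_slice (F := fun ζ => (conj (f ζ + conj (g ζ)) * (f ζ + conj (g ζ)) +
      conj (v ζ) * (deriv f ζ + conj (deriv g ζ))).im)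
      (continuous_im.comp_continuousOn (((continuous_conj.comp_continuousOn c1).mul c1).add
        ((continuous_conj.comp_continuousOn h.cv).mul
        ((differentiableOn_deriv h.hf).continuousOn.add
          (continuous_conj.comp_continuousOn (differentiableOn_deriv h.hg).continuousOn)))))
  have dN : ∀ y ∈ Ioo L 0, ∀ θ, HasDerivAt (fun t => normalCurrent v f g t θ) (N y θ) y :=
    fun y hy θ => hasDerivAt_im ((hasDerivAt_conj (h.hvx y hy θ)).mul
      ((hasDerivAt_slice_left h.hf hy θ).add (hasDerivAt_conj (hasDerivAt_slice_left h.hg hy θ))))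
  have dT : ∀ θ, HasDerivAt (tangentCurrent v f g x) (-N x θ) θ := fun θ => by
    have h1 := hasDerivAt_im ((hasDerivAt_conj (h.hvt x hxL θ)).mul
      (((hasDerivAt_slice_right h.hf hxL θ).sub
        (hasDerivAt_conj (hasDerivAt_slice_right h.hg hxL θ))).const_mul I))
    simp only [hN, conservation_identity, neg_neg]
    exact h1
  have cn := h.continuousOn_normalCurrent
  have cn' : ∀ y ∈ Ioo L 0, Continuous (normalCurrent v f g y) := fun y hy => continuous_slice cn hy
  have main := hasDerivAt_integral 0 (2 * Real.pi)
    (φ := fun x θ => normalCurrent v f g x θ * ψ x θ)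
    (φ' := fun x θ => N x θ * ψ x θ + normalCurrent v f g x θ * ψx x θ)
    (fun y hy => (cn' y hy).mul (cψ y))
    ((cN.mul cψ'.continuousOn).add (cn.mul cψx.continuousOn))
    (fun y hy θ => (dN y hy θ).mul (hx y θ)) hxL
  have cNx := continuous_slice cN hxL
  have ctx := continuous_slice h.continuousOn_tangentCurrent hxL
  have cψxx : Continuous (ψx x) := cψx.comp (by fun_prop : Continuous fun θ : ℝ => (x, θ))
  have cψtx : Continuous (ψt x) := cψt.comp (by fun_prop : Continuous fun θ : ℝ => (x, θ))
  have pT : tangentCurrent v f g x (2 * Real.pi) = tangentCurrent v f g x 0 := by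
    have e1 := periodic_slice h.pv x 0
    have e2 := periodic_slice h.pf x 0
    have e3 := periodic_slice h.pg x 0
    simp only [zero_add] at e1 e2 e3
    simp only [tangentCurrent, e1, e2, e3]
  have parts := intervalIntegral.integral_mul_deriv_eq_deriv_mul (a := 0) (b := 2 * Real.pi)
    (fun θ _ => ht x θ) (fun θ _ => dT θ) (cψtx.intervalIntegrable _ _)
    (cNx.neg.intervalIntegrable _ _)
  rw [pψ, pT, sub_self, zero_sub] at parts
  have parts' : ∫ θ in (0 : ℝ)..(2 * Real.pi), N x θ * ψ x θ =
      ∫ θ in (0 : ℝ)..(2 * Real.pi), tangentCurrent v f g x θ * ψt x θ := by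
    have e1 : ∀ θ, ψ x θ * -N x θ = -(N x θ * ψ x θ) := fun θ => by ring
    simp only [e1, intervalIntegral.integral_neg, neg_inj] at parts
    rw [parts]
    congr 1
    ext θ; ring
  have e : ∫ θ in (0 : ℝ)..(2 * Real.pi), (N x θ * ψ x θ + normalCurrent v f g x θ * ψx x θ) =
      ∫ θ in (0 : ℝ)..(2 * Real.pi), (normalCurrent v f g x θ * ψx x θ +
        tangentCurrent v f g x θ * ψt x θ) := by
    have q1 : Continuous fun θ => N x θ * ψ x θ := cNx.mul (cψ x)
    have q2 : Continuous fun θ => normalCurrent v f g x θ * ψx x θ := (cn' x hxL).mul cψxx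
    have q3 : Continuous fun θ => tangentCurrent v f g x θ * ψt x θ := ctx.mul cψtx
    rw [intervalIntegral.integral_add (q1.intervalIntegrable _ _) (q2.intervalIntegrable _ _),
      parts', intervalIntegral.integral_add (q2.intervalIntegrable _ _)
      (q3.intervalIntegrable _ _), add_comm]
  rw [← e]
  exact main

end StripMap

/-- A primitive of an integrable function of mean zero which vanishes along a sequence at one end
vanishes at the other end. -/
lemma tendsto_zero_of_frequently {L : ℝ} (hL : L < 0) {Ψ h : ℝ → ℝ}
    (hΨ : ∀ x ∈ Ioo L 0, HasDerivAt Ψ (h x) x) (hh : IntegrableOn h (Ioo L 0))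
    (h0 : ∫ x in L..0, h x = 0)
    (hfreq : ∀ η > 0, ∃ᶠ s in 𝓝[<] (0 : ℝ), |Ψ (L - s)| ≤ η) :
    Tendsto Ψ (𝓝[<] 0) (𝓝 0) := by
  have hh' := hh
  rw [← intervalIntegrable_iff_integrableOn_Ioo_of_le hL.le] at hh'
  have hr := (hh'.comp_sub_left L).symm
  rw [sub_self, sub_zero, intervalIntegrable_iff_integrableOn_Ioo_of_le hL.le] at hr
  have t1 := tendsto_tail hL hh
  have t2 := tendsto_tail hL hr
  rw [Metric.tendsto_nhds]
  intro ε hε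
  have ev2 := t2.eventually (Metric.ball_mem_nhds 0 (by positivity : 0 < ε / 4))
  obtain ⟨s, hs1, hs2, hs3⟩ := ((hfreq (ε / 4) (by positivity)).and_eventually
    (ev2.and (Ioo_mem_nhdsLT hL))).exists
  have ev1 := t1.eventually (Metric.ball_mem_nhds 0 (by positivity : 0 < ε / 4))
  have hx0 : L - s < 0 := by linarith [hs3.1]
  filter_upwards [ev1, Ioo_mem_nhdsLT hx0] with y hy1 hy
  have hxL : L < L - s := by linarith [hs3.2]
  have iI : ∀ a b, L ≤ a → b ≤ 0 → a ≤ b → IntervalIntegrable h volume a b := fun a b ha hb hab => by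
    rw [intervalIntegrable_iff_integrableOn_Ioo_of_le hab]
    exact hh.mono_set (Ioo_subset_Ioo ha hb)
  have e1 := intervalIntegral.integral_eq_sub_of_hasDerivAt (a := L - s) (b := y)
    (fun t ht => hΨ t (by
      rw [uIcc_of_le hy.1.le] at ht
      exact ⟨hxL.trans_le ht.1, ht.2.trans_lt hy.2⟩))
    (iI _ _ hxL.le hy.2.le hy.1.le)
  have e2 := intervalIntegral.integral_add_adjacent_intervals (iI L (L - s) le_rfl hx0.le hxL.le)
    (iI (L - s) y hxL.le hy.2.le hy.1.le)
  have e3 := intervalIntegral.integral_add_adjacent_intervals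
    (iI L y le_rfl hy.2.le (hxL.trans hy.1).le) (iI y 0 (hxL.trans hy.1).le le_rfl hy.2.le)
  have e4 := intervalIntegral.integral_comp_sub_left h L (a := s) (b := 0)
  rw [sub_zero] at e4
  rw [dist_zero_right, Real.norm_eq_abs] at hy1 hs2 ⊢
  rw [e4] at hs2
  have e5 : Ψ y = Ψ (L - s) - (∫ x in L..(L - s), h x) - ∫ x in y..0, h x := by linarith
  have a1 := abs_lt.1 hy1
  have a2 := abs_lt.1 hs2
  have a3 := abs_le.1 hs1
  rw [e5, abs_lt]
  constructor <;> linarith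

/-! ### Solutions as boundary data in the strip -/

/-- Conformal invariance of `(a ∧ A) · B` under the similarity with factor `z`. -/
lemma wedge_conformal (a z : ℂ) (A : ℂ →L[ℝ] ℂ) (B : ℂ →L[ℝ] ℝ) :
    wedge a (A z) * B z + wedge a (A (z * I)) * B (z * I) =
      ‖z‖ ^ 2 * (wedge a (A 1) * B 1 + wedge a (A I) * B I) := by
  have e1 : z = z.re • (1 : ℂ) + z.im • I := by simp
  have e2 : z * I = (-z.im) • (1 : ℂ) + z.re • I := by apply Complex.ext <;> simp
  rw [e2]
  nth_rewrite 1 2 [e1]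
  rw [← normSq_eq_norm_sq, normSq_apply]
  simp only [map_add, map_smul, wedge, add_re, add_im, Complex.smul_re, Complex.smul_im,
    smul_eq_mul]
  ring

lemma exp_pt_pow (n : ℕ) (x θ : ℝ) :
    Complex.exp (pt x θ) ^ n = (Real.exp (n * x) : ℂ) * ex n θ := by
  rw [← Complex.exp_nat_mul, ex, Complex.ofReal_exp, ← Complex.exp_add]
  congr 1
  simp [pt]; ring

lemma norm_exp_pt (x θ : ℝ) : ‖Complex.exp (pt x θ)‖ = Real.exp x := by
  rw [Complex.norm_exp, pt_re]

lemma circleMap_exp (x θ : ℝ) : circleMap 0 (Real.exp x) θ = Complex.exp (pt x θ) := by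
  rw [circleMap, zero_add, Complex.ofReal_exp, ← Complex.exp_add, pt]

namespace IsSolution

variable {ϱ : ℝ} {p q : ℤ} {u : ℂ → ℂ}

/-- The flux of the current `u ∧ ∇u` through the circle of radius `e^x`, weighted by `ψ`. -/
noncomputable def flux (u : ℂ → ℂ) (ψ : ℂ → ℝ) (x : ℝ) : ℝ :=
  ∫ θ in (0 : ℝ)..(2 * Real.pi),
    StripMap.normalCurrent (logV u) (logF u) (logG u) x θ * ψ (Complex.exp (pt x θ))

lemma normalCurrent_eq (u : ℂ → ℂ) (x θ : ℝ) :
    StripMap.normalCurrent (logV u) (logF u) (logG u) x θ = wedge (u (Complex.exp (pt x θ)))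
      (fderiv ℝ u (Complex.exp (pt x θ)) (Complex.exp (pt x θ))) := by
  rw [wedge_eq_im, fderiv_apply_eq, StripMap.normalCurrent, logV, logF, logG]
  congr 2
  simp
  ring

lemma tangentCurrent_eq (u : ℂ → ℂ) (x θ : ℝ) :
    StripMap.tangentCurrent (logV u) (logF u) (logG u) x θ = wedge (u (Complex.exp (pt x θ)))
      (fderiv ℝ u (Complex.exp (pt x θ)) (Complex.exp (pt x θ) * I)) := by
  rw [wedge_eq_im, fderiv_apply_eq, StripMap.tangentCurrent, logV, logF, logG]
  congr 2
  simp
  ring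

lemma integrableOn_norm_mul (hu : IsSolution ϱ p q u) :
    IntegrableOn (fun z => ‖u z‖ * ‖fderiv ℝ u z‖) (annulus ϱ) :=
  hu.memClass.1.memLp.norm.integrable_mul hu.memClass.1.memLp_fderiv.norm

/-- The weak Neumann condition: the derivative of the flux has mean zero. -/
lemma exists_deriv_flux (hϱ0 : 0 < ϱ) (hϱ1 : ϱ < 1) (hu : IsSolution ϱ p q u) {ψ : ℂ → ℝ}
    (hψ : ContDiff ℝ ∞ ψ) :
    ∃ h : ℝ → ℝ, (∀ x ∈ Ioo (Real.log ϱ) 0, HasDerivAt (flux u ψ) (h x) x) ∧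
      IntegrableOn h (Ioo (Real.log ϱ) 0) ∧ ∫ x in (Real.log ϱ)..0, h x = 0 := by
  set G : ℂ → ℝ := fun z => wedge (u z) (dx u z) * fderiv ℝ ψ z 1 +
      wedge (u z) (dy u z) * fderiv ℝ ψ z I with hG
  have hψ1 : ContDiff ℝ 1 ψ := hψ.of_le (by norm_cast)
  have cψ' : Continuous (fderiv ℝ ψ) := hψ1.continuous_fderiv one_ne_zero
  have cu : ContinuousOn u (annulus ϱ) := hu.memClass.1.contDiffOn.continuousOn
  have cu' : ContinuousOn (fderiv ℝ u) (annulus ϱ) :=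
    hu.memClass.1.contDiffOn.continuousOn_fderiv_of_isOpen (isOpen_annulus ϱ) le_rfl
  have cwedge : ∀ a : ℂ, ContinuousOn (fun z => wedge (u z) (fderiv ℝ u z a)) (annulus ϱ) :=
    fun a => by
    simp only [wedge_eq_im]
    exact continuous_im.comp_continuousOn ((continuous_conj.comp_continuousOn cu).mul
      (cu'.clm_apply continuousOn_const))
  have cG : ContinuousOn G (annulus ϱ) :=
    ((cwedge 1).mul (cψ'.clm_apply continuous_const).continuousOn).add
      ((cwedge I).mul (cψ'.clm_apply continuous_const).continuousOn)
  have iG : IntegrableOn G (annulus ϱ) := by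
    obtain ⟨C, hC⟩ := (isCompact_closedBall (0 : ℂ) 1).exists_bound_of_continuousOn
      cψ'.continuousOn
    refine (hu.integrableOn_norm_mul.const_mul (2 * C)).mono'
      (cG.aestronglyMeasurable (isOpen_annulus ϱ).measurableSet) ?_
    refine (ae_restrict_iff' (isOpen_annulus ϱ).measurableSet).2 (ae_of_all _ fun z hz => ?_)
    have h1 := hC z (by rw [mem_closedBall_zero_iff]; exact hz.2.le)
    have hb : ∀ a : ℂ, ‖a‖ = 1 → |wedge (u z) (fderiv ℝ u z a) * fderiv ℝ ψ z a| ≤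
        ‖u z‖ * ‖fderiv ℝ u z‖ * C := fun a ha => by
      have b1 := (fderiv ℝ u z).le_opNorm a
      have b2 := (fderiv ℝ ψ z).le_opNorm a
      rw [ha, mul_one] at b1 b2
      rw [abs_mul, wedge_eq_im]
      have b3 : |(conj (u z) * fderiv ℝ u z a).im| ≤ ‖u z‖ * ‖fderiv ℝ u z‖ := by
        refine (abs_im_le_norm _).trans ?_
        rw [norm_mul, RCLike.norm_conj]
        gcongr
      exact mul_le_mul b3 (b2.trans h1) (abs_nonneg _) (by positivity)
    have := hb 1 norm_one
    have := hb I norm_I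
    rw [Real.norm_eq_abs]
    refine (abs_add_le _ _).trans ?_
    simp only [dx, dy]
    linarith
  obtain ⟨i1, i2⟩ := annulus_change_of_variables hϱ0 hϱ1 iG
  rw [hu.neumann ψ hψ] at i2
  refine ⟨_, fun x hx => ?_, i1, i2.symm⟩
  have cE : Continuous fun r : ℝ × ℝ => Complex.exp (pt r.1 r.2) :=
    Complex.continuous_exp.comp continuous_pt
  have hdψ : ∀ z, HasFDerivAt ψ (fderiv ℝ ψ z) z := fun z =>
    (hψ.differentiable (by simp) z).hasFDerivAt
  have main := (hu.stripMap hϱ0 hϱ1).hasDerivAt_flux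
    (ψ := fun x θ => ψ (Complex.exp (pt x θ)))
    (ψx := fun x θ => fderiv ℝ ψ (Complex.exp (pt x θ)) (Complex.exp (pt x θ)))
    (ψt := fun x θ => fderiv ℝ ψ (Complex.exp (pt x θ)) (Complex.exp (pt x θ) * I))
    (fun x => hψ.continuous.comp (cE.comp (by fun_prop : Continuous fun θ : ℝ => (x, θ))))
    (hψ.continuous.comp cE) ((cψ'.comp cE).clm_apply cE)
    ((cψ'.comp cE).clm_apply (cE.mul continuous_const))
    (fun x θ => by
      have := (hdψ (Complex.exp (pt x θ))).comp_hasDerivAt x (hasDerivAt_pt_left x θ).cexp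
      rw [mul_one] at this
      exact this)
    (fun x θ => (hdψ (Complex.exp (pt x θ))).comp_hasDerivAt θ (hasDerivAt_pt_right x θ).cexp)
    (fun x => by
      have := pt_add_two_pi x 0
      rw [zero_add] at this
      simp only [this, Complex.exp_add, Complex.exp_two_pi_mul_I, mul_one]) hx
  have e : (∫ θ in (0 : ℝ)..(2 * Real.pi), Real.exp x ^ 2 * G (Complex.exp (pt x θ))) =
      ∫ θ in (0 : ℝ)..(2 * Real.pi),
        (StripMap.normalCurrent (logV u) (logF u) (logG u) x θ *
          fderiv ℝ ψ (Complex.exp (pt x θ)) (Complex.exp (pt x θ)) +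
        StripMap.tangentCurrent (logV u) (logF u) (logG u) x θ *
          fderiv ℝ ψ (Complex.exp (pt x θ)) (Complex.exp (pt x θ) * I)) := by
    congr 1
    ext θ
    rw [normalCurrent_eq, tangentCurrent_eq, wedge_conformal, norm_exp_pt]
    rfl
  rw [e]
  exact main

/-- The weighted flux through a circle is at most `ϱ⁻¹` times the supremum of the weight times the
circle integral of `|u| |∇u|`, in the form that occurs in `annulus_change_of_variables`. -/
lemma abs_flux_le (hϱ0 : 0 < ϱ) (hϱ1 : ϱ < 1) (hu : IsSolution ϱ p q u) {ψ : ℂ → ℝ} {x S : ℝ}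
    (hx : x ∈ Ioo (Real.log ϱ) 0)
    (hS : ∀ θ, |ψ (Complex.exp (pt x θ))| ≤ S) :
    |flux u ψ x| ≤ S * (ϱ⁻¹ * ∫ θ in (0 : ℝ)..(2 * Real.pi), Real.exp x ^ 2 *
      (‖u (Complex.exp (pt x θ))‖ * ‖fderiv ℝ u (Complex.exp (pt x θ))‖)) := by
  have hs := hu.stripMap hϱ0 hϱ1
  have hpi := Real.two_pi_pos
  have hmem : ∀ θ, Complex.exp (pt x θ) ∈ annulus ϱ := fun θ => exp_mem_annulus hϱ0 (pt_mem hx θ)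
  have cE : Continuous fun θ : ℝ => Complex.exp (pt x θ) :=
    Complex.continuous_exp.comp (continuous_pt.comp (by fun_prop : Continuous fun θ : ℝ => (x, θ)))
  have cu : Continuous fun θ => u (Complex.exp (pt x θ)) :=
    hu.memClass.1.contDiffOn.continuousOn.comp_continuous cE hmem
  have cu' : Continuous fun θ => fderiv ℝ u (Complex.exp (pt x θ)) :=
    (hu.memClass.1.contDiffOn.continuousOn_fderiv_of_isOpen (isOpen_annulus ϱ)
      le_rfl).comp_continuous cE hmem
  have c1 : Continuous fun θ => Real.exp x ^ 2 *
      (‖u (Complex.exp (pt x θ))‖ * ‖fderiv ℝ u (Complex.exp (pt x θ))‖) :=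
    continuous_const.mul (cu.norm.mul cu'.norm)
  rw [flux, ← intervalIntegral.integral_const_mul, ← intervalIntegral.integral_const_mul,
    ← Real.norm_eq_abs]
  refine intervalIntegral.norm_integral_le_of_norm_le hpi.le (ae_of_all _ fun θ _ => ?_)
    ((continuous_const.mul (continuous_const.mul c1)).intervalIntegrable _ _)
  have hϱx : ϱ ≤ Real.exp x := ((Real.log_lt_iff_lt_exp hϱ0).1 hx.1).le
  rw [Real.norm_eq_abs, abs_mul, normalCurrent_eq, wedge_eq_im, mul_comm]
  refine mul_le_mul (hS θ) ?_ (abs_nonneg _) ((abs_nonneg _).trans (hS θ))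
  refine (abs_im_le_norm _).trans ?_
  rw [norm_mul, RCLike.norm_conj]
  have h1 := (fderiv ℝ u (Complex.exp (pt x θ))).le_opNorm (Complex.exp (pt x θ))
  rw [norm_exp_pt] at h1
  have h2 : Real.exp x ≤ ϱ⁻¹ * Real.exp x ^ 2 := by
    rw [inv_mul_eq_div, le_div_iff₀ hϱ0, sq]
    gcongr
  calc _ ≤ ‖u (Complex.exp (pt x θ))‖ *
        (‖fderiv ℝ u (Complex.exp (pt x θ))‖ * (ϱ⁻¹ * Real.exp x ^ 2)) := by
        gcongr
        exact h1.trans (by gcongr)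
    _ = _ := by ring

lemma integrableOn_flux_bound (hϱ0 : 0 < ϱ) (hϱ1 : ϱ < 1) (hu : IsSolution ϱ p q u) :
    IntegrableOn (fun x => ∫ θ in (0 : ℝ)..(2 * Real.pi), Real.exp x ^ 2 *
      (‖u (Complex.exp (pt x θ))‖ * ‖fderiv ℝ u (Complex.exp (pt x θ))‖))
      (Ioo (Real.log ϱ) 0) :=
  (annulus_change_of_variables hϱ0 hϱ1 hu.integrableOn_norm_mul).1

/-- A flux weighted by a function which vanishes linearly at the end is small along a sequence,
since the integrable factor `E` is frequently `o(1/|s|)`. -/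
lemma frequently_le_of_bound {L C κ η : ℝ} (hL : L < 0) {E Φ : ℝ → ℝ} (hE : IntegrableOn E (Ioo L 0))
    (hκ : 0 < κ) (hC : 0 ≤ C) (hη : 0 < η)
    (hΦ : ∀ s ∈ Ioo L 0, |Φ s| ≤ C * |s| * (κ⁻¹ * E s)) :
    ∃ᶠ s in 𝓝[<] (0 : ℝ), |Φ s| ≤ η := by
  refine ((frequently_abs_mul_le hL hE (by positivity : 0 < η * κ / (C + 1))).and_eventually
    (Ioo_mem_nhdsLT hL)).mono fun s hs => (hΦ s hs.2).trans ?_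
  calc C * |s| * (κ⁻¹ * E s) = C * κ⁻¹ * (|s| * E s) := by ring
    _ ≤ C * κ⁻¹ * (η * κ / (C + 1)) := by gcongr; exact hs.1
    _ = C / (C + 1) * η := by field_simp
    _ ≤ 1 * η := by gcongr; rw [div_le_one (by positivity)]; linarith
    _ = η := one_mul η

lemma reflect_mem {L s : ℝ} (hs : s ∈ Ioo L 0) : L - s ∈ Ioo L 0 :=
  ⟨by linarith [hs.2], by linarith [hs.1]⟩

/-- For a test function vanishing on the inner circle, the flux through the outer circle
vanishes. -/
lemma tendsto_flux_outer (hϱ0 : 0 < ϱ) (hϱ1 : ϱ < 1) (hu : IsSolution ϱ p q u) {ψ : ℂ → ℝ} {C : ℝ}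
    (hψ : ContDiff ℝ ∞ ψ) (hC : 0 ≤ C)
    (hb : ∀ s ∈ Ioo (Real.log ϱ) 0, ∀ θ,
      |ψ (Complex.exp (pt (Real.log ϱ - s) θ))| ≤ C * |s|) :
    Tendsto (flux u ψ) (𝓝[<] 0) (𝓝 0) := by
  have hL := Real.log_neg hϱ0 hϱ1
  obtain ⟨h, h1, h2, h3⟩ := hu.exists_deriv_flux hϱ0 hϱ1 hψ
  have hE := hu.integrableOn_flux_bound hϱ0 hϱ1
  rw [← intervalIntegrable_iff_integrableOn_Ioo_of_le hL.le] at hE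
  have hE' := (hE.comp_sub_left (Real.log ϱ)).symm
  rw [sub_self, sub_zero, intervalIntegrable_iff_integrableOn_Ioo_of_le hL.le] at hE'
  exact tendsto_zero_of_frequently hL h1 h2 h3 fun η hη => frequently_le_of_bound hL hE' hϱ0 hC hη
    fun s hs => hu.abs_flux_le hϱ0 hϱ1 (reflect_mem hs) (hb s hs)

/-- For a test function vanishing on the outer circle, the flux through the inner circle
vanishes. -/
lemma tendsto_flux_inner (hϱ0 : 0 < ϱ) (hϱ1 : ϱ < 1) (hu : IsSolution ϱ p q u) {ψ : ℂ → ℝ} {C : ℝ}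
    (hψ : ContDiff ℝ ∞ ψ) (hC : 0 ≤ C)
    (hb : ∀ s ∈ Ioo (Real.log ϱ) 0, ∀ θ, |ψ (Complex.exp (pt s θ))| ≤ C * |s|) :
    Tendsto (fun s => flux u ψ (Real.log ϱ - s)) (𝓝[<] 0) (𝓝 0) := by
  have hL := Real.log_neg hϱ0 hϱ1
  obtain ⟨h, h1, h2, h3⟩ := hu.exists_deriv_flux hϱ0 hϱ1 hψ
  have hE := hu.integrableOn_flux_bound hϱ0 hϱ1
  rw [← intervalIntegrable_iff_integrableOn_Ioo_of_le hL.le] at h2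
  have h2' := (h2.comp_sub_left (Real.log ϱ)).symm
  rw [sub_self, sub_zero, intervalIntegrable_iff_integrableOn_Ioo_of_le hL.le] at h2'
  refine tendsto_zero_of_frequently (h := fun s => -1 * h (Real.log ϱ - s)) hL
    (fun s hs => ?_) (h2'.const_mul (-1)) ?_ fun η hη => ?_
  · have := HasDerivAt.scomp s (h1 _ (reflect_mem hs)) ((hasDerivAt_id s).const_sub (Real.log ϱ))
    exact this
  · rw [intervalIntegral.integral_const_mul, intervalIntegral.integral_comp_sub_left, sub_self,
      sub_zero, h3, mul_zero]
  · simp only [sub_sub_cancel]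
    exact frequently_le_of_bound hL hE hϱ0 hC hη
      fun s hs => hu.abs_flux_le hϱ0 hϱ1 hs (hb s hs)

/-- The test functions `(α + β |z|²) Re (c zⁿ)`. -/
noncomputable def testFun (α β : ℝ) (c : ℂ) (n : ℕ) (z : ℂ) : ℝ := (α + β * ‖z‖ ^ 2) * (c * z ^ n).re

lemma contDiff_testFun (α β : ℝ) (c : ℂ) (n : ℕ) : ContDiff ℝ ∞ (testFun α β c n) := by
  have h1 : ContDiff ℝ ∞ fun z : ℂ => c * z ^ n := contDiff_const.mul (contDiff_id.pow n)
  exact (contDiff_const.add (contDiff_const.mul (contDiff_norm_sq ℝ))).mul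
    (reCLM.contDiff.comp h1)

lemma testFun_exp (α β : ℝ) (c : ℂ) (n : ℕ) (x θ : ℝ) : testFun α β c n (Complex.exp (pt x θ)) =
    (α + β * Real.exp x ^ 2) * Real.exp (n * x) * (c * ex n θ).re := by
  rw [testFun, norm_exp_pt, exp_pt_pow, mul_left_comm, Complex.re_ofReal_mul]
  ring

lemma abs_testFun_le {α β : ℝ} (c : ℂ) (n : ℕ) {x S : ℝ} (hx : x ≤ 0)
    (hS : |α + β * Real.exp x ^ 2| ≤ S) (θ : ℝ) :
    |testFun α β c n (Complex.exp (pt x θ))| ≤ S * ‖c‖ := by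
  rw [testFun_exp, abs_mul, abs_mul, Real.abs_exp]
  have h1 : Real.exp (n * x) ≤ 1 :=
    Real.exp_le_one_iff.2 (mul_nonpos_of_nonneg_of_nonpos (Nat.cast_nonneg n) hx)
  have h2 : |(c * ex n θ).re| ≤ ‖c‖ := by
    refine (abs_re_le_norm _).trans_eq ?_
    rw [norm_mul, norm_ex, mul_one]
  have hS0 : 0 ≤ S := (abs_nonneg _).trans hS
  calc _ ≤ S * 1 * ‖c‖ := by gcongr
    _ = _ := by ring

/-- Vanishing of the weighted fluxes for all `Re (c zⁿ)` is vanishing of the Fourier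
coefficients. -/
lemma tendsto_fc_of_testFun {N : ℝ → ℝ → ℝ} {A : ℝ → ℝ} {a : ℝ} {l : Filter ℝ} (ha : a ≠ 0)
    (hN : ∀ᶠ x in l, Continuous (N x)) (n : ℕ) (hA : Tendsto A l (𝓝 a))
    (h : ∀ c : ℂ, Tendsto (fun x => ∫ θ in (0 : ℝ)..(2 * Real.pi),
      N x θ * (A x * (c * ex n θ).re)) l (𝓝 0)) :
    Tendsto (fun x => fc (fun θ => (N x θ : ℂ)) (-n)) l (𝓝 0) ∧
      Tendsto (fun x => fc (fun θ => (N x θ : ℂ)) n) l (𝓝 0) := by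
  have key : ∀ c : ℂ, Tendsto (fun x => ∫ θ in (0 : ℝ)..(2 * Real.pi),
      N x θ * (c * ex n θ).re) l (𝓝 0) := fun c => by
    have h1 := (h c).div hA ha
    rw [zero_div] at h1
    refine h1.congr' ?_
    filter_upwards [hA.eventually_ne ha] with x hx
    have : ∀ θ, N x θ * (A x * (c * ex n θ).re) = A x * (N x θ * (c * ex n θ).re) := fun θ => by ring
    simp only [Pi.div_apply, this, intervalIntegral.integral_const_mul]
    rw [mul_div_cancel_left₀ _ hx]
  have h1 : Tendsto (fun x => fc (fun θ => (N x θ : ℂ)) (-n)) l (𝓝 0) := by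
    have lim := (((continuous_ofReal.tendsto 0).comp (key 1)).sub
      (((continuous_ofReal.tendsto 0).comp (key I)).const_mul I)).const_mul (2 * Real.pi : ℂ)⁻¹
    simp only [ofReal_zero, mul_zero, sub_zero] at lim
    refine lim.congr' ?_
    filter_upwards [hN] with x hx
    have cre : ∀ c : ℂ, Continuous fun θ => ((N x θ * (c * ex n θ).re : ℝ) : ℂ) := fun c =>
      continuous_ofReal.comp (hx.mul (continuous_re.comp
        (continuous_const.mul (continuous_ex n))))
    rw [fc_eq, neg_neg]
    congr 1
    simp only [Function.comp_apply, ← intervalIntegral.integral_ofReal]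
    have cI : Continuous fun θ => I * ((N x θ * (I * ex n θ).re : ℝ) : ℂ) :=
      continuous_const.mul (cre I)
    rw [← intervalIntegral.integral_const_mul, ← intervalIntegral.integral_sub
      ((cre 1).intervalIntegrable _ _) (cI.intervalIntegrable _ _)]
    congr 1
    ext θ
    have e0 := Complex.re_add_im (ex n θ)
    simp
    linear_combination (N x θ : ℂ) * e0
  refine ⟨h1, ?_⟩
  have h2 := (continuous_conj.tendsto 0).comp h1
  rw [map_zero] at h2
  refine h2.congr fun x => ?_
  rw [Function.comp_apply, ← fc_conj]
  simp only [conj_ofReal]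

/-- The normal current of a solution vanishes on the outer circle, in the sense of Fourier
coefficients. -/
lemma tendsto_fc_outer (hϱ0 : 0 < ϱ) (hϱ1 : ϱ < 1) (hu : IsSolution ϱ p q u) (m : ℤ) :
    Tendsto (fun x => fc (fun θ =>
      (StripMap.normalCurrent (logV u) (logF u) (logG u) x θ : ℂ)) m) (𝓝[<] 0) (𝓝 0) := by
  have hL := Real.log_neg hϱ0 hϱ1
  have hN : ∀ᶠ x in 𝓝[<] (0 : ℝ),
      Continuous (StripMap.normalCurrent (logV u) (logF u) (logG u) x) := by
    filter_upwards [Ioo_mem_nhdsLT hL] with x hx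
    exact continuous_slice (hu.stripMap hϱ0 hϱ1).continuousOn_normalCurrent hx
  have key : ∀ n : ℕ, _ := fun n : ℕ => tendsto_fc_of_testFun
    (A := fun x => (-ϱ ^ 2 + 1 * Real.exp x ^ 2) * Real.exp (n * x)) (a := 1 - ϱ ^ 2)
    (by nlinarith) hN n
    (by
      have : Continuous fun x => (-ϱ ^ 2 + 1 * Real.exp x ^ 2) * Real.exp (n * x) := by fun_prop
      have h1 := (this.tendsto 0).mono_left (nhdsWithin_le_nhds (s := Iio 0))
      simpa [neg_add_eq_sub] using h1)
    (fun c => by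
      have := hu.tendsto_flux_outer hϱ0 hϱ1 (contDiff_testFun (-ϱ ^ 2) 1 c n)
        (C := 2 * ‖c‖) (by positivity) (fun s hs θ => by
          have hx := reflect_mem hs
          have e1 : ϱ = Real.exp (Real.log ϱ) := (Real.exp_log hϱ0).symm
          have b := abs_testFun_le (α := -ϱ ^ 2) (β := 1) c n hx.2.le (S := 2 * |s|) (by
            have e2 : -ϱ ^ 2 + 1 * Real.exp (Real.log ϱ - s) ^ 2 =
                Real.exp (Real.log ϱ - s) ^ 2 * (1 - Real.exp (2 * s)) := by
              nth_rewrite 1 [e1]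
              rw [mul_sub, ← Real.exp_nat_mul, ← Real.exp_nat_mul, ← Real.exp_add]
              push_cast
              ring_nf
            have e3 := Real.add_one_le_exp (2 * s)
            have e4 : Real.exp (2 * s) ≤ 1 := Real.exp_le_one_iff.2 (by linarith [hs.2])
            have e5 : Real.exp (Real.log ϱ - s) ≤ 1 := Real.exp_le_one_iff.2 hx.2.le
            have e6 : Real.exp (Real.log ϱ - s) ^ 2 ≤ 1 := pow_le_one₀ (Real.exp_nonneg _) e5
            rw [e2, abs_of_nonneg (mul_nonneg (sq_nonneg _) (by linarith)), abs_of_neg hs.2]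
            calc _ ≤ 1 * (1 - Real.exp (2 * s)) := by gcongr
              _ ≤ _ := by linarith) θ
          refine b.trans_eq (by ring))
      refine this.congr fun x => ?_
      simp only [flux, testFun_exp])
  rcases Int.eq_nat_or_neg m with ⟨n, rfl | rfl⟩
  · exact (key n).2
  · exact (key n).1

/-- The normal current of a solution vanishes on the inner circle, in the sense of Fourier
coefficients. -/
lemma tendsto_fc_inner (hϱ0 : 0 < ϱ) (hϱ1 : ϱ < 1) (hu : IsSolution ϱ p q u) (m : ℤ) :
    Tendsto (fun s => fc (fun θ =>
      (StripMap.normalCurrent (logV u) (logF u) (logG u) (Real.log ϱ - s) θ : ℂ)) m)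
      (𝓝[<] 0) (𝓝 0) := by
  have hL := Real.log_neg hϱ0 hϱ1
  have hN : ∀ᶠ s in 𝓝[<] (0 : ℝ),
      Continuous (StripMap.normalCurrent (logV u) (logF u) (logG u) (Real.log ϱ - s)) := by
    filter_upwards [Ioo_mem_nhdsLT hL] with s hs
    exact continuous_slice (hu.stripMap hϱ0 hϱ1).continuousOn_normalCurrent (reflect_mem hs)
  have key : ∀ n : ℕ, _ := fun n : ℕ => tendsto_fc_of_testFun
    (N := fun s => StripMap.normalCurrent (logV u) (logF u) (logG u) (Real.log ϱ - s))
    (A := fun s => (1 + -1 * Real.exp (Real.log ϱ - s) ^ 2) * Real.exp (n * (Real.log ϱ - s)))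
    (a := (1 - ϱ ^ 2) * Real.exp (n * Real.log ϱ))
    (mul_ne_zero (by nlinarith) (Real.exp_ne_zero _)) hN n
    (by
      have : Continuous fun s => (1 + -1 * Real.exp (Real.log ϱ - s) ^ 2) *
          Real.exp (n * (Real.log ϱ - s)) := by fun_prop
      have h1 := (this.tendsto 0).mono_left (nhdsWithin_le_nhds (s := Iio 0))
      rw [sub_zero, Real.exp_log hϱ0, neg_one_mul, ← sub_eq_add_neg] at h1
      exact h1)
    (fun c => by
      have := hu.tendsto_flux_inner hϱ0 hϱ1 (contDiff_testFun 1 (-1) c n)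
        (C := 2 * ‖c‖) (by positivity) (fun s hs θ => by
          have b := abs_testFun_le (α := 1) (β := -1) c n hs.2.le (S := 2 * |s|) (by
            have e2 : Real.exp s ^ 2 = Real.exp (2 * s) := by
              rw [← Real.exp_nat_mul]; push_cast; rfl
            have e3 := Real.add_one_le_exp (2 * s)
            have e4 : Real.exp (2 * s) ≤ 1 := Real.exp_le_one_iff.2 (by linarith [hs.2])
            rw [e2, abs_of_nonneg (by linarith), abs_of_neg hs.2]
            linarith) θ
          refine b.trans_eq (by ring))
      refine this.congr fun x => ?_
      simp only [flux, testFun_exp])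
  rcases Int.eq_nat_or_neg m with ⟨n, rfl | rfl⟩
  · exact (key n).2
  · exact (key n).1

/-- If functions converge in `L²` to a circle-valued function, their moduli converge to one in `L²`.
-/
lemma tendsto_integral_norm_sub_one {l : Filter ℝ} {φ : ℝ → ℝ → ℂ} {g : ℝ → ℂ}
    (hg : MemLp g 2 angleMeasure) (hg1 : ∀ᵐ θ ∂angleMeasure, ‖g θ‖ = 1)
    (hφ : ∀ᶠ x in l, Continuous (φ x))
    (h : Tendsto (fun x => eLpNorm (fun θ => φ x θ - g θ) 2 angleMeasure) l (𝓝 0)) :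
    Tendsto (fun x => ∫ θ in (0 : ℝ)..(2 * Real.pi), (‖φ x θ‖ - 1) ^ 2) l (𝓝 0) := by
  have h1 : Tendsto (fun x => (eLpNorm (fun θ => φ x θ - g θ) 2 angleMeasure).toReal ^ 2) l
      (𝓝 0) := by
    have := ((ENNReal.tendsto_toReal ENNReal.zero_ne_top).comp h).pow 2
    rw [ENNReal.toReal_zero, zero_pow two_ne_zero] at this
    exact this
  refine squeeze_zero' (Eventually.of_forall fun x =>
    intervalIntegral.integral_nonneg Real.two_pi_pos.le fun _ _ => sq_nonneg _) ?_ h1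
  filter_upwards [hφ] with x hx
  have hm : MemLp (fun θ => φ x θ - g θ) 2 angleMeasure := (memLp_two_of_continuous hx).sub hg
  have c1 : Continuous fun θ => (‖φ x θ‖ - 1) ^ 2 := (hx.norm.sub continuous_const).pow 2
  have e : (eLpNorm (fun θ => φ x θ - g θ) 2 angleMeasure).toReal ^ 2 =
      ∫ θ, ‖φ x θ - g θ‖ ^ 2 ∂angleMeasure := by
    have h0 : 0 ≤ ∫ θ, ‖φ x θ - g θ‖ ^ 2 ∂angleMeasure := integral_nonneg fun _ => sq_nonneg _
    rw [hm.eLpNorm_eq_integral_rpow_norm two_ne_zero ENNReal.ofNat_ne_top]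
    simp only [ENNReal.toReal_ofNat, Real.rpow_two]
    rw [ENNReal.toReal_ofReal (by positivity), ← Real.rpow_natCast, ← Real.rpow_mul h0]
    norm_num
  rw [e, intervalIntegral.integral_of_le Real.two_pi_pos.le]
  refine integral_mono_ae (c1.integrableOn_Ioc) (hm.integrable_norm_pow (by norm_num)) ?_
  filter_upwards [hg1] with θ hθ
  have a1 := abs_norm_sub_norm_le (φ x θ) (g θ)
  rw [hθ] at a1
  rw [← sq_abs]
  gcongr

lemma tendsto_outer {gout : ℝ → ℂ} (h : IsTrace (𝓝[<] 1) u gout) :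
    Tendsto (fun x => eLpNorm (fun θ => logV u (pt x θ) - gout θ) 2 angleMeasure)
      (𝓝[<] 0) (𝓝 0) := by
  have hexp : Tendsto Real.exp (𝓝[<] 0) (𝓝[<] 1) := by
    refine tendsto_nhdsWithin_iff.2 ⟨?_, ?_⟩
    · have := (Real.continuous_exp.tendsto 0).mono_left (nhdsWithin_le_nhds (s := Iio 0))
      rwa [Real.exp_zero] at this
    · filter_upwards [self_mem_nhdsWithin] with x hx
      exact Real.exp_lt_one_iff.2 hx
  refine (h.2.comp hexp).congr fun x => ?_
  simp only [Function.comp_apply, circleMap_exp, logV]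

lemma tendsto_inner (hϱ0 : 0 < ϱ) {gin : ℝ → ℂ} (h : IsTrace (𝓝[>] ϱ) u gin) :
    Tendsto (fun s => eLpNorm (fun θ => logV u (pt (Real.log ϱ - s) θ) - gin θ) 2 angleMeasure)
      (𝓝[<] 0) (𝓝 0) := by
  have hexp : Tendsto (fun s => Real.exp (Real.log ϱ - s)) (𝓝[<] 0) (𝓝[>] ϱ) := by
    refine tendsto_nhdsWithin_iff.2 ⟨?_, ?_⟩
    · have c : Continuous fun s => Real.exp (Real.log ϱ - s) := by fun_prop
      have := (c.tendsto 0).mono_left (nhdsWithin_le_nhds (s := Iio 0))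
      rwa [sub_zero, Real.exp_log hϱ0] at this
    · filter_upwards [self_mem_nhdsWithin] with s hs
      rw [mem_Iio] at hs
      rw [mem_Ioi, ← Real.log_lt_iff_lt_exp hϱ0]
      linarith
  refine (h.2.comp hexp).congr fun x => ?_
  simp only [Function.comp_apply, circleMap_exp, logV]

lemma endData_outer (hϱ0 : 0 < ϱ) (hϱ1 : ϱ < 1) (hu : IsSolution ϱ p q u) :
    EndData (Real.log ϱ) (logV u) (logF u) (logG u) := by
  have hs := hu.stripMap hϱ0 hϱ1
  obtain ⟨-, gout, gin, h1, h2, h3, h4, h5, h6⟩ := hu.memClass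
  refine ⟨hs, ?_, fun m => hu.tendsto_fc_outer hϱ0 hϱ1 m⟩
  refine tendsto_integral_norm_sub_one h1.1 h3 ?_ (tendsto_outer h1)
  filter_upwards [Ioo_mem_nhdsLT hs.neg] with x hx using hs.continuous_v hx

lemma endData_inner (hϱ0 : 0 < ϱ) (hϱ1 : ϱ < 1) (hu : IsSolution ϱ p q u) :
    EndData (Real.log ϱ) (fun ζ => logV u (refl (Real.log ϱ) ζ))
      (fun ζ => -conj (logG u (refl (Real.log ϱ) ζ)))
      (fun ζ => -conj (logF u (refl (Real.log ϱ) ζ))) := by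
  have hs := hu.stripMap hϱ0 hϱ1
  obtain ⟨-, gout, gin, h1, h2, h3, h4, h5, h6⟩ := hu.memClass
  refine ⟨hs.reflect, ?_, fun m => ?_⟩
  · simp only [refl_pt]
    refine tendsto_integral_norm_sub_one h2.1 h4 ?_ (tendsto_inner hϱ0 h2)
    filter_upwards [Ioo_mem_nhdsLT hs.neg] with x hx using hs.continuous_v (reflect_mem hx)
  · have h7 := (hu.tendsto_fc_inner hϱ0 hϱ1 m).const_mul (-1)
    rw [mul_zero] at h7
    refine h7.congr fun s => ?_
    rw [← fc_const_mul]
    congr 1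
    ext θ
    simp only [refl_pt, StripMap.normalCurrent]
    rw [← ofReal_one, ← ofReal_neg, ← ofReal_mul]
    congr 1
    simp
    ring

end IsSolution

end SemiStiff

theorem mainTheorem7 (ϱ : ℝ) (hϱ0 : 0 < ϱ) (hϱ1 : ϱ < 1) (p q : ℤ) (u : ℂ → ℂ)
    (hu : SemiStiff.IsSolution ϱ p q u) :
    ∃ c : ℝ, (∀ z ∈ SemiStiff.annulus ϱ, SemiStiff.hopf u z = (c : ℂ) / z ^ 2) ∧
      (c ≠ 0 → p = q) := by
  have hs := hu.stripMap hϱ0 hϱ1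
  have ho := hu.endData_outer hϱ0 hϱ1
  have hi := hu.endData_inner hϱ0 hϱ1
  obtain ⟨c, hc⟩ := SemiStiff.exists_hopf_const
    (F := fun ζ => SemiStiff.logF u ζ * SemiStiff.logG u ζ) hs.neg (hs.hf.mul hs.hg)
    (hs.pf.mul hs.pg) (fun ε hε => ho.eventually_im_mul_le hε) (fun ε hε => by
      filter_upwards [hi.eventually_im_mul_le hε] with s h θ
      have h1 := h θ
      rw [SemiStiff.refl_pt, neg_mul_neg, ← map_mul, conj_im, abs_neg, mul_comm] at h1
      exact h1)
  refine ⟨c, fun z hz => ?_, fun hc0 => ?_⟩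
  · have h0 := SemiStiff.ne_zero_of_mem_annulus hϱ0 hz
    have h1 := hc _ (SemiStiff.log_mem_strip hϱ0 hz)
    simp only [SemiStiff.logF, SemiStiff.logG, Complex.exp_log h0] at h1
    rw [SemiStiff.hopf, ← h1]
    field_simp
  · obtain ⟨-, gout, gin, h1, h2, h3, h4, h5, h6⟩ := hu.memClass
    exact SemiStiff.degree_eq_of_hopf_ne_zero ho hi (by exact_mod_cast hc0) hc h1.1 h2.1 h5 h6
      (SemiStiff.IsSolution.tendsto_outer h1) (SemiStiff.IsSolution.tendsto_inner hϱ0 h2)
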